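/- Let $\omega_0,\gamma,T_-,\theta>0$ and let $a,b\in\mathbb R$ satisfy $b-a=\tfrac12$, $a\le 0$, $b\ge 0$. Let $\mathcal F:\mathbb R\to\mathbb R$ be smooth and $1$-periodic with $\int_0^1\mathcal F(t)\,dt=0$ and $\int_0^1\mathcal F(t)^2\,dt>0$, and put $\tilde{\mathcal F}(\ell)=\int_0^1e^{-2\pi i\ell t}\mathcal F(t)\,dt$. For $n\ge1$ let $\theta_n=n^b\theta$ and $\mathcal F_n(t)=n^a\mathcal F(t/\theta_n)$. Consider the harmonic chain $(\mathbf q,\mathbf p)=(q_0,\dots,q_n,p_0,\dots,p_n)\in\mathbb R^{2(n+1)}$ with time-dependent generator $$\mathcal G_t f=\sum_{x=0}^n p_x\partial_{q_x}f+\sum_{x=0}^n(\Delta_{\rm N}q_x-\omega_0^2q_x)\partial_{p_x}f+\mathcal F_n(t)\partial_{p_n}f+\gamma\sum_{x=1}^n\big(f(\mathbf q,\mathbf p^x)-f(\mathbf q,\mathbf p)\big)+2\gamma\big(T_-\partial_{p_0}^2f-p_0\partial_{p_0}f\big),$$ where $\Delta_{\rm N}q_x=q_{x+1}+q_{x-1}-2q_x$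 with $q_{-1}=q_0$, $q_{n+1}=q_n$, and $\mathbf p^x$ is $\mathbf p$ with the sign of $p_x$ reversed. For each $n\ge1$ let $(\mu^{P}_t)_{t\ge0}$ be a periodic stationary state: a family of Borel probability measures on $\mathbb R^{2(n+1)}$ with $\mu^P_{t+\theta_n}=\mu^P_t$ that solves the forward equation $\partial_t\mu^P_t=\mathcal G_t^*\mu^P_t$, that is, $\frac{d}{dt}\int f\,d\mu^P_t=\int\mathcal G_tf\,d\mu^P_t$ for all $t\ge0$ (one-sided derivative at $t=0$) and all $f\in C_c^\infty(\mathbb R^{2(n+1)})$. Then, for every $n\ge1$, $p_0^2$ is $\mu^P_t$-integrable for each $t\ge0$ and the average $\langle p_0^2\rangle_n=\frac1{\theta_n}\int_0^{\theta_n}\int p_0^2\,d\mu^P_t\,dt$ is well defined and finite, and, as $n\to\infty$, $$T_--\langle p_0^2\rangle_n=\frac{J^{a,b}}{2\gamma n}+o\Big(\frac1n\Big),\qquad J^{a,b}:=-\Big(\frac{2\pi}{\theta}\Big)^2\sum_{\ell\in\mathbb Z}\ell^2\mathcal Q^{a,b}(\ell),$$ where the series converges and $$\mathcal Q^{-1/2,0}(\ell)=4\gamma|\tilde{\mathcal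 F}(\ell)|^2\int_0^1\cos^2\Big(\frac{\pi z}2\Big)\Big\{\Big[4\sin^2\Big(\frac{\pi z}2\Big)+\omega_0^2-\Big(\frac{2\pi\ell}\theta\Big)^2\Big]^2+\Big(\frac{4\gamma\pi\ell}\theta\Big)^2\Big\}^{-1}dz,$$ $$\mathcal Q^{b-1/2,b}(\ell)=4\gamma|\tilde{\mathcal F}(\ell)|^2\int_0^1\cos^2\Big(\frac{\pi z}2\Big)\Big[4\sin^2\Big(\frac{\pi z}2\Big)+\omega_0^2\Big]^{-2}dz\quad\text{when }b>0.$$ -/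

import Mathlib

open MeasureTheory Filter Asymptotics
open scoped ContDiff

noncomputable section

namespace HarmonicChain

/-- Configurations `(q, p)` of positions and momenta of the particles `0, …, n`. -/
abbrev Phase (n : ℕ) : Type := (Fin (n + 1) → ℝ) × (Fin (n + 1) → ℝ)

/-- The value `q_{x+1}`, with the convention `q_{n+1} = q_n`. -/
def rightNbr {n : ℕ} (q : Fin (n + 1) → ℝ) (x : Fin (n + 1)) : ℝ :=
  if h : x.val + 1 < n + 1 then q ⟨x.val + 1, h⟩ else q x

/-- The value `q_{x-1}`, with the convention `q_{-1} = q_0`. -/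
def leftNbr {n : ℕ} (q : Fin (n + 1) → ℝ) (x : Fin (n + 1)) : ℝ :=
  if x.val = 0 then q x else q ⟨x.val - 1, by omega⟩

/-- The Neumann discrete Laplacian on `{0, …, n}`. -/
def neumannLaplacian {n : ℕ} (q : Fin (n + 1) → ℝ) (x : Fin (n + 1)) : ℝ :=
  rightNbr q x + leftNbr q x - 2 * q x

/-- The coordinate direction of `q_x`. -/
def dirQ {n : ℕ} (x : Fin (n + 1)) : Phase n := (Pi.single x 1, 0)

/-- The coordinate direction of `p_x`. -/
def dirP {n : ℕ} (x : Fin (n + 1)) : Phase n := (0, Pi.single x 1)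

/-- The derivative of `f` in the direction `v`. -/
def pderiv {n : ℕ} (v : Phase n) (f : Phase n → ℝ) (z : Phase n) : ℝ := fderiv ℝ f z v

/-- The configuration with the sign of the momentum `p_x` reversed. -/
def flip {n : ℕ} (x : Fin (n + 1)) (z : Phase n) : Phase n :=
  (z.1, Function.update z.2 x (-z.2 x))

/-- The period `θ_n = n ^ b θ` of the force. -/
def period (θ b : ℝ) (n : ℕ) : ℝ := (n : ℝ) ^ b * θ

/-- The force `n ^ a F (t / θ_n)` acting on the last particle. -/
def force (θ a b : ℝ) (F : ℝ → ℝ) (n : ℕ) (t : ℝ) : ℝ :=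
  (n : ℝ) ^ a * F (t / period θ b n)

/-- The Liouville part of the generator, for the value `φ` of the force. -/
def liouville {n : ℕ} (ω₀ φ : ℝ) (f : Phase n → ℝ) (z : Phase n) : ℝ :=
  (∑ x, z.2 x * pderiv (dirQ x) f z)
    + (∑ x, (neumannLaplacian z.1 x - ω₀ ^ 2 * z.1 x) * pderiv (dirP x) f z)
    + φ * pderiv (dirP (Fin.last n)) f z

/-- The generator of the reversals of the momenta of the particles `1, …, n`. -/
def flipGen {n : ℕ} (f : Phase n → ℝ) (z : Phase n) : ℝ :=
  ∑ x ∈ Finset.univ.filter (fun x : Fin (n + 1) => x ≠ 0), (f (flip x z) - f z)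

/-- The generator of the Langevin thermostat at temperature `T` acting on the particle `0`. -/
def thermostat {n : ℕ} (T : ℝ) (f : Phase n → ℝ) (z : Phase n) : ℝ :=
  T * pderiv (dirP 0) (pderiv (dirP 0) f) z - z.2 0 * pderiv (dirP 0) f z

/-- The generator of the dynamics at time `t`. -/
def generator (ω₀ γ T θ a b : ℝ) (F : ℝ → ℝ) (n : ℕ) (t : ℝ) (f : Phase n → ℝ)
    (z : Phase n) : ℝ :=
  liouville ω₀ (force θ a b F n t) f z + γ * flipGen f z + 2 * γ * thermostat T f z

/-- `μ t`, `t ≥ 0`, is a periodic stationary state: a family of Borel probability measures, periodic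
with the period of the force, that solves the forward (Fokker-Planck) equation tested against
smooth compactly supported functions. The values of `μ` at negative times play no role. -/
structure IsPeriodicState (ω₀ γ T θ a b : ℝ) (F : ℝ → ℝ) (n : ℕ)
    (μ : ℝ → Measure (Phase n)) : Prop where
  prob : ∀ t, 0 ≤ t → IsProbabilityMeasure (μ t)
  periodic : ∀ t, 0 ≤ t → μ (t + period θ b n) = μ t
  forward : ∀ f : Phase n → ℝ, ContDiff ℝ ∞ f → HasCompactSupport f → ∀ t, 0 ≤ t →
    HasDerivWithinAt (fun s => ∫ z, f z ∂(μ s))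
      (∫ z, generator ω₀ γ T θ a b F n t f z ∂(μ t)) (Set.Ici 0) t

/-- The average of an observable `f` over the state and over the time interval `[0, τ]`. -/
def timeAverage {n : ℕ} (τ : ℝ) (μ : ℝ → Measure (Phase n)) (f : Phase n → ℝ) : ℝ :=
  τ⁻¹ * ∫ t in (0 : ℝ)..τ, ∫ z, f z ∂(μ t)

/-- The Fourier coefficient of `F` of index `l`, for the period `1`. -/
def fourierCoef (F : ℝ → ℝ) (l : ℤ) : ℂ :=
  ∫ t in (0 : ℝ)..1, Complex.exp (-2 * Real.pi * Complex.I * l * t) * (F t : ℂ)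

/-- The coefficients in the series for the limiting current, when `a = b - 1 / 2`. -/
def currentCoef (ω₀ γ θ b : ℝ) (F : ℝ → ℝ) (l : ℤ) : ℝ :=
  if b = 0 then
    4 * γ * ‖fourierCoef F l‖ ^ 2 *
      ∫ z in (0 : ℝ)..1, Real.cos (Real.pi * z / 2) ^ 2 *
        ((4 * Real.sin (Real.pi * z / 2) ^ 2 + ω₀ ^ 2 - (2 * Real.pi * l / θ) ^ 2) ^ 2
          + (4 * γ * Real.pi * l / θ) ^ 2)⁻¹
  else
    4 * γ * ‖fourierCoef F l‖ ^ 2 *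
      ∫ z in (0 : ℝ)..1, Real.cos (Real.pi * z / 2) ^ 2 *
        ((4 * Real.sin (Real.pi * z / 2) ^ 2 + ω₀ ^ 2) ^ 2)⁻¹

/-- The limiting current `J^{a,b}`, for `a = b - 1 / 2`. -/
def limitCurrent (ω₀ γ θ b : ℝ) (F : ℝ → ℝ) : ℝ :=
  -(2 * Real.pi / θ) ^ 2 * ∑' l : ℤ, (l : ℝ) ^ 2 * currentCoef ω₀ γ θ b F l

end HarmonicChain

end

noncomputable section

namespace HarmonicChain

/-! ### The generator in coordinate-free form -/

variable {n : ℕ}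

/-! Momentum reversals conserve the energy, so the generator maps it to `φ p_n + 2γ(T - p_0²)`
(`forcedGen_energy`). Over a period the mean energy returns to its initial value. Hence `T` minus
the averaged `p_0²` equals `-1/(2γ)` times the mean power of the force, and this power involves the
state only through the mean of `p_n`.

The reversals damp the mean momenta of the particles `1, …, n` at rate `2γ`, and the thermostat
damps that of the particle `0` at the same rate (`forcedGen_momFun`). The means therefore solve a
uniformly damped linear chain, which the Neumann cosine modes split into scalar oscillators
(`stiff_mode`, `sum_mode_last_mul_mode`). For a periodic solution, the Fourier coefficients of each
oscillator follow algebraically from those of the force (`hasSum_oscillator`). With `w = 2πl/θ_n`,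
the harmonic `l` contributes `n^(2a) |F̂(l)|² 2γw²` times a weighted average of the resonance
profile over the modes. Since `b - a = 1/2`, `n^(2a) w² = (2πl/θ)²/n`, which is the order `1/n` of
the claim. The averages over the modes are Riemann sums (`tendsto_chainResponse`). A bound on the
profile uniform in the mode and the frequency, with the decay of `F̂`, permits the limit inside the
sum over `l` (`tendsto_tsum_chainResponse`).

The analytic difficulty is that the forward equation is tested only against compactly supported
functions and no moment is assumed. A quadratic Lyapunov function is built by carrying the
dissipation of `p_0²` along the chain, one particle at a time (`dissipated_mom`, `exists_lyapunov`).
Truncating it by a concave cutoff preserves the dissipation inequality even though the reversals are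
jumps (`forcedGen_cutAt_le`). Periodicity and Fatou's lemma then give finite second moments, and
dominated convergence extends the forward equation, in integrated form, to functions of quadratic
growth (`IsForcedState.dynkin`). -/

/-- The stiffness operator `ν² - Δ` of the chain. -/
def stiff (ν : ℝ) : (Fin (n + 1) → ℝ) →L[ℝ] (Fin (n + 1) → ℝ) :=
  LinearMap.toContinuousLinearMap
    { toFun := fun q x => ν ^ 2 * q x - neumannLaplacian q x
      map_add' := by
        intro q q'
        funext x
        simp only [neumannLaplacian, rightNbr, leftNbr, Pi.add_apply]
        split_ifs <;> ring
      map_smul' := by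
        intro c q
        funext x
        simp only [neumannLaplacian, rightNbr, leftNbr, Pi.smul_apply, smul_eq_mul, RingHom.id_apply]
        split_ifs <;> ring }

theorem stiff_apply (ν : ℝ) (q : Fin (n + 1) → ℝ) (x : Fin (n + 1)) :
    stiff ν q x = ν ^ 2 * q x - neumannLaplacian q x := rfl

/-- The generator, for the value `φ` of the force. -/
def forcedGen (ν γ T φ : ℝ) (f : Phase n → ℝ) (z : Phase n) : ℝ :=
  liouville ν φ f z + γ * flipGen f z + 2 * γ * thermostat T f z

/-- The vector field of the Hamiltonian dynamics with force `φ`. -/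
def drift (ν φ : ℝ) (z : Phase n) : Phase n :=
  (z.2, -stiff ν z.1) + φ • dirP (Fin.last n)

theorem eq_sum_dir (q p : Fin (n + 1) → ℝ) :
    ((q, p) : Phase n) = ∑ x, q x • dirQ x + ∑ x, p x • dirP x := by
  refine Prod.ext ?_ ?_
  · funext y
    simp [dirQ, dirP, Prod.fst_sum, Finset.sum_apply, Pi.single_apply]
  · funext y
    simp [dirQ, dirP, Prod.snd_sum, Finset.sum_apply, Pi.single_apply]

/-- Written as one directional derivative, the Liouville part inherits the Leibniz and chain rules
directly from `fderiv`. -/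
theorem liouville_eq (ν φ : ℝ) (f : Phase n → ℝ) (z : Phase n) :
    liouville ν φ f z = fderiv ℝ f z (drift ν φ z) := by
  rw [drift, eq_sum_dir]
  simp only [map_add, map_sum, map_smul, liouville, pderiv, smul_eq_mul, Pi.neg_apply, stiff_apply,
    neg_sub]

theorem liouville_eq_add (ν φ : ℝ) (f : Phase n → ℝ) (z : Phase n) :
    liouville ν φ f z = liouville ν 0 f z + φ * pderiv (dirP (Fin.last n)) f z := by
  simp [liouville]

/-- Isolates the only term that varies in time, so that most estimates can be made at zero force. -/
theorem forcedGen_eq_add (ν γ T φ : ℝ) (f : Phase n → ℝ) (z : Phase n) :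
    forcedGen ν γ T φ f z = forcedGen ν γ T 0 f z + φ * pderiv (dirP (Fin.last n)) f z := by
  rw [forcedGen, liouville_eq_add, forcedGen]
  ring

/-! ### Algebraic rules for the generator -/

section Rules

variable {f g : Phase n → ℝ}

theorem pderiv_contDiff (hf : ContDiff ℝ ∞ f) (v : Phase n) : ContDiff ℝ ∞ (pderiv v f) :=
  (hf.fderiv_right (m := ∞) (by simp)).clm_apply contDiff_const

theorem smooth_differentiable (hf : ContDiff ℝ ∞ f) : Differentiable ℝ f :=
  hf.differentiable (by simp)

theorem pderiv_add (hf : ContDiff ℝ ∞ f) (hg : ContDiff ℝ ∞ g) (v : Phase n) :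
    pderiv v (fun z => f z + g z) = fun z => pderiv v f z + pderiv v g z := by
  funext z
  simp only [pderiv]
  rw [fderiv_fun_add (smooth_differentiable hf z) (smooth_differentiable hg z)]
  simp

theorem pderiv_mul (hf : ContDiff ℝ ∞ f) (hg : ContDiff ℝ ∞ g) (v : Phase n) :
    pderiv v (fun z => f z * g z) = fun z => f z * pderiv v g z + g z * pderiv v f z := by
  funext z
  simp only [pderiv]
  rw [fderiv_fun_mul (smooth_differentiable hf z) (smooth_differentiable hg z)]
  simp

theorem pderiv_const (c : ℝ) (v : Phase n) : pderiv v (fun _ => c) = fun _ => 0 := by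
  funext z
  simp [pderiv]

theorem pderiv_clm (L : Phase n →L[ℝ] ℝ) (v : Phase n) : pderiv v L = fun _ => L v := by
  funext z
  simp [pderiv]

theorem forcedGen_add (ν γ T φ : ℝ) (hf : ContDiff ℝ ∞ f) (hg : ContDiff ℝ ∞ g) (z : Phase n) :
    forcedGen ν γ T φ (fun z => f z + g z) z = forcedGen ν γ T φ f z + forcedGen ν γ T φ g z := by
  have hL : liouville ν φ (fun z => f z + g z) z = liouville ν φ f z + liouville ν φ g z := by
    simp only [liouville_eq]
    exact congrFun (pderiv_add hf hg (drift ν φ z)) z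
  have hS : flipGen (fun z => f z + g z) z = flipGen f z + flipGen g z := by
    simp only [flipGen, ← Finset.sum_add_distrib]
    exact Finset.sum_congr rfl fun x _ => by ring
  have hT : thermostat T (fun z => f z + g z) z = thermostat T f z + thermostat T g z := by
    simp only [thermostat]
    rw [pderiv_add hf hg, pderiv_add (pderiv_contDiff hf _) (pderiv_contDiff hg _)]
    ring
  simp only [forcedGen, hL, hS, hT]
  ring

theorem forcedGen_const (ν γ T φ c : ℝ) (z : Phase n) :
    forcedGen ν γ T φ (fun _ => c) z = 0 := by
  simp [forcedGen, liouville, flipGen, thermostat, pderiv_const]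

/-- The carré du champ of the generator. -/
def carre (γ T : ℝ) (f g : Phase n → ℝ) (z : Phase n) : ℝ :=
  4 * γ * T * (pderiv (dirP 0) f z * pderiv (dirP 0) g z)
    + γ * ∑ x ∈ Finset.univ.filter (fun x : Fin (n + 1) => x ≠ 0),
        (f (flip x z) - f z) * (g (flip x z) - g z)

/-- The first-order part is a derivation. The defect `carre` comes from the second derivative of the
thermostat and from the jumps. -/
theorem forcedGen_mul (ν γ T φ : ℝ) (hf : ContDiff ℝ ∞ f) (hg : ContDiff ℝ ∞ g) (z : Phase n) :
    forcedGen ν γ T φ (fun z => f z * g z) z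
      = f z * forcedGen ν γ T φ g z + g z * forcedGen ν γ T φ f z + carre γ T f g z := by
  have hpf := pderiv_contDiff hf (dirP 0)
  have hpg := pderiv_contDiff hg (dirP 0)
  have hL : liouville ν φ (fun z => f z * g z) z
      = f z * liouville ν φ g z + g z * liouville ν φ f z := by
    simp only [liouville_eq]
    exact congrFun (pderiv_mul hf hg (drift ν φ z)) z
  have hS : flipGen (fun z => f z * g z) z = f z * flipGen g z + g z * flipGen f z
      + ∑ x ∈ Finset.univ.filter (fun x : Fin (n + 1) => x ≠ 0),
        (f (flip x z) - f z) * (g (flip x z) - g z) := by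
    simp only [flipGen, Finset.mul_sum, ← Finset.sum_add_distrib]
    refine Finset.sum_congr rfl fun x _ => by ring
  have hT : thermostat T (fun z => f z * g z) z = f z * thermostat T g z + g z * thermostat T f z
      + 2 * T * (pderiv (dirP 0) f z * pderiv (dirP 0) g z) := by
    simp only [thermostat]
    rw [pderiv_mul hf hg, pderiv_add (hf.mul hpg) (hg.mul hpf), pderiv_mul hf hpg,
      pderiv_mul hg hpf]
    ring
  simp only [forcedGen, carre, hL, hS, hT]
  ring

theorem forcedGen_const_mul (ν γ T φ c : ℝ) (hf : ContDiff ℝ ∞ f) (z : Phase n) :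
    forcedGen ν γ T φ (fun z => c * f z) z = c * forcedGen ν γ T φ f z := by
  have := forcedGen_mul ν γ T φ (contDiff_const (c := c)) hf z
  rw [this, forcedGen_const]
  simp [carre, pderiv_const]

theorem forcedGen_sum (ν γ T φ : ℝ) {ι : Type*} (s : Finset ι) (f : ι → Phase n → ℝ)
    (hf : ∀ i, ContDiff ℝ ∞ (f i)) (z : Phase n) :
    forcedGen ν γ T φ (fun z => ∑ i ∈ s, f i z) z = ∑ i ∈ s, forcedGen ν γ T φ (f i) z := by
  classical
  induction s using Finset.induction_on with
  | empty => simp [forcedGen_const]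
  | insert i s hi ih =>
    simp only [Finset.sum_insert hi]
    rw [forcedGen_add ν γ T φ (hf i) (ContDiff.sum fun i _ => hf i), ih]

/-- The chain rule for the generator. -/
theorem forcedGen_comp (ν γ T φ : ℝ) {χ : ℝ → ℝ} (hχ : ContDiff ℝ ∞ χ) (hf : ContDiff ℝ ∞ f)
    (z : Phase n) :
    forcedGen ν γ T φ (fun z => χ (f z)) z
      = deriv χ (f z) * forcedGen ν γ T φ f z
        + 2 * γ * T * deriv (deriv χ) (f z) * pderiv (dirP 0) f z ^ 2
        + γ * ∑ x ∈ Finset.univ.filter (fun x : Fin (n + 1) => x ≠ 0),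
          (χ (f (flip x z)) - χ (f z) - deriv χ (f z) * (f (flip x z) - f z)) := by
  have hχ1 : Differentiable ℝ χ := hχ.differentiable (by simp)
  have hχ' : ContDiff ℝ ∞ (deriv χ) := by
    simpa using (contDiff_infty_iff_deriv.1 hχ).2
  have hχ2 : Differentiable ℝ (deriv χ) := hχ'.differentiable (by simp)
  have hd : ∀ {χ : ℝ → ℝ} (_ : Differentiable ℝ χ) (v : Phase n),
      pderiv v (fun z => χ (f z)) = fun z => deriv χ (f z) * pderiv v f z := by
    intro χ h v
    funext z
    simp only [pderiv]
    have := ((h (f z)).hasDerivAt.comp_hasFDerivAt z (smooth_differentiable hf z).hasFDerivAt).fderiv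
    rw [Function.comp_def] at this
    rw [this]
    simp
  have hL : liouville ν φ (fun z => χ (f z)) z = deriv χ (f z) * liouville ν φ f z := by
    simp only [liouville_eq]
    exact congrFun (hd hχ1 _) z
  have hT : thermostat T (fun z => χ (f z)) z = deriv χ (f z) * thermostat T f z
      + T * deriv (deriv χ) (f z) * pderiv (dirP 0) f z ^ 2 := by
    simp only [thermostat]
    rw [hd hχ1, pderiv_mul (f := fun z => deriv χ (f z)) (hχ'.comp hf) (pderiv_contDiff hf _), hd hχ2]
    ring
  simp only [forcedGen, hL, hT, flipGen, Finset.sum_sub_distrib, ← Finset.mul_sum]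
  ring

end Rules

/-! ### The generator on linear and quadratic functions -/

section Linear

/-- A linear functional of the positions. -/
def posFun (l : (Fin (n + 1) → ℝ) →L[ℝ] ℝ) : Phase n →L[ℝ] ℝ :=
  l.comp (ContinuousLinearMap.fst ℝ _ _)

/-- A linear functional of the momenta. -/
def momFun (l : (Fin (n + 1) → ℝ) →L[ℝ] ℝ) : Phase n →L[ℝ] ℝ :=
  l.comp (ContinuousLinearMap.snd ℝ _ _)

@[simp] theorem posFun_apply (l : (Fin (n + 1) → ℝ) →L[ℝ] ℝ) (z : Phase n) :
    posFun l z = l z.1 := rfl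

@[simp] theorem momFun_apply (l : (Fin (n + 1) → ℝ) →L[ℝ] ℝ) (z : Phase n) :
    momFun l z = l z.2 := rfl

theorem update_neg_eq (p : Fin (n + 1) → ℝ) (x : Fin (n + 1)) :
    Function.update p x (-p x) = p - (2 * p x) • Pi.single x (1 : ℝ) := by
  funext y
  by_cases h : y = x
  · subst h
    simp
    ring
  · simp [h]

theorem pi_eq_sum_smul (p : Fin (n + 1) → ℝ) : p = ∑ x, p x • Pi.single x (1 : ℝ) := by
  funext y
  simp [Finset.sum_apply, Pi.single_apply]

theorem forcedGen_posFun (ν γ T φ : ℝ) (l : (Fin (n + 1) → ℝ) →L[ℝ] ℝ) (z : Phase n) :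
    forcedGen ν γ T φ (posFun l) z = l z.2 := by
  simp only [forcedGen, liouville_eq, flipGen, thermostat, pderiv_clm, pderiv_const]
  simp [drift, dirP, flip]

/-- A reversal changes `p_x` by `-2 p_x`, which yields the damping `-2γ p_x` for `x ≠ 0`; the
thermostat yields `-2γ p_0`. The equality of the two rates later lets the normal modes decouple. -/
theorem forcedGen_momFun (ν γ T φ : ℝ) (l : (Fin (n + 1) → ℝ) →L[ℝ] ℝ) (z : Phase n) :
    forcedGen ν γ T φ (momFun l) z
      = -l (stiff ν z.1) - 2 * γ * l z.2 + φ * l (Pi.single (Fin.last n) 1) := by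
  have hp : l z.2 = ∑ x, z.2 x * l (Pi.single x 1) := by
    conv_lhs => rw [pi_eq_sum_smul z.2]
    simp
  have hs : ∑ x ∈ Finset.univ.filter (fun x : Fin (n + 1) => x ≠ 0), z.2 x * l (Pi.single x 1)
      = l z.2 - z.2 0 * l (Pi.single 0 1) := by
    rw [hp, Finset.filter_ne', Finset.sum_erase_eq_sub (Finset.mem_univ _)]
  have hf : flipGen (momFun l) z = -2 * (l z.2 - z.2 0 * l (Pi.single 0 1)) := by
    rw [← hs, Finset.mul_sum]
    refine Finset.sum_congr rfl fun x _ => ?_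
    simp only [momFun_apply, flip, update_neg_eq, map_sub, map_smul, smul_eq_mul]
    ring
  simp only [forcedGen, hf, liouville_eq, thermostat, pderiv_clm, pderiv_const]
  simp only [drift, ContinuousLinearMap.fderiv, map_add, map_smul, momFun_apply, map_neg, dirP,
    smul_eq_mul]
  ring

theorem carre_posFun (γ T : ℝ) (l : (Fin (n + 1) → ℝ) →L[ℝ] ℝ) (g : Phase n → ℝ) (z : Phase n) :
    carre γ T (posFun l) g z = 0 := by
  simp [carre, pderiv_clm, dirP, flip]

theorem forcedGen_pos_mul_pos (ν γ T φ : ℝ) (l m : (Fin (n + 1) → ℝ) →L[ℝ] ℝ) (z : Phase n) :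
    forcedGen ν γ T φ (fun z => l z.1 * m z.1) z = l z.1 * m z.2 + m z.1 * l z.2 := by
  have h := forcedGen_mul ν γ T φ (posFun l).contDiff (posFun m).contDiff z
  rw [forcedGen_posFun, forcedGen_posFun, carre_posFun, add_zero] at h
  exact h

theorem forcedGen_pos_mul_mom (ν γ T φ : ℝ) (l m : (Fin (n + 1) → ℝ) →L[ℝ] ℝ) (z : Phase n) :
    forcedGen ν γ T φ (fun z => l z.1 * m z.2) z
      = l z.1 * (-m (stiff ν z.1) - 2 * γ * m z.2 + φ * m (Pi.single (Fin.last n) 1))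
        + m z.2 * l z.2 := by
  have h := forcedGen_mul ν γ T φ (posFun l).contDiff (momFun m).contDiff z
  rw [forcedGen_posFun, forcedGen_momFun, carre_posFun, add_zero] at h
  exact h

/-- The coordinate functionals. -/
abbrev coord (x : Fin (n + 1)) : (Fin (n + 1) → ℝ) →L[ℝ] ℝ := ContinuousLinearMap.proj x

theorem forcedGen_mom_sq (ν γ T φ : ℝ) (x : Fin (n + 1)) (z : Phase n) :
    forcedGen ν γ T φ (fun z => z.2 x * z.2 x) z
      = -2 * z.2 x * stiff ν z.1 x + 2 * φ * z.2 x * (if x = Fin.last n then 1 else 0)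
        + (if x = 0 then 4 * γ * (T - z.2 0 ^ 2) else 0) := by
  have h := forcedGen_mul ν γ T φ (momFun (coord x)).contDiff (momFun (coord x)).contDiff z
  simp only [forcedGen_momFun, momFun_apply, ContinuousLinearMap.proj_apply] at h
  rw [h]
  -- For `x ≠ 0` the value `4γ p_x²` cancels the damping of `p_x²` exactly: reversals preserve
  -- squares.
  have hc : carre γ T (momFun (coord x)) (momFun (coord x)) z
      = if x = 0 then 4 * γ * T else 4 * γ * z.2 x ^ 2 := by
    simp only [carre, pderiv_clm, momFun_apply, ContinuousLinearMap.proj_apply, flip, dirP]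
    by_cases hx : x = 0
    · subst hx
      have : ∀ y ∈ Finset.univ.filter (fun x : Fin (n + 1) => x ≠ 0),
          (Function.update z.2 y (-z.2 y) 0 - z.2 0) * (Function.update z.2 y (-z.2 y) 0 - z.2 0)
            = 0 := by
        intro y hy
        have hy' : (0 : Fin (n + 1)) ≠ y := Ne.symm (Finset.mem_filter.1 hy).2
        simp [Function.update_of_ne hy']
      rw [Finset.sum_eq_zero this]
      simp
    · rw [Finset.sum_eq_single x]
      · simp [hx]
        ring
      · intro y _ hy
        simp [Function.update_of_ne (Ne.symm hy)]
      · intro h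
        simp [hx] at h
  rw [hc]
  have hs : (Pi.single (Fin.last n) (1 : ℝ) : Fin (n + 1) → ℝ) x
      = if x = Fin.last n then 1 else 0 := by
    simp [Pi.single_apply]
  rw [hs]
  by_cases hx : x = 0
  · subst hx
    simp only [if_true]
    ring
  · simp only [hx, if_false]
    ring

end Linear

/-! ### Symmetry and positivity of the stiffness operator -/

section Symmetry

theorem rightNbr_castSucc (q : Fin (n + 1) → ℝ) (i : Fin n) :
    rightNbr q i.castSucc = q i.succ := by
  simp [rightNbr, Fin.succ]

theorem rightNbr_last (q : Fin (n + 1) → ℝ) : rightNbr q (Fin.last n) = q (Fin.last n) := by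
  simp [rightNbr]

theorem leftNbr_succ (q : Fin (n + 1) → ℝ) (i : Fin n) : leftNbr q i.succ = q i.castSucc := by
  simp only [leftNbr, Fin.val_succ, Nat.add_eq_zero_iff, one_ne_zero, and_false, if_false]
  rfl

theorem leftNbr_zero (q : Fin (n + 1) → ℝ) : leftNbr q 0 = q 0 := by
  simp [leftNbr]

/-- Summation by parts. -/
theorem sum_mul_stiff (ν : ℝ) (u v : Fin (n + 1) → ℝ) :
    ∑ x, u x * stiff ν v x = ν ^ 2 * ∑ x, u x * v x
      + ∑ i : Fin n, (u i.succ - u i.castSucc) * (v i.succ - v i.castSucc) := by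
  have h1 : ∑ x, u x * rightNbr v x
      = ∑ i : Fin n, u i.castSucc * v i.succ + u (Fin.last n) * v (Fin.last n) := by
    simp [Fin.sum_univ_castSucc, rightNbr_castSucc, rightNbr_last]
  have h2 : ∑ x, u x * leftNbr v x
      = u 0 * v 0 + ∑ i : Fin n, u i.succ * v i.castSucc := by
    simp [Fin.sum_univ_succ, leftNbr_succ, leftNbr_zero]
  have h3 := Fin.sum_univ_castSucc (fun x => u x * v x)
  have h4 := Fin.sum_univ_succ (fun x => u x * v x)
  have h5 : ∑ x, u x * stiff ν v x = ν ^ 2 * ∑ x, u x * v x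
      - (∑ x, u x * rightNbr v x + ∑ x, u x * leftNbr v x - 2 * ∑ x, u x * v x) := by
    simp only [stiff_apply, neumannLaplacian, Finset.mul_sum, ← Finset.sum_add_distrib,
      ← Finset.sum_sub_distrib]
    exact Finset.sum_congr rfl fun x _ => by ring
  have h6 : ∑ i : Fin n, (u i.succ - u i.castSucc) * (v i.succ - v i.castSucc)
      = ∑ i : Fin n, u i.succ * v i.succ + ∑ i : Fin n, u i.castSucc * v i.castSucc
        - ∑ i : Fin n, u i.castSucc * v i.succ - ∑ i : Fin n, u i.succ * v i.castSucc := by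
    simp only [← Finset.sum_add_distrib, ← Finset.sum_sub_distrib]
    exact Finset.sum_congr rfl fun x _ => by ring
  rw [h5, h6, h1, h2]
  linarith

theorem sum_mul_stiff_comm (ν : ℝ) (u v : Fin (n + 1) → ℝ) :
    ∑ x, u x * stiff ν v x = ∑ x, v x * stiff ν u x := by
  rw [sum_mul_stiff, sum_mul_stiff]
  simp only [mul_comm]

theorem le_sum_mul_stiff (ν : ℝ) (u : Fin (n + 1) → ℝ) :
    ν ^ 2 * ∑ x, u x ^ 2 ≤ ∑ x, u x * stiff ν u x := by
  rw [sum_mul_stiff]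
  have : 0 ≤ ∑ i : Fin n, (u i.succ - u i.castSucc) * (u i.succ - u i.castSucc) :=
    Finset.sum_nonneg fun i _ => mul_self_nonneg _
  simp only [pow_two] at *
  linarith

/-- The three-term recursion by which control at a site, at its left neighbour and of the stiffness
at that site passes to the next site. -/
theorem apply_succ_eq (ν : ℝ) (v : Fin (n + 1) → ℝ) (i : Fin n) :
    v i.succ = (ν ^ 2 + 2) * v i.castSucc - leftNbr v i.castSucc - stiff ν v i.castSucc := by
  rw [stiff_apply, neumannLaplacian, rightNbr_castSucc]
  ring

end Symmetry

/-! ### Energy and its balance -/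

section Energy

/-- The energy of the chain. -/
def energy (ν : ℝ) (z : Phase n) : ℝ :=
  1 / 2 * ∑ x, (z.2 x * z.2 x + z.1 x * stiff ν z.1 x)

theorem contDiff_mom_sq (x : Fin (n + 1)) : ContDiff ℝ ∞ fun z : Phase n => z.2 x * z.2 x :=
  (momFun (coord x)).contDiff.mul (momFun (coord x)).contDiff

theorem contDiff_pos_mul_stiff (ν : ℝ) (x : Fin (n + 1)) :
    ContDiff ℝ ∞ fun z : Phase n => z.1 x * stiff ν z.1 x :=
  (posFun (coord x)).contDiff.mul (posFun ((coord x).comp (stiff ν))).contDiff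

theorem contDiff_energy (ν : ℝ) : ContDiff ℝ ∞ (energy (n := n) ν) :=
  contDiff_const.mul (ContDiff.sum fun x _ =>
    (contDiff_mom_sq x).add (contDiff_pos_mul_stiff ν x))

theorem forcedGen_energy (ν γ T φ : ℝ) (z : Phase n) :
    forcedGen ν γ T φ (energy ν) z = φ * z.2 (Fin.last n) + 2 * γ * (T - z.2 0 ^ 2) := by
  have hsum : forcedGen ν γ T φ (energy ν) z = 1 / 2 * ∑ x : Fin (n + 1),
      (forcedGen ν γ T φ (fun z => z.2 x * z.2 x) z
        + forcedGen ν γ T φ (fun z => z.1 x * stiff ν z.1 x) z) := by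
    unfold energy
    rw [forcedGen_const_mul _ _ _ _ _ (ContDiff.sum fun x _ =>
      (contDiff_mom_sq x).add (contDiff_pos_mul_stiff ν x)),
      forcedGen_sum _ _ _ _ _ _ (fun x => (contDiff_mom_sq x).add (contDiff_pos_mul_stiff ν x))]
    simp only [forcedGen_add _ _ _ _ (contDiff_mom_sq _) (contDiff_pos_mul_stiff ν _)]
  have hq : ∀ x : Fin (n + 1), forcedGen ν γ T φ (fun z => z.1 x * stiff ν z.1 x) z
      = z.1 x * stiff ν z.2 x + z.2 x * stiff ν z.1 x := by
    intro x
    have := forcedGen_pos_mul_pos ν γ T φ (coord x) ((coord x).comp (stiff ν)) z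
    simp only [ContinuousLinearMap.proj_apply, ContinuousLinearMap.comp_apply] at this
    rw [this]
    ring
  rw [hsum]
  simp only [hq, forcedGen_mom_sq, Finset.sum_add_distrib]
  rw [sum_mul_stiff_comm ν z.1 z.2]
  have e1 : ∑ x : Fin (n + 1), -2 * z.2 x * stiff ν z.1 x = -2 * ∑ x, z.2 x * stiff ν z.1 x := by
    rw [Finset.mul_sum]
    exact Finset.sum_congr rfl fun x _ => by ring
  have e2 : ∑ x : Fin (n + 1), 2 * φ * z.2 x * (if x = Fin.last n then (1 : ℝ) else 0)
      = 2 * φ * z.2 (Fin.last n) := by simp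
  have e3 : ∑ x : Fin (n + 1), (if x = 0 then 4 * γ * (T - z.2 0 ^ 2) else 0)
      = 4 * γ * (T - z.2 0 ^ 2) := by simp
  rw [e1, e2, e3]
  ring

theorem le_energy (ν : ℝ) (z : Phase n) :
    1 / 2 * (∑ x, z.2 x ^ 2 + ν ^ 2 * ∑ x, z.1 x ^ 2) ≤ energy ν z := by
  have := le_sum_mul_stiff ν z.1
  rw [energy, Finset.sum_add_distrib]
  simp only [← pow_two]
  linarith

end Energy

/-! ### The generator preserves test functions -/

section CompactSupport

theorem flip_eq (x : Fin (n + 1)) (z : Phase n) :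
    flip x z = z - ((0 : Fin (n + 1) → ℝ), (2 * z.2 x) • Pi.single x (1 : ℝ)) := by
  rw [flip, update_neg_eq]
  refine Prod.ext ?_ ?_ <;> simp

theorem flip_flip (x : Fin (n + 1)) (z : Phase n) : flip x (flip x z) = z := by
  simp [flip]

theorem contDiff_flip (x : Fin (n + 1)) : ContDiff ℝ ∞ (flip (n := n) x) := by
  have : flip (n := n) x
      = fun z => z - ((0 : Fin (n + 1) → ℝ), (2 * z.2 x) • Pi.single x (1 : ℝ)) :=
    funext (flip_eq x)
  rw [this]
  have h : ContDiff ℝ ∞ fun z : Phase n => z.2 x := (momFun (coord x)).contDiff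
  exact contDiff_id.sub (contDiff_const.prodMk ((contDiff_const.mul h).smul contDiff_const))

/-- The reversal of a momentum, as a homeomorphism. -/
def flipHomeo (x : Fin (n + 1)) : Phase n ≃ₜ Phase n where
  toFun := flip x
  invFun := flip x
  left_inv := flip_flip x
  right_inv := flip_flip x
  continuous_toFun := (contDiff_flip x).continuous
  continuous_invFun := (contDiff_flip x).continuous

theorem norm_flip (x : Fin (n + 1)) (z : Phase n) : ‖flip x z‖ = ‖z‖ := by
  have key : ∀ z : Phase n, ‖flip x z‖ ≤ ‖z‖ := by
    intro z
    rw [Prod.norm_def, Prod.norm_def]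
    refine max_le_max le_rfl ((pi_norm_le_iff_of_nonneg (norm_nonneg _)).2 fun y => ?_)
    by_cases h : y = x
    · subst h
      simpa [flip] using norm_le_pi_norm z.2 y
    · simpa [flip, h] using norm_le_pi_norm z.2 y
  refine le_antisymm (key z) ?_
  conv_lhs => rw [← flip_flip x z]
  exact key _

theorem hasCompactSupport_sum {ι : Type*} (s : Finset ι) {f : ι → Phase n → ℝ}
    (hf : ∀ i, HasCompactSupport (f i)) : HasCompactSupport fun z => ∑ i ∈ s, f i z := by
  classical
  induction s using Finset.induction_on with
  | empty =>
    simp only [Finset.sum_empty]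
    exact HasCompactSupport.zero
  | insert i s hi ih =>
    simp only [Finset.sum_insert hi]
    exact (hf i).add ih

theorem hasCompactSupport_pderiv {f : Phase n → ℝ} (hf : HasCompactSupport f) (v : Phase n) :
    HasCompactSupport (pderiv v f) :=
  hf.fderiv_apply ℝ v

theorem hasCompactSupport_forcedGen (ν γ T φ : ℝ) {f : Phase n → ℝ} (hf : HasCompactSupport f) :
    HasCompactSupport (forcedGen ν γ T φ f) := by
  have hp := hasCompactSupport_pderiv hf
  have hflip : HasCompactSupport (flipGen f) := by
    refine hasCompactSupport_sum _ fun x => ?_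
    exact (hf.comp_homeomorph (flipHomeo x)).sub hf
  have hth : HasCompactSupport (thermostat T f) := by
    exact (HasCompactSupport.mul_left (hasCompactSupport_pderiv (hp _) _)).sub (hp _).mul_left
  have hL : HasCompactSupport (liouville ν φ f) := by
    refine ((hasCompactSupport_sum _ fun x => ?_).add
      (hasCompactSupport_sum _ fun x => ?_)).add ?_
    · exact (hp _).mul_left
    · exact (hp _).mul_left
    · exact (hp _).mul_left
  exact (hL.add hflip.mul_left).add hth.mul_left

theorem contDiff_forcedGen (ν γ T φ : ℝ) {f : Phase n → ℝ} (hf : ContDiff ℝ ∞ f) :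
    ContDiff ℝ ∞ (forcedGen ν γ T φ f) := by
  have hp := pderiv_contDiff hf
  have hmom : ∀ x : Fin (n + 1), ContDiff ℝ ∞ fun z : Phase n => z.2 x :=
    fun x => (momFun (coord x)).contDiff
  have hst : ∀ x : Fin (n + 1),
      ContDiff ℝ ∞ fun z : Phase n => neumannLaplacian z.1 x - ν ^ 2 * z.1 x := by
    intro x
    have : (fun z : Phase n => neumannLaplacian z.1 x - ν ^ 2 * z.1 x)
        = -(posFun ((coord x).comp (stiff ν))) := by
      funext z
      simp [stiff_apply]
    rw [this]
    exact (-(posFun ((coord x).comp (stiff ν)))).contDiff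
  have hflip : ContDiff ℝ ∞ (flipGen f) :=
    ContDiff.sum fun x _ => (hf.comp (contDiff_flip x)).sub hf
  have hth : ContDiff ℝ ∞ (thermostat T f) :=
    (contDiff_const.mul (pderiv_contDiff (hp _) _)).sub ((hmom 0).mul (hp _))
  have hL : ContDiff ℝ ∞ (liouville ν φ f) :=
    ((ContDiff.sum fun x _ => (hmom x).mul (hp _)).add
      (ContDiff.sum fun x _ => (hst x).mul (hp _))).add (contDiff_const.mul (hp _))
  exact (hL.add (contDiff_const.mul hflip)).add (contDiff_const.mul hth)

end CompactSupport

/-! ### Functions of quadratic growth -/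

section Growth

/-- Smooth functions which grow at most quadratically, together with their derivatives. -/
structure QuadGrowth (W : Phase n → ℝ) : Prop where
  smooth : ContDiff ℝ ∞ W
  growth : W =O[⊤] fun z => 1 + ‖z‖ ^ 2
  pderiv_growth : ∀ v, pderiv v W =O[⊤] fun z => 1 + ‖z‖
  pderiv_pderiv_growth : ∀ v, pderiv v (pderiv v W) =O[⊤] fun _ => (1 : ℝ)

theorem isBigO_one_linear : (fun _ : Phase n => (1 : ℝ)) =O[⊤] fun z : Phase n => 1 + ‖z‖ := by
  refine isBigO_top.2 ⟨1, fun z => ?_⟩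
  have := norm_nonneg z
  rw [norm_one, Real.norm_of_nonneg (by positivity)]
  linarith

theorem isBigO_linear_quadratic :
    (fun z : Phase n => 1 + ‖z‖) =O[⊤] fun z : Phase n => 1 + ‖z‖ ^ 2 := by
  refine isBigO_top.2 ⟨2, fun z => ?_⟩
  rw [Real.norm_of_nonneg (by positivity), Real.norm_of_nonneg (by positivity)]
  nlinarith [sq_nonneg (‖z‖ - 1), sq_nonneg ‖z‖]

theorem isBigO_linear_mul_linear :
    (fun z : Phase n => (1 + ‖z‖) * (1 + ‖z‖)) =O[⊤] fun z : Phase n => 1 + ‖z‖ ^ 2 := by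
  refine isBigO_top.2 ⟨2, fun z => ?_⟩
  rw [Real.norm_of_nonneg (by positivity), Real.norm_of_nonneg (by positivity)]
  nlinarith [sq_nonneg (‖z‖ - 1), sq_nonneg ‖z‖]

theorem isBigO_clm (L : Phase n →L[ℝ] ℝ) : (fun z => L z) =O[⊤] fun z : Phase n => 1 + ‖z‖ := by
  refine isBigO_top.2 ⟨‖L‖, fun z => (L.le_opNorm z).trans ?_⟩
  rw [Real.norm_of_nonneg (by positivity)]
  gcongr
  linarith

theorem isBigO_const (c : ℝ) : (fun _ : Phase n => c) =O[⊤] fun _ : Phase n => (1 : ℝ) :=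
  isBigO_top.2 ⟨|c|, fun z => by simp⟩

theorem IsBigO.comp_flip {W : Phase n → ℝ} (h : W =O[⊤] fun z => 1 + ‖z‖ ^ 2)
    (x : Fin (n + 1)) : (fun z => W (flip x z)) =O[⊤] fun z => 1 + ‖z‖ ^ 2 := by
  obtain ⟨C, hC⟩ := isBigO_top.1 h
  refine isBigO_top.2 ⟨C, fun z => ?_⟩
  have := hC (flip x z)
  rwa [norm_flip] at this

namespace QuadGrowth

variable {V W : Phase n → ℝ}

theorem add (hV : QuadGrowth V) (hW : QuadGrowth W) : QuadGrowth fun z => V z + W z where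
  smooth := hV.smooth.add hW.smooth
  growth := hV.growth.add hW.growth
  pderiv_growth v := by
    rw [pderiv_add hV.smooth hW.smooth]
    exact (hV.pderiv_growth v).add (hW.pderiv_growth v)
  pderiv_pderiv_growth v := by
    rw [pderiv_add hV.smooth hW.smooth,
      pderiv_add (pderiv_contDiff hV.smooth v) (pderiv_contDiff hW.smooth v)]
    exact (hV.pderiv_pderiv_growth v).add (hW.pderiv_pderiv_growth v)

theorem pderiv_const_mul {f : Phase n → ℝ} (hf : ContDiff ℝ ∞ f) (c : ℝ) (v : Phase n) :
    pderiv v (fun z => c * f z) = fun z => c * pderiv v f z := by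
  rw [pderiv_mul contDiff_const hf, pderiv_const]
  simp

theorem const_mul (hV : QuadGrowth V) (c : ℝ) : QuadGrowth fun z => c * V z where
  smooth := contDiff_const.mul hV.smooth
  growth := hV.growth.const_mul_left c
  pderiv_growth v := by
    rw [pderiv_const_mul hV.smooth]
    exact (hV.pderiv_growth v).const_mul_left c
  pderiv_pderiv_growth v := by
    rw [pderiv_const_mul hV.smooth, pderiv_const_mul (pderiv_contDiff hV.smooth v)]
    exact (hV.pderiv_pderiv_growth v).const_mul_left c

theorem const (c : ℝ) : QuadGrowth fun _ : Phase n => c where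
  smooth := contDiff_const
  growth := (isBigO_const c).trans (isBigO_one_linear.trans isBigO_linear_quadratic)
  pderiv_growth v := by
    rw [pderiv_const]
    exact (isBigO_const 0).trans isBigO_one_linear
  pderiv_pderiv_growth v := by
    rw [pderiv_const, pderiv_const]
    exact isBigO_const 0

theorem sum {ι : Type*} (s : Finset ι) {f : ι → Phase n → ℝ} (hf : ∀ i, QuadGrowth (f i)) :
    QuadGrowth fun z => ∑ i ∈ s, f i z := by
  classical
  induction s using Finset.induction_on with
  | empty => simpa using const 0
  | insert i s hi ih =>
    simp only [Finset.sum_insert hi]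
    exact (hf i).add ih

theorem clm (L : Phase n →L[ℝ] ℝ) : QuadGrowth fun z => L z where
  smooth := L.contDiff
  growth := (isBigO_clm L).trans isBigO_linear_quadratic
  pderiv_growth v := by
    rw [pderiv_clm]
    exact (isBigO_const _).trans isBigO_one_linear
  pderiv_pderiv_growth v := by
    rw [pderiv_clm, pderiv_const]
    exact isBigO_const 0

theorem clm_mul_clm (L M : Phase n →L[ℝ] ℝ) : QuadGrowth fun z => L z * M z where
  smooth := L.contDiff.mul M.contDiff
  growth := ((isBigO_clm L).mul (isBigO_clm M)).trans isBigO_linear_mul_linear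
  pderiv_growth v := by
    rw [pderiv_mul L.contDiff M.contDiff, pderiv_clm, pderiv_clm]
    simp only [mul_comm _ (M v), mul_comm _ (L v)]
    exact ((isBigO_clm L).const_mul_left _).add ((isBigO_clm M).const_mul_left _)
  pderiv_pderiv_growth v := by
    have : pderiv v (fun z => L z * M z) = fun z => (M v • L + L v • M) z := by
      rw [pderiv_mul L.contDiff M.contDiff, pderiv_clm, pderiv_clm]
      funext z
      simp [mul_comm]
    rw [this, pderiv_clm]
    exact isBigO_const _

theorem forcedGen_zero_growth (hW : QuadGrowth W) (ν γ T : ℝ) :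
    forcedGen ν γ T 0 W =O[⊤] fun z => 1 + ‖z‖ ^ 2 := by
  have h1 : ∀ (L : Phase n →L[ℝ] ℝ) (v : Phase n),
      (fun z => L z * pderiv v W z) =O[⊤] fun z => 1 + ‖z‖ ^ 2 := fun L v =>
    ((isBigO_clm L).mul (hW.pderiv_growth v)).trans isBigO_linear_mul_linear
  have hL : (fun z => liouville ν 0 W z) =O[⊤] fun z => 1 + ‖z‖ ^ 2 := by
    simp only [liouville, zero_mul, add_zero]
    refine (IsBigO.fun_sum fun x _ => h1 (momFun (coord x)) (dirQ x)).add
      (IsBigO.fun_sum fun x _ => ?_)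
    have := h1 (-(posFun ((coord x).comp (stiff ν)))) (dirP x)
    simpa [stiff_apply] using this
  have hS : (fun z => flipGen W z) =O[⊤] fun z => 1 + ‖z‖ ^ 2 :=
    IsBigO.fun_sum fun x _ => (IsBigO.comp_flip hW.growth x).sub hW.growth
  have hT : (fun z => thermostat T W z) =O[⊤] fun z => 1 + ‖z‖ ^ 2 := by
    refine IsBigO.sub ?_ (h1 (momFun (coord 0)) (dirP 0))
    exact ((hW.pderiv_pderiv_growth _).const_mul_left T).trans
      (isBigO_one_linear.trans isBigO_linear_quadratic)
  exact (hL.add (hS.const_mul_left γ)).add (hT.const_mul_left (2 * γ))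

end QuadGrowth

theorem quadGrowth_energy (ν : ℝ) : QuadGrowth (energy (n := n) ν) :=
  (QuadGrowth.sum _ fun x =>
    (QuadGrowth.clm_mul_clm (momFun (coord x)) (momFun (coord x))).add
      (QuadGrowth.clm_mul_clm (posFun (coord x)) (posFun ((coord x).comp (stiff ν))))).const_mul _

/-- The square of the Euclidean norm. -/
def sqNorm (z : Phase n) : ℝ := ∑ x, z.1 x ^ 2 + ∑ x, z.2 x ^ 2

theorem sqNorm_nonneg (z : Phase n) : 0 ≤ sqNorm z := by
  unfold sqNorm
  positivity

theorem norm_sq_le_sqNorm (z : Phase n) : ‖z‖ ^ 2 ≤ sqNorm z := by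
  have key : ∀ q : Fin (n + 1) → ℝ, ‖q‖ ^ 2 ≤ ∑ x, q x ^ 2 := by
    intro q
    rw [← Real.le_sqrt (norm_nonneg _) (by positivity)]
    refine (pi_norm_le_iff_of_nonneg (Real.sqrt_nonneg _)).2 fun x => Real.abs_le_sqrt ?_
    exact Finset.single_le_sum (f := fun x => q x ^ 2) (fun _ _ => sq_nonneg _) (Finset.mem_univ x)
  have h1 := key z.1
  have h2 := key z.2
  have h1' : 0 ≤ ∑ x, z.1 x ^ 2 := by positivity
  have h2' : 0 ≤ ∑ x, z.2 x ^ 2 := by positivity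
  rw [Prod.norm_def, sqNorm]
  rcases max_cases ‖z.1‖ ‖z.2‖ with ⟨h, -⟩ | ⟨h, -⟩ <;> rw [h] <;> linarith

theorem sq_clm_le (L : Phase n →L[ℝ] ℝ) (z : Phase n) : L z ^ 2 ≤ ‖L‖ ^ 2 * sqNorm z := by
  have h := L.le_opNorm z
  calc L z ^ 2 = ‖L z‖ ^ 2 := by simp
    _ ≤ (‖L‖ * ‖z‖) ^ 2 := by gcongr
    _ = ‖L‖ ^ 2 * ‖z‖ ^ 2 := by ring
    _ ≤ _ := by gcongr; exact norm_sq_le_sqNorm z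

end Growth

/-! ### Propagation of dissipation and the Lyapunov function -/

section Lyapunov

variable {ν γ T : ℝ} {g h : Phase n → ℝ}

/-- The quadratic form `g` is dissipated, up to arbitrarily small quadratic errors. -/
def Dissipated (ν γ T : ℝ) (g : Phase n → ℝ) : Prop :=
  ∀ ε > 0, ∃ Q : Phase n → ℝ, ∃ C : ℝ, QuadGrowth Q ∧
    ∀ z, forcedGen ν γ T 0 Q z ≤ -g z + ε * sqNorm z + C

theorem Dissipated.mono (hg : Dissipated ν γ T g) (hgh : ∀ z, h z ≤ g z) :
    Dissipated ν γ T h := by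
  intro ε hε
  obtain ⟨Q, C, hQ, hz⟩ := hg ε hε
  exact ⟨Q, C, hQ, fun z => (hz z).trans (by linarith [hgh z])⟩

/-- The constant `K` may blow up as `ε → 0`: it is fixed first, and `h` is then dissipated up to the
error `ε / (2(K + 1))`. This order of choices makes dissipation propagate. -/
theorem Dissipated.of_le (hh : Dissipated ν γ T h)
    (H : ∀ ε > 0, ∃ Q : Phase n → ℝ, ∃ K C : ℝ, 0 ≤ K ∧ QuadGrowth Q ∧
      ∀ z, forcedGen ν γ T 0 Q z ≤ -g z + K * h z + ε * sqNorm z + C) :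
    Dissipated ν γ T g := by
  intro ε hε
  obtain ⟨Q, K, C, hK, hQ, hz⟩ := H (ε / 2) (half_pos hε)
  obtain ⟨R, D, hR, hw⟩ := hh (ε / 2 / (K + 1)) (by positivity)
  refine ⟨fun z => Q z + K * R z, C + K * D, hQ.add (hR.const_mul K), fun z => ?_⟩
  rw [forcedGen_add _ _ _ _ hQ.smooth (hR.const_mul K).smooth,
    forcedGen_const_mul _ _ _ _ _ hR.smooth]
  have h1 := hz z
  have h2 := mul_le_mul_of_nonneg_left (hw z) hK
  have h3 : K * (ε / 2 / (K + 1) * sqNorm z) ≤ ε / 2 * sqNorm z := by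
    have : K * (ε / 2 / (K + 1)) ≤ ε / 2 := by
      rw [mul_div_assoc', div_le_iff₀ (by positivity)]
      nlinarith
    calc _ = K * (ε / 2 / (K + 1)) * sqNorm z := by ring
      _ ≤ _ := mul_le_mul_of_nonneg_right this (sqNorm_nonneg z)
  nlinarith

theorem Dissipated.add (hg : Dissipated ν γ T g) (hh : Dissipated ν γ T h) :
    Dissipated ν γ T fun z => g z + h z := by
  intro ε hε
  obtain ⟨Q, C, hQ, hz⟩ := hg (ε / 2) (half_pos hε)
  obtain ⟨R, D, hR, hw⟩ := hh (ε / 2) (half_pos hε)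
  refine ⟨fun z => Q z + R z, C + D, hQ.add hR, fun z => ?_⟩
  rw [forcedGen_add _ _ _ _ hQ.smooth hR.smooth]
  linarith [hz z, hw z]

theorem Dissipated.const_mul (hg : Dissipated ν γ T g) {K : ℝ} (hK : 0 ≤ K) :
    Dissipated ν γ T fun z => K * g z := by
  refine hg.of_le fun ε hε => ⟨fun _ => 0, K, 0, hK, QuadGrowth.const 0, fun z => ?_⟩
  rw [forcedGen_const]
  nlinarith [sqNorm_nonneg z]

theorem Dissipated.zero : Dissipated (n := n) ν γ T fun _ => 0 := by
  refine fun ε hε => ⟨fun _ => 0, 0, QuadGrowth.const 0, fun z => ?_⟩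
  rw [forcedGen_const]
  nlinarith [sqNorm_nonneg z]

theorem Dissipated.sum {ι : Type*} (s : Finset ι) {f : ι → Phase n → ℝ}
    (hf : ∀ i, Dissipated ν γ T (f i)) : Dissipated ν γ T fun z => ∑ i ∈ s, f i z := by
  classical
  induction s using Finset.induction_on with
  | empty => simpa using Dissipated.zero
  | insert i s hi ih =>
    simp only [Finset.sum_insert hi]
    exact (hf i).add ih

theorem dissipated_mom_zero (hγ : 0 < γ) :
    Dissipated (n := n) ν γ T fun z => z.2 0 ^ 2 := by
  refine fun ε hε => ⟨fun z => 1 / (2 * γ) * energy ν z, T, (quadGrowth_energy ν).const_mul _,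
    fun z => ?_⟩
  rw [forcedGen_const_mul _ _ _ _ _ (contDiff_energy ν), forcedGen_energy]
  have : 1 / (2 * γ) * (0 * z.2 (Fin.last n) + 2 * γ * (T - z.2 0 ^ 2)) = T - z.2 0 ^ 2 := by
    field_simp
    ring
  rw [this]
  nlinarith [sqNorm_nonneg z]

/-- Young's inequality with weight `ε / (M + 1)`; the `+ 1` avoids a separate case `M = 0`. -/
theorem two_mul_le_of_sq_le {M N a b ε : ℝ} (hε : 0 < ε) (hM : 0 ≤ M) (hN : 0 ≤ N)
    (h : b ^ 2 ≤ M * N) : 2 * a * b ≤ (M + 1) / ε * a ^ 2 + ε * N := by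
  have hδ : 0 < ε / (M + 1) := by positivity
  have h1 : 2 * a * b ≤ (ε / (M + 1))⁻¹ * a ^ 2 + ε / (M + 1) * b ^ 2 := by
    have : 0 ≤ (ε / (M + 1))⁻¹ * (a - ε / (M + 1) * b) ^ 2 := by positivity
    have e : (ε / (M + 1))⁻¹ * (a - ε / (M + 1) * b) ^ 2
        = (ε / (M + 1))⁻¹ * a ^ 2 + ε / (M + 1) * b ^ 2 - 2 * a * b := by
      field_simp
      ring
    linarith
  have h2 : ε / (M + 1) * b ^ 2 ≤ ε * N := by
    rw [div_mul_eq_mul_div, div_le_iff₀ (by positivity)]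
    nlinarith [mul_nonneg hε.le hN]
  rw [inv_div] at h1
  linarith

/-- Let `S` be the stiffness operator. The generator maps `2 (Sq)_x p_x` to `-2 (Sq)_x²` plus cross
terms. The damping term `-4γ (Sq)_x p_x` costs one `(Sq)_x²` and `4γ² p_x²`. The term `2 p_x (Sp)_x`
costs a small multiple of `sqNorm` and a large one of `p_x²`, which is already dissipated. -/
theorem dissipated_stiff_pos (x : Fin (n + 1))
    (h : Dissipated ν γ T fun z => z.2 x ^ 2) :
    Dissipated ν γ T fun z => stiff ν z.1 x ^ 2 := by
  refine h.of_le fun ε hε => ?_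
  have hM := sq_clm_le (momFun ((coord x).comp (stiff ν)))
  set M := ‖momFun ((coord x).comp (stiff ν))‖ ^ 2 with hMdef
  refine ⟨fun z => 2 * (stiff ν z.1 x * z.2 x), 4 * γ ^ 2 + (M + 1) / ε, 0, by positivity,
    (QuadGrowth.clm_mul_clm (posFun ((coord x).comp (stiff ν))) (momFun (coord x))).const_mul 2,
    fun z => ?_⟩
  rw [forcedGen_const_mul (f := fun z : Phase n => stiff ν z.1 x * z.2 x) _ _ _ _ _
    ((posFun ((coord x).comp (stiff ν))).contDiff.mul (momFun (coord x)).contDiff)]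
  have e := forcedGen_pos_mul_mom ν γ T 0 ((coord x).comp (stiff ν)) (coord x) z
  simp only [ContinuousLinearMap.proj_apply, ContinuousLinearMap.comp_apply, zero_mul,
    add_zero] at e
  rw [e]
  have h1 := two_mul_le_of_sq_le (a := z.2 x) hε (by positivity) (sqNorm_nonneg z) (hM z)
  simp only [momFun_apply, ContinuousLinearMap.comp_apply, ContinuousLinearMap.proj_apply] at h1
  nlinarith [sq_nonneg (stiff ν z.1 x + 2 * γ * z.2 x)]

/-- The same argument with `-2 (Sq)_x (Sp)_x`, whose image contains `-2 (Sp)_x²`. The remaining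
terms carry a factor `(Sq)_x`, which is already dissipated. -/
theorem dissipated_stiff_mom (x : Fin (n + 1))
    (h : Dissipated ν γ T fun z => stiff ν z.1 x ^ 2) :
    Dissipated ν γ T fun z => stiff ν z.2 x ^ 2 := by
  refine h.of_le fun ε hε => ?_
  have hM := sq_clm_le (posFun (((coord x).comp (stiff ν)).comp (stiff ν)))
  set M := ‖posFun (((coord x).comp (stiff ν)).comp (stiff ν))‖ ^ 2 with hMdef
  refine ⟨fun z => -2 * (stiff ν z.1 x * stiff ν z.2 x), 4 * γ ^ 2 + (M + 1) / ε, 0,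
    by positivity,
    (QuadGrowth.clm_mul_clm (posFun ((coord x).comp (stiff ν)))
      (momFun ((coord x).comp (stiff ν)))).const_mul (-2), fun z => ?_⟩
  rw [forcedGen_const_mul (f := fun z : Phase n => stiff ν z.1 x * stiff ν z.2 x) _ _ _ _ _
    ((posFun ((coord x).comp (stiff ν))).contDiff.mul
      (momFun ((coord x).comp (stiff ν))).contDiff)]
  have e := forcedGen_pos_mul_mom ν γ T 0 ((coord x).comp (stiff ν)) ((coord x).comp (stiff ν)) z
  simp only [ContinuousLinearMap.proj_apply, ContinuousLinearMap.comp_apply, zero_mul,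
    add_zero] at e
  rw [e]
  have h1 := two_mul_le_of_sq_le (a := stiff ν z.1 x) hε (by positivity) (sqNorm_nonneg z) (hM z)
  simp only [posFun_apply, ContinuousLinearMap.comp_apply, ContinuousLinearMap.proj_apply] at h1
  nlinarith [sq_nonneg (stiff ν z.2 x - 2 * γ * stiff ν z.1 x)]

/-- Strong induction along the chain: from `p_y²` to `(Sq)_y²`, to `(Sp)_y²`, and then to the next
momentum through the three-term recursion. -/
theorem dissipated_mom (hγ : 0 < γ) (k : ℕ) :
    ∀ x : Fin (n + 1), x.val ≤ k → Dissipated ν γ T fun z => z.2 x ^ 2 := by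
  induction k with
  | zero =>
    intro x hx
    have : x = 0 := Fin.ext (by simpa using hx)
    subst this
    exact dissipated_mom_zero hγ
  | succ k ih =>
    intro x hx
    rcases Nat.lt_or_ge x.val (k + 1) with hlt | hge
    · exact ih x (by omega)
    have hk : k < n := by omega
    have hxk : x = (⟨k, hk⟩ : Fin n).succ := Fin.ext (by simp; omega)
    set y : Fin (n + 1) := (⟨k, hk⟩ : Fin n).castSucc with hy
    have hyk : y.val = k := by simp [hy]
    have d1 := ih y hyk.le
    have d2 := dissipated_stiff_mom y (dissipated_stiff_pos y d1)
    -- At the left end the Neumann convention makes `leftNbr` the particle itself, so no earlier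
    -- site is needed.
    have d3 : Dissipated ν γ T fun z : Phase n => leftNbr z.2 y ^ 2 := by
      by_cases h0 : y.val = 0
      · simpa [leftNbr, h0] using d1
      · simpa [leftNbr, h0] using ih ⟨y.val - 1, by omega⟩ (by simp; omega)
    -- The factor `3` comes from `(a + b + c)² ≤ 3 (a² + b² + c²)`.
    refine (((d1.const_mul (sq_nonneg (ν ^ 2 + 2))).add (d2.add d3)).const_mul
      (by norm_num : (0 : ℝ) ≤ 3)).mono fun z => ?_
    rw [hxk, apply_succ_eq ν z.2 ⟨k, hk⟩, ← hy]
    nlinarith [sq_nonneg ((ν ^ 2 + 2) * z.2 y + leftNbr z.2 y),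
      sq_nonneg ((ν ^ 2 + 2) * z.2 y + stiff ν z.2 y), sq_nonneg (leftNbr z.2 y - stiff ν z.2 y)]

theorem dissipated_sum_mom (hγ : 0 < γ) :
    Dissipated ν γ T fun z : Phase n => ∑ x, z.2 x ^ 2 :=
  Dissipated.sum _ fun x => dissipated_mom hγ n x (by omega)

theorem dissipated_sum_pos (hν : 0 < ν) (hγ : 0 < γ) :
    Dissipated ν γ T fun z : Phase n => ∑ x, z.1 x ^ 2 := by
  have key : Dissipated ν γ T fun z : Phase n => ν ^ 2 * ∑ x, z.1 x ^ 2 := by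
    refine (dissipated_sum_mom hγ).of_le fun ε hε => ?_
    have hc1 : ∀ x : Fin (n + 1), QuadGrowth fun z : Phase n => z.1 x * z.2 x := fun x =>
      QuadGrowth.clm_mul_clm (posFun (coord x)) (momFun (coord x))
    have hc2 : ∀ x : Fin (n + 1), QuadGrowth fun z : Phase n => γ * (z.1 x * z.1 x) := fun x =>
      (QuadGrowth.clm_mul_clm (posFun (coord x)) (posFun (coord x))).const_mul γ
    -- The virial `q · p`, corrected by `γ |q|²` to cancel the damping term `-2γ q · p`. Its image
    -- is `|p|² - q · Sq`, and `q · Sq ≥ ν² |q|²`.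
    refine ⟨fun z => ∑ x, (z.1 x * z.2 x + γ * (z.1 x * z.1 x)), 1, 0, zero_le_one,
      QuadGrowth.sum _ fun x => (hc1 x).add (hc2 x), fun z => ?_⟩
    rw [forcedGen_sum _ _ _ _ _ _ fun x => ((hc1 x).add (hc2 x)).smooth]
    have e : ∀ x : Fin (n + 1),
        forcedGen ν γ T 0 (fun z => z.1 x * z.2 x + γ * (z.1 x * z.1 x)) z
          = z.2 x ^ 2 - z.1 x * stiff ν z.1 x := by
      intro x
      have e1 := forcedGen_pos_mul_mom ν γ T 0 (coord x) (coord x) z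
      have e2 := forcedGen_pos_mul_pos ν γ T 0 (coord x) (coord x) z
      simp only [ContinuousLinearMap.proj_apply] at e1 e2
      rw [forcedGen_add _ _ _ _ (hc1 x).smooth (hc2 x).smooth,
        forcedGen_const_mul (f := fun z : Phase n => z.1 x * z.1 x) _ _ _ _ _ ((posFun (coord x)).contDiff.mul (posFun (coord x)).contDiff), e1, e2]
      ring
    simp only [e, Finset.sum_sub_distrib]
    have := le_sum_mul_stiff ν z.1
    have := mul_nonneg hε.le (sqNorm_nonneg z)
    linarith
  refine (key.const_mul (inv_nonneg.2 (sq_nonneg ν))).mono fun z => ?_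
  rw [inv_mul_cancel_left₀ (by positivity)]

/-- A Lyapunov function for the chain without force. -/
theorem exists_lyapunov (hν : 0 < ν) (hγ : 0 < γ) (T : ℝ) :
    ∃ V : Phase n → ℝ, ∃ C : ℝ, QuadGrowth V ∧ (∀ z, sqNorm z ≤ V z) ∧
      ∀ z, forcedGen ν γ T 0 V z ≤ C - 1 / 2 * sqNorm z := by
  obtain ⟨Q, C, hQ, hz⟩ := (dissipated_sum_pos (n := n) (T := T) hν hγ).add
    (dissipated_sum_mom hγ) (1 / 2) (by norm_num)
  obtain ⟨K₀, hK₀⟩ := isBigO_top.1 hQ.growth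
  have hK₀' : ∀ z, -Q z ≤ |K₀| * (1 + sqNorm z) := by
    intro z
    have h1 := hK₀ z
    rw [Real.norm_eq_abs, Real.norm_of_nonneg (by positivity)] at h1
    have h2 := norm_sq_le_sqNorm z
    calc -Q z ≤ |Q z| := neg_le_abs _
      _ ≤ K₀ * (1 + ‖z‖ ^ 2) := h1
      _ ≤ |K₀| * (1 + ‖z‖ ^ 2) := by gcongr; exact le_abs_self _
      _ ≤ _ := by gcongr
  set m := min 1 (ν ^ 2) with hm
  have hm0 : 0 < m := lt_min one_pos (by positivity)
  -- Chosen so that `K` times the lower bound `m / 2` of the energy outweighs `-Q` with one `sqNorm`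
  -- to spare. Adding `K` times the energy raises the generator bound by a constant only.
  set K := 2 / m * (|K₀| + 1) with hK
  have hKpos : 0 < K := by positivity
  have hE : ∀ z : Phase n, m / 2 * sqNorm z ≤ energy ν z := by
    intro z
    have h1 := le_energy ν z
    have h2 : m * ∑ x, z.2 x ^ 2 ≤ 1 * ∑ x, z.2 x ^ 2 :=
      mul_le_mul_of_nonneg_right (min_le_left _ _) (by positivity)
    have h3 : m * ∑ x, z.1 x ^ 2 ≤ ν ^ 2 * ∑ x, z.1 x ^ 2 :=
      mul_le_mul_of_nonneg_right (min_le_right _ _) (by positivity)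
    unfold sqNorm
    linarith
  have hE' := (quadGrowth_energy (n := n) ν).const_mul K
  have hc := QuadGrowth.const (n := n) |K₀|
  refine ⟨fun z => (K * energy ν z + Q z) + |K₀|, K * (2 * γ * T) + C, (hE'.add hQ).add hc,
    fun z => ?_, fun z => ?_⟩
  · have h1 := mul_le_mul_of_nonneg_left (hE z) hKpos.le
    have h2 : K * (m / 2 * sqNorm z) = (|K₀| + 1) * sqNorm z := by
      rw [hK]
      field_simp
    linarith [hK₀' z]
  · rw [forcedGen_add _ _ _ _ (hE'.add hQ).smooth hc.smooth,
      forcedGen_add _ _ _ _ hE'.smooth hQ.smooth, forcedGen_const,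
      forcedGen_const_mul _ _ _ _ _ (contDiff_energy ν), forcedGen_energy]
    have h1 := hz z
    have h2 : 0 ≤ K * (2 * γ * z.2 0 ^ 2) := by positivity
    simp only [sqNorm] at h1 ⊢
    linarith

/-- The Lyapunov function for a bounded force. -/
theorem exists_lyapunov_force (hν : 0 < ν) (hγ : 0 < γ) (T Φ : ℝ) :
    ∃ V : Phase n → ℝ, ∃ C : ℝ, QuadGrowth V ∧ (∀ z, sqNorm z ≤ V z) ∧
      ∀ φ, |φ| ≤ Φ → ∀ z, forcedGen ν γ T φ V z ≤ C - 1 / 4 * sqNorm z := by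
  obtain ⟨V, C, hV, hpos, hz⟩ := exists_lyapunov (n := n) hν hγ T
  obtain ⟨K, hK⟩ := isBigO_top.1 (hV.pderiv_growth (dirP (Fin.last n)))
  refine ⟨V, |C| + (Φ * |K| + (Φ * |K|) ^ 2), hV, hpos, fun φ hφ z => ?_⟩
  have hΦ : 0 ≤ Φ := (abs_nonneg φ).trans hφ
  rw [forcedGen_eq_add]
  have h1 : φ * pderiv (dirP (Fin.last n)) V z ≤ Φ * (|K| * (1 + ‖z‖)) := by
    have h2 := hK z
    rw [Real.norm_eq_abs, Real.norm_of_nonneg (by positivity)] at h2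
    calc _ ≤ |φ * pderiv (dirP (Fin.last n)) V z| := le_abs_self _
      _ = |φ| * |pderiv (dirP (Fin.last n)) V z| := abs_mul _ _
      _ ≤ Φ * (K * (1 + ‖z‖)) := by gcongr
      _ ≤ _ := by gcongr; exact le_abs_self _
  -- The force term grows only linearly, so half of the dissipation absorbs it.
  have h3 : Φ * |K| * ‖z‖ ≤ (Φ * |K|) ^ 2 + 1 / 4 * sqNorm z := by
    nlinarith [sq_nonneg (Φ * |K| - 1 / 2 * ‖z‖), norm_sq_le_sqNorm z]
  have := le_abs_self C
  have := hz z
  linarith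

end Lyapunov

/-! ### A smooth concave cutoff -/

section Cutoff

/-- A smooth nonincreasing function, equal to `1` before `1` and to `0` after `2`. -/
def cutSlope (v : ℝ) : ℝ := Real.smoothTransition (2 - v)

theorem contDiff_cutSlope : ContDiff ℝ ∞ cutSlope :=
  Real.smoothTransition.contDiff.comp (contDiff_const.sub contDiff_id)

theorem cutSlope_nonneg (v : ℝ) : 0 ≤ cutSlope v := Real.smoothTransition.nonneg _

theorem cutSlope_le_one (v : ℝ) : cutSlope v ≤ 1 := Real.smoothTransition.le_one _

theorem cutSlope_antitone : Antitone cutSlope := fun _ _ h =>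
  Real.smoothTransition.monotone (by linarith)

theorem cutSlope_of_le_one {v : ℝ} (h : v ≤ 1) : cutSlope v = 1 :=
  Real.smoothTransition.one_of_one_le (by linarith)

theorem cutSlope_of_two_le {v : ℝ} (h : 2 ≤ v) : cutSlope v = 0 :=
  Real.smoothTransition.zero_of_nonpos (by linarith)

/-- A smooth concave function, equal to the identity before `1` and constant after `2`. -/
def cut (v : ℝ) : ℝ := ∫ s in (0 : ℝ)..v, cutSlope s

theorem cutSlope_intervalIntegrable (u v : ℝ) : IntervalIntegrable cutSlope volume u v :=
  contDiff_cutSlope.continuous.intervalIntegrable u v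

theorem cut_sub (u v : ℝ) : cut v - cut u = ∫ s in u..v, cutSlope s :=
  intervalIntegral.integral_interval_sub_left (cutSlope_intervalIntegrable _ _)
    (cutSlope_intervalIntegrable _ _)

theorem hasDerivAt_cut (v : ℝ) : HasDerivAt cut (cutSlope v) v :=
  intervalIntegral.integral_hasDerivAt_right (cutSlope_intervalIntegrable _ _)
    (contDiff_cutSlope.continuous.stronglyMeasurableAtFilter _ _)
    contDiff_cutSlope.continuous.continuousAt

theorem deriv_cut : deriv cut = cutSlope := funext fun v => (hasDerivAt_cut v).deriv

theorem contDiff_cut : ContDiff ℝ ∞ cut := by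
  rw [contDiff_infty_iff_deriv, deriv_cut]
  exact ⟨fun v => (hasDerivAt_cut v).differentiableAt, contDiff_cutSlope⟩

theorem cut_zero : cut 0 = 0 := intervalIntegral.integral_same

theorem cut_of_le_one {v : ℝ} (h : v ≤ 1) : cut v = v := by
  have : cut v = ∫ _ in (0 : ℝ)..v, (1 : ℝ) := by
    refine intervalIntegral.integral_congr fun s hs => cutSlope_of_le_one ?_
    have := hs.2
    exact this.trans (max_le zero_le_one h)
  rw [this]
  simp

theorem cut_of_two_le {v : ℝ} (h : 2 ≤ v) : cut v = cut 2 := by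
  rw [← sub_eq_zero, cut_sub]
  have : ∫ s in (2 : ℝ)..v, cutSlope s = ∫ _ in (2 : ℝ)..v, (0 : ℝ) := by
    refine intervalIntegral.integral_congr fun s hs => cutSlope_of_two_le ?_
    have := hs.1
    rwa [min_eq_left h] at this
  rw [this]
  simp

theorem abs_cut_sub_le (u v : ℝ) : |cut v - cut u| ≤ |v - u| := by
  rw [cut_sub]
  have := intervalIntegral.norm_integral_le_of_norm_le_const (a := u) (b := v) (f := cutSlope)
    (C := 1) fun s _ => by
      rw [Real.norm_of_nonneg (cutSlope_nonneg s)]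
      exact cutSlope_le_one s
  simpa using this

/-- A concave function lies below its tangents. This one-sided bound replaces the chain rule for the
jumps. -/
theorem cut_sub_le (u v : ℝ) : cut v - cut u ≤ cutSlope u * (v - u) := by
  rw [cut_sub]
  have hc : ∫ _ in u..v, cutSlope u = cutSlope u * (v - u) := by
    simp [mul_comm]
  rw [← hc]
  rcases le_total u v with h | h
  · refine intervalIntegral.integral_mono_on h (cutSlope_intervalIntegrable _ _) (by simp)
      fun s hs => cutSlope_antitone hs.1
  · rw [intervalIntegral.integral_symm v u, intervalIntegral.integral_symm v u]
    refine neg_le_neg (intervalIntegral.integral_mono_on h (by simp)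
      (cutSlope_intervalIntegrable _ _) fun s hs => cutSlope_antitone hs.2)

theorem exists_abs_deriv_cutSlope_le : ∃ K, ∀ v, |deriv cutSlope v| ≤ K := by
  have hs : HasCompactSupport (deriv cutSlope) := by
    refine HasCompactSupport.intro (K := Set.Icc 1 2) isCompact_Icc fun v hv => ?_
    rw [Set.mem_Icc, not_and_or, not_le, not_le] at hv
    rcases hv with hv | hv
    · have : cutSlope =ᶠ[nhds v] fun _ => 1 := by
        filter_upwards [Iio_mem_nhds hv] with s hs using cutSlope_of_le_one (le_of_lt hs)
      rw [this.deriv_eq, deriv_const]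
    · have : cutSlope =ᶠ[nhds v] fun _ => 0 := by
        filter_upwards [Ioi_mem_nhds hv] with s hs using cutSlope_of_two_le (le_of_lt hs)
      rw [this.deriv_eq, deriv_const]
  exact hs.exists_bound_of_continuous ((contDiff_infty_iff_deriv.1 contDiff_cutSlope).2.continuous)

theorem deriv_cutSlope_nonpos (v : ℝ) : deriv cutSlope v ≤ 0 :=
  cutSlope_antitone.deriv_nonpos

/-- The cutoff at the height `r`. -/
def cutAt (r v : ℝ) : ℝ := r * cut (v / r)

variable {r : ℝ}

theorem contDiff_cutAt (r : ℝ) : ContDiff ℝ ∞ (cutAt r) :=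
  contDiff_const.mul (contDiff_cut.comp (contDiff_id.div_const r))

theorem deriv_cutAt (hr : 0 < r) : deriv (cutAt r) = fun v => cutSlope (v / r) := by
  funext v
  have h := ((hasDerivAt_cut (v / r)).comp v ((hasDerivAt_id v).div_const r)).const_mul r
  have h' : HasDerivAt (cutAt r) (r * (cutSlope (v / r) * (1 / r))) v := h
  rw [h'.deriv]
  field_simp

theorem deriv_deriv_cutAt (hr : 0 < r) :
    deriv (deriv (cutAt r)) = fun v => deriv cutSlope (v / r) / r := by
  rw [deriv_cutAt hr]
  funext v
  have hd : HasDerivAt cutSlope (deriv cutSlope (v / r)) (v / r) :=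
    (contDiff_cutSlope.differentiable (by simp) _).hasDerivAt
  have h := hd.comp v ((hasDerivAt_id v).div_const r)
  have h' : HasDerivAt (fun v => cutSlope (v / r)) (deriv cutSlope (v / r) * (1 / r)) v := h
  rw [h'.deriv]
  field_simp

theorem abs_cutAt_sub_le (hr : 0 < r) (u v : ℝ) : |cutAt r v - cutAt r u| ≤ |v - u| := by
  rw [cutAt, cutAt, ← mul_sub, abs_mul, abs_of_pos hr]
  calc _ ≤ r * |v / r - u / r| := mul_le_mul_of_nonneg_left (abs_cut_sub_le _ _) hr.le
    _ = |r * (v / r - u / r)| := by rw [abs_mul, abs_of_pos hr]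
    _ = _ := by congr 1; field_simp

theorem cutAt_zero (r : ℝ) : cutAt r 0 = 0 := by simp [cutAt, cut_zero]

theorem abs_cutAt_le (hr : 0 < r) (v : ℝ) : |cutAt r v| ≤ |v| := by
  simpa [cutAt_zero] using abs_cutAt_sub_le hr 0 v

theorem cutAt_sub_le (hr : 0 < r) (u v : ℝ) :
    cutAt r v - cutAt r u - cutSlope (u / r) * (v - u) ≤ 0 := by
  have h := mul_le_mul_of_nonneg_left (cut_sub_le (u / r) (v / r)) hr.le
  have e : r * (cutSlope (u / r) * (v / r - u / r)) = cutSlope (u / r) * (v - u) := by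
    field_simp
  rw [e] at h
  rw [cutAt, cutAt]
  linarith

theorem cutAt_of_le (hr : 0 < r) {v : ℝ} (h : v ≤ r) : cutAt r v = v := by
  rw [cutAt, cut_of_le_one ((div_le_one hr).2 h)]
  field_simp

theorem cutAt_of_two_mul_le (hr : 0 < r) {v : ℝ} (h : 2 * r ≤ v) : cutAt r v = r * cut 2 := by
  rw [cutAt, cut_of_two_le ((le_div_iff₀ hr).2 h)]

end Cutoff

/-! ### The generator on truncated functions -/

section CutoffGen

variable {ν γ T φ r : ℝ} {W : Phase n → ℝ}

theorem forcedGen_cutAt (hr : 0 < r) (hW : ContDiff ℝ ∞ W) (z : Phase n) :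
    forcedGen ν γ T φ (fun z => cutAt r (W z)) z
      = cutSlope (W z / r) * forcedGen ν γ T φ W z
        + 2 * γ * T * (deriv cutSlope (W z / r) / r) * pderiv (dirP 0) W z ^ 2
        + γ * ∑ x ∈ Finset.univ.filter (fun x : Fin (n + 1) => x ≠ 0),
          (cutAt r (W (flip x z)) - cutAt r (W z)
            - cutSlope (W z / r) * (W (flip x z) - W z)) := by
  rw [forcedGen_comp _ _ _ _ (contDiff_cutAt r) hW, deriv_deriv_cutAt hr, deriv_cutAt hr]

/-- Concavity of the cutoff makes both corrections to the first-order chain rule nonpositive: the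
second-derivative term of the thermostat and the jump terms. -/
theorem forcedGen_cutAt_le (hγ : 0 < γ) (hT : 0 < T) (hr : 0 < r) (hW : ContDiff ℝ ∞ W)
    (z : Phase n) :
    forcedGen ν γ T φ (fun z => cutAt r (W z)) z
      ≤ cutSlope (W z / r) * forcedGen ν γ T φ W z := by
  rw [forcedGen_cutAt hr hW]
  have h1 : 2 * γ * T * (deriv cutSlope (W z / r) / r) * pderiv (dirP 0) W z ^ 2 ≤ 0 := by
    refine mul_nonpos_of_nonpos_of_nonneg (mul_nonpos_of_nonneg_of_nonpos (by positivity) ?_)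
      (sq_nonneg _)
    exact div_nonpos_of_nonpos_of_nonneg (deriv_cutSlope_nonpos _) hr.le
  have h2 : ∑ x ∈ Finset.univ.filter (fun x : Fin (n + 1) => x ≠ 0),
      (cutAt r (W (flip x z)) - cutAt r (W z)
        - cutSlope (W z / r) * (W (flip x z) - W z)) ≤ 0 :=
    Finset.sum_nonpos fun x _ => cutAt_sub_le hr _ _
  have h3 := mul_nonpos_of_nonneg_of_nonpos hγ.le h2
  linarith

/-- The sequence is eventually constant: once `W z` and its finitely many reversed values lie below
the cutoff height, the cutoff acts as the identity. -/
theorem tendsto_forcedGen_cutAt (hW : ContDiff ℝ ∞ W) (z : Phase n) :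
    Tendsto (fun k : ℕ => forcedGen ν γ T φ (fun z => cutAt (k + 1) (W z)) z) atTop
      (nhds (forcedGen ν γ T φ W z)) := by
  refine tendsto_nhds_of_eventually_eq ?_
  have h1 : ∀ᶠ k : ℕ in atTop, W z ≤ k :=
    tendsto_natCast_atTop_atTop.eventually (eventually_ge_atTop (W z))
  have h2 : ∀ᶠ k : ℕ in atTop, ∀ x : Fin (n + 1), W (flip x z) ≤ k :=
    eventually_all.2 fun x =>
      tendsto_natCast_atTop_atTop.eventually (eventually_ge_atTop (W (flip x z)))
  filter_upwards [h1, h2] with k hk1 hk2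
  have hk : (0 : ℝ) < k + 1 := by positivity
  have hlt : W z / (k + 1) < 1 := (div_lt_one hk).2 (by linarith)
  rw [forcedGen_cutAt hk hW, cutSlope_of_le_one hlt.le, cutAt_of_le hk (by linarith)]
  have hd : deriv cutSlope (W z / (k + 1)) = 0 := by
    have : cutSlope =ᶠ[nhds (W z / (k + 1))] fun _ => 1 := by
      filter_upwards [Iio_mem_nhds hlt] with s hs using cutSlope_of_le_one (le_of_lt hs)
    rw [this.deriv_eq, deriv_const]
  rw [hd, Finset.sum_eq_zero fun x _ => by
    rw [cutAt_of_le hk (by linarith [hk2 x])]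
    ring]
  ring

theorem QuadGrowth.exists_abs_forcedGen_le (hW : QuadGrowth W) (ν γ T Φ : ℝ) :
    ∃ K, 0 ≤ K ∧ ∀ φ, |φ| ≤ Φ → ∀ z, |forcedGen ν γ T φ W z| ≤ K * (1 + ‖z‖ ^ 2) := by
  obtain ⟨K₁, h1⟩ := isBigO_top.1 (hW.forcedGen_zero_growth ν γ T)
  obtain ⟨K₂, h2⟩ := isBigO_top.1
    ((hW.pderiv_growth (dirP (Fin.last n))).trans isBigO_linear_quadratic)
  refine ⟨|K₁| + |Φ| * |K₂|, by positivity, fun φ hφ z => ?_⟩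
  have h1 := h1 z
  have h2 := h2 z
  rw [Real.norm_eq_abs, Real.norm_of_nonneg (by positivity)] at h1 h2
  rw [forcedGen_eq_add]
  calc _ ≤ |forcedGen ν γ T 0 W z| + |φ| * |pderiv (dirP (Fin.last n)) W z| := by
        rw [← abs_mul]
        exact abs_add_le _ _
    _ ≤ |K₁| * (1 + ‖z‖ ^ 2) + |Φ| * (|K₂| * (1 + ‖z‖ ^ 2)) := by
        have a1 := le_abs_self K₁
        have a2 := le_abs_self K₂
        have a3 := hφ.trans (le_abs_self Φ)
        gcongr
        · exact h1.trans (by gcongr)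
        · exact h2.trans (by gcongr)
    _ = _ := by ring

/-- Supplies the dominating function for removing the cutoff, hence the uniformity in `r`. The
cutoff is 1-Lipschitz, and its second derivative is of order `1 / r`, bounded for `r ≥ 1`. -/
theorem QuadGrowth.exists_abs_forcedGen_cutAt_le (hW : QuadGrowth W) (ν γ T Φ : ℝ) :
    ∃ K, 0 ≤ K ∧ ∀ r, 1 ≤ r → ∀ φ, |φ| ≤ Φ → ∀ z,
      |forcedGen ν γ T φ (fun z => cutAt r (W z)) z| ≤ K * (1 + ‖z‖ ^ 2) := by
  obtain ⟨K₁, hK₁, h1⟩ := hW.exists_abs_forcedGen_le ν γ T Φ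
  obtain ⟨K₂, h2⟩ := isBigO_top.1
    (((hW.pderiv_growth (dirP 0)).mul (hW.pderiv_growth (dirP 0))).trans isBigO_linear_mul_linear)
  obtain ⟨K₃, h3⟩ := exists_abs_deriv_cutSlope_le
  have h4 : ∀ x : Fin (n + 1), ∃ K, ∀ z, |W (flip x z) - W z| ≤ K * (1 + ‖z‖ ^ 2) := by
    intro x
    obtain ⟨K, hK⟩ := isBigO_top.1 ((IsBigO.comp_flip hW.growth x).sub hW.growth)
    refine ⟨K, fun z => ?_⟩
    have := hK z
    rwa [Real.norm_eq_abs, Real.norm_of_nonneg (by positivity)] at this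
  choose K₄ h4 using h4
  have hK₃ : 0 ≤ K₃ := (abs_nonneg _).trans (h3 0)
  refine ⟨K₁ + |2 * γ * T| * K₃ * |K₂| + |γ| * ∑ x, 2 * |K₄ x|, by positivity,
    fun r hr φ hφ z => ?_⟩
  have hr0 : 0 < r := by linarith
  have hs : |cutSlope (W z / r)| ≤ 1 := by
    rw [abs_of_nonneg (cutSlope_nonneg _)]
    exact cutSlope_le_one _
  have e1 : |cutSlope (W z / r) * forcedGen ν γ T φ W z| ≤ K₁ * (1 + ‖z‖ ^ 2) := by
    rw [abs_mul]
    calc _ ≤ 1 * |forcedGen ν γ T φ W z| := by gcongr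
      _ ≤ _ := by rw [one_mul]; exact h1 φ hφ z
  have e2 : |2 * γ * T * (deriv cutSlope (W z / r) / r) * pderiv (dirP 0) W z ^ 2|
      ≤ |2 * γ * T| * K₃ * |K₂| * (1 + ‖z‖ ^ 2) := by
    have a := h2 z
    rw [Real.norm_eq_abs, Real.norm_of_nonneg (by positivity), ← pow_two] at a
    have b : |deriv cutSlope (W z / r) / r| ≤ K₃ := by
      rw [abs_div, abs_of_pos hr0]
      exact (div_le_self (abs_nonneg _) hr).trans (h3 _)
    rw [abs_mul, abs_mul]
    calc _ ≤ |2 * γ * T| * K₃ * (|K₂| * (1 + ‖z‖ ^ 2)) := by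
          gcongr
          exact a.trans (by gcongr; exact le_abs_self _)
      _ = _ := by ring
  have e3 : |γ * ∑ x ∈ Finset.univ.filter (fun x : Fin (n + 1) => x ≠ 0),
      (cutAt r (W (flip x z)) - cutAt r (W z) - cutSlope (W z / r) * (W (flip x z) - W z))|
      ≤ |γ| * (∑ x, 2 * |K₄ x|) * (1 + ‖z‖ ^ 2) := by
    rw [abs_mul, mul_assoc]
    refine mul_le_mul_of_nonneg_left ?_ (abs_nonneg _)
    rw [Finset.sum_mul]
    refine (Finset.abs_sum_le_sum_abs _ _).trans ((Finset.sum_le_sum fun x _ => ?_).trans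
      (Finset.sum_le_sum_of_subset_of_nonneg (Finset.filter_subset _ _)
        fun x _ _ => by positivity))
    calc _ ≤ |cutAt r (W (flip x z)) - cutAt r (W z)|
          + |cutSlope (W z / r) * (W (flip x z) - W z)| := abs_sub _ _
      _ ≤ |W (flip x z) - W z| + 1 * |W (flip x z) - W z| := by
          rw [abs_mul]
          exact add_le_add (abs_cutAt_sub_le hr0 _ _)
            (mul_le_mul_of_nonneg_right hs (abs_nonneg _))
      _ = 2 * |W (flip x z) - W z| := by ring
      _ ≤ 2 * (|K₄ x| * (1 + ‖z‖ ^ 2)) := by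
          gcongr
          exact (h4 x z).trans (by gcongr; exact le_abs_self _)
      _ = _ := by ring
  rw [forcedGen_cutAt hr0 hW.smooth]
  calc _ ≤ _ := abs_add_three _ _ _
    _ ≤ _ := add_le_add (add_le_add e1 e2) e3
    _ = _ := by ring

/-- The sublevel sets of a coercive function are bounded. -/
theorem hasCompactSupport_of_le {g : Phase n → ℝ} (hpos : ∀ z, sqNorm z ≤ W z) {R : ℝ}
    (hg : ∀ z, R ≤ W z → g z = 0) : HasCompactSupport g := by
  refine HasCompactSupport.intro (isCompact_closedBall (0 : Phase n) (|R| + 1)) fun z hz => ?_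
  refine hg z ?_
  rw [mem_closedBall_zero_iff, not_le] at hz
  have h1 := norm_sq_le_sqNorm z
  have h2 := hpos z
  have h3 := le_abs_self R
  nlinarith [abs_nonneg R]

/-- Subtracting the terminal value turns a truncated coercive function into a test function; the
generator and differences of expectations do not see the constant. -/
theorem hasCompactSupport_cutAt (hr : 0 < r) (hpos : ∀ z, sqNorm z ≤ W z) :
    HasCompactSupport fun z => cutAt r (W z) + -(r * cut 2) :=
  hasCompactSupport_of_le (R := 2 * r) hpos fun z hz => by
    rw [cutAt_of_two_mul_le hr hz]
    ring

end CutoffGen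

/-! ### Second moments of periodic states -/

theorem lintegral_ofReal_le_liminf {α : Type*} [MeasurableSpace α] {m : Measure α}
    {g : ℕ → α → ℝ} {h : α → ℝ} (hg : ∀ k, Measurable (g k))
    (hgh : ∀ z, ∀ᶠ k in atTop, g k z = h z) :
    ∫⁻ z, ENNReal.ofReal (h z) ∂m ≤ liminf (fun k => ∫⁻ z, ENNReal.ofReal (g k z) ∂m) atTop := by
  have h1 : ∀ z, liminf (fun k => ENNReal.ofReal (g k z)) atTop = ENNReal.ofReal (h z) := by
    intro z
    refine Tendsto.liminf_eq (tendsto_nhds_of_eventually_eq ?_)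
    filter_upwards [hgh z] with k hk
    rw [hk]
  calc _ = ∫⁻ z, liminf (fun k => ENNReal.ofReal (g k z)) atTop ∂m := by simp only [h1]
    _ ≤ _ := lintegral_liminf_le fun k => (hg k).ennreal_ofReal

theorem continuous_sqNorm : Continuous (sqNorm (n := n)) := by
  unfold sqNorm
  fun_prop

theorem contDiff_sqNorm : ContDiff ℝ ∞ (sqNorm (n := n)) := by
  have h1 : ∀ x : Fin (n + 1), ContDiff ℝ ∞ fun z : Phase n => z.1 x :=
    fun x => (posFun (coord x)).contDiff
  have h2 : ∀ x : Fin (n + 1), ContDiff ℝ ∞ fun z : Phase n => z.2 x :=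
    fun x => (momFun (coord x)).contDiff
  exact (ContDiff.sum fun x _ => (h1 x).pow 2).add (ContDiff.sum fun x _ => (h2 x).pow 2)

theorem integrable_norm_sq {m : Measure (Phase n)} [IsFiniteMeasure m]
    (hm : Integrable sqNorm m) : Integrable (fun z => 1 + ‖z‖ ^ 2) m := by
  refine (integrable_const 1).add (hm.mono' (by fun_prop) (Eventually.of_forall fun z => ?_))
  rw [Real.norm_of_nonneg (by positivity)]
  exact norm_sq_le_sqNorm z

theorem integrable_of_isBigO {m : Measure (Phase n)} [IsFiniteMeasure m]
    (hm : Integrable sqNorm m) {W : Phase n → ℝ} (hW : Continuous W)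
    (hO : W =O[⊤] fun z => 1 + ‖z‖ ^ 2) : Integrable W m := by
  obtain ⟨K, hK⟩ := isBigO_top.1 hO
  refine ((integrable_norm_sq hm).const_mul K).mono' hW.aestronglyMeasurable
    (Eventually.of_forall fun z => ?_)
  have := hK z
  rwa [Real.norm_of_nonneg (by positivity : (0 : ℝ) ≤ 1 + ‖z‖ ^ 2)] at this

theorem isBigO_forcedGen {W : Phase n → ℝ} (hW : QuadGrowth W) (ν γ T φ : ℝ) :
    forcedGen ν γ T φ W =O[⊤] fun z => 1 + ‖z‖ ^ 2 := by
  obtain ⟨K, -, hK⟩ := hW.exists_abs_forcedGen_le ν γ T |φ|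
  refine isBigO_top.2 ⟨K, fun z => ?_⟩
  rw [Real.norm_eq_abs, Real.norm_of_nonneg (by positivity)]
  exact hK φ le_rfl z

/-- Periodic solutions of the forward equation of the chain with the force `φ`. -/
structure IsForcedState (ν γ T : ℝ) (φ : ℝ → ℝ) (τ : ℝ) (μ : ℝ → Measure (Phase n)) : Prop where
  prob : ∀ t, 0 ≤ t → IsProbabilityMeasure (μ t)
  periodic : ∀ t, 0 ≤ t → μ (t + τ) = μ t
  forward : ∀ f : Phase n → ℝ, ContDiff ℝ ∞ f → HasCompactSupport f → ∀ t, 0 ≤ t →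
    HasDerivWithinAt (fun s => ∫ z, f z ∂(μ s)) (∫ z, forcedGen ν γ T (φ t) f z ∂(μ t))
      (Set.Ici 0) t

namespace IsForcedState

variable {ν γ T τ Φ : ℝ} {φ : ℝ → ℝ} {μ : ℝ → Measure (Phase n)} {f : Phase n → ℝ}

theorem continuousOn (h : IsForcedState ν γ T φ τ μ) (hf : ContDiff ℝ ∞ f)
    (hc : HasCompactSupport f) : ContinuousOn (fun t => ∫ z, f z ∂(μ t)) (Set.Ici 0) :=
  fun t ht => (h.forward f hf hc t ht).continuousWithinAt

theorem integrable (h : IsForcedState ν γ T φ τ μ) (hf : Continuous f)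
    (hc : HasCompactSupport f) {t : ℝ} (ht : 0 ≤ t) : Integrable f (μ t) := by
  have := h.prob t ht
  exact hf.integrable_of_hasCompactSupport hc

/-- With the force split off, the zero-force generator of `f` and its derivative along `p_n` are
themselves test functions, so the forward equation makes their expectations continuous. -/
theorem continuousOn_gen (h : IsForcedState ν γ T φ τ μ) (hφ : Continuous φ)
    (hf : ContDiff ℝ ∞ f) (hc : HasCompactSupport f) :
    ContinuousOn (fun t => ∫ z, forcedGen ν γ T (φ t) f z ∂(μ t)) (Set.Ici 0) := by
  have h0 := contDiff_forcedGen ν γ T 0 hf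
  have c0 := hasCompactSupport_forcedGen ν γ T 0 hc
  have h1 := pderiv_contDiff hf (dirP (Fin.last n))
  have c1 := hasCompactSupport_pderiv hc (dirP (Fin.last n))
  refine ((h.continuousOn h0 c0).add (hφ.continuousOn.mul (h.continuousOn h1 c1))).congr
    fun t ht => ?_
  simp only [forcedGen_eq_add ν γ T (φ t)]
  rw [integral_add (h.integrable h0.continuous c0 ht)
    ((h.integrable h1.continuous c1 ht).const_mul _), integral_const_mul]
  rfl

theorem integral_gen_eq (h : IsForcedState ν γ T φ τ μ) (hφ : Continuous φ)
    (hf : ContDiff ℝ ∞ f) (hc : HasCompactSupport f) {s t : ℝ} (hs : 0 ≤ s) (hst : s ≤ t) :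
    ∫ r in s..t, ∫ z, forcedGen ν γ T (φ r) f z ∂(μ r) = ∫ z, f z ∂(μ t) - ∫ z, f z ∂(μ s) := by
  have hsub : Set.Icc s t ⊆ Set.Ici 0 := fun r hr => hs.trans hr.1
  refine intervalIntegral.integral_eq_sub_of_hasDeriv_right
    (f := fun r => ∫ z, f z ∂(μ r)) ?_ (fun r hr => ?_) ?_
  · rw [Set.uIcc_of_le hst]
    exact (h.continuousOn hf hc).mono hsub
  · rw [min_eq_left hst, max_eq_right hst] at hr
    exact (h.forward f hf hc r (hs.trans hr.1.le)).mono
      fun u hu => hs.trans (hr.1.le.trans (le_of_lt hu))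
  · refine ContinuousOn.intervalIntegrable ?_
    rw [Set.uIcc_of_le hst]
    exact (h.continuousOn_gen hφ hf hc).mono hsub

section Cut

variable {W : Phase n → ℝ} {r : ℝ}

theorem integrable_cutAt (h : IsForcedState ν γ T φ τ μ) (hr : 0 < r) (hW : ContDiff ℝ ∞ W)
    (hpos : ∀ z, sqNorm z ≤ W z) {t : ℝ} (ht : 0 ≤ t) :
    Integrable (fun z => cutAt r (W z)) (μ t) := by
  have := h.prob t ht
  have h1 := h.integrable (((contDiff_cutAt r).comp hW).add contDiff_const).continuous
    (hasCompactSupport_cutAt hr hpos) ht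
  exact (h1.add (integrable_const (r * cut 2))).congr
    (Eventually.of_forall fun z => neg_add_cancel_right _ _)

theorem forcedGen_cutAt_add_const (hW : ContDiff ℝ ∞ W) (φ c : ℝ) :
    forcedGen ν γ T φ (fun z => cutAt r (W z) + c) = forcedGen ν γ T φ fun z => cutAt r (W z) := by
  funext z
  rw [forcedGen_add (f := fun z => cutAt r (W z)) _ _ _ _ ((contDiff_cutAt r).comp hW)
    contDiff_const, forcedGen_const, add_zero]

theorem integral_gen_cutAt_eq (h : IsForcedState ν γ T φ τ μ) (hφ : Continuous φ) (hr : 0 < r)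
    (hW : ContDiff ℝ ∞ W) (hpos : ∀ z, sqNorm z ≤ W z) {s t : ℝ} (hs : 0 ≤ s) (hst : s ≤ t) :
    ∫ u in s..t, ∫ z, forcedGen ν γ T (φ u) (fun z => cutAt r (W z)) z ∂(μ u)
      = ∫ z, cutAt r (W z) ∂(μ t) - ∫ z, cutAt r (W z) ∂(μ s) := by
  have h1 := h.integral_gen_eq hφ (f := fun z => cutAt r (W z) + -(r * cut 2))
    (((contDiff_cutAt r).comp hW).add contDiff_const) (hasCompactSupport_cutAt hr hpos) hs hst
  simp only [forcedGen_cutAt_add_const hW] at h1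
  have := h.prob t (hs.trans hst)
  have := h.prob s hs
  rw [h1, integral_add (h.integrable_cutAt hr hW hpos (hs.trans hst)) (integrable_const _),
    integral_add (h.integrable_cutAt hr hW hpos hs) (integrable_const _)]
  simp

theorem continuousOn_gen_cutAt (h : IsForcedState ν γ T φ τ μ) (hφ : Continuous φ) (hr : 0 < r)
    (hW : ContDiff ℝ ∞ W) (hpos : ∀ z, sqNorm z ≤ W z) :
    ContinuousOn (fun u => ∫ z, forcedGen ν γ T (φ u) (fun z => cutAt r (W z)) z ∂(μ u))
      (Set.Ici 0) := by
  have h1 := h.continuousOn_gen hφ (f := fun z => cutAt r (W z) + -(r * cut 2))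
    (((contDiff_cutAt r).comp hW).add contDiff_const) (hasCompactSupport_cutAt hr hpos)
  simpa only [forcedGen_cutAt_add_const hW] using h1

theorem integrable_gen_cutAt (h : IsForcedState ν γ T φ τ μ) (hr : 0 < r)
    (hW : ContDiff ℝ ∞ W) (hpos : ∀ z, sqNorm z ≤ W z) (a : ℝ) {t : ℝ} (ht : 0 ≤ t) :
    Integrable (forcedGen ν γ T a fun z => cutAt r (W z)) (μ t) := by
  have hs : ContDiff ℝ ∞ fun z => cutAt r (W z) + -(r * cut 2) :=
    ((contDiff_cutAt r).comp hW).add contDiff_const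
  have h1 := h.integrable (contDiff_forcedGen ν γ T a hs).continuous
    (hasCompactSupport_forcedGen ν γ T a (hasCompactSupport_cutAt hr hpos)) ht
  rwa [forcedGen_cutAt_add_const hW] at h1

end Cut

/-- The second moments are finite at some time. -/
theorem exists_integrable_sqNorm (h : IsForcedState ν γ T φ τ μ) (hγ : 0 < γ)
    (hT : 0 < T) (hτ : 0 < τ) (hφ : Continuous φ) {V : Phase n → ℝ} {C : ℝ}
    (hV : ContDiff ℝ ∞ V) (hpos : ∀ z, sqNorm z ≤ V z)
    (hgen : ∀ t z, forcedGen ν γ T (φ t) V z ≤ C - 1 / 4 * sqNorm z) :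
    ∃ t, 0 ≤ t ∧ t ≤ τ ∧ Integrable sqNorm (μ t) := by
  -- The weight is the slope of the cutoff, so this is exactly the dissipation that survives
  -- truncation in `forcedGen_cutAt_le`.
  set g : ℕ → Phase n → ℝ := fun k z => cutSlope (V z / (k + 1)) * sqNorm z with hg
  have hgs : ∀ k, ContDiff ℝ ∞ (g k) := fun k =>
    (contDiff_cutSlope.comp (hV.div_const _)).mul contDiff_sqNorm
  have hgc : ∀ k, HasCompactSupport (g k) := fun k =>
    hasCompactSupport_of_le (R := 2 * (k + 1)) hpos fun z hz => by
      have : cutSlope (V z / (k + 1)) = 0 :=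
        cutSlope_of_two_le ((le_div_iff₀ (by positivity)).2 hz)
      simp [hg, this]
  have hg0 : ∀ k z, 0 ≤ g k z := fun k z => mul_nonneg (cutSlope_nonneg _) (sqNorm_nonneg z)
  have hlim : ∀ z, ∀ᶠ k in atTop, g k z = sqNorm z := by
    intro z
    filter_upwards [tendsto_natCast_atTop_atTop.eventually (eventually_ge_atTop (V z))] with k hk
    have : cutSlope (V z / (k + 1)) = 1 :=
      cutSlope_of_le_one ((div_le_one (by positivity)).2 (by linarith))
    simp [hg, this]
  have hsub : Set.Icc 0 τ ⊆ Set.Ici 0 := fun u hu => hu.1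
  have hcont : ∀ k, ContinuousOn (fun t => ∫ z, g k z ∂(μ t)) (Set.Icc 0 τ) := fun k =>
    (h.continuousOn (hgs k) (hgc k)).mono hsub
  have hint : ∀ k, ∫ t in (0 : ℝ)..τ, ∫ z, g k z ∂(μ t) ≤ 4 * |C| * τ := by
    intro k
    have hk : (0 : ℝ) < k + 1 := by positivity
    have h1 := h.integral_gen_cutAt_eq hφ hk hV hpos le_rfl hτ.le
    have h2 := h.periodic 0 le_rfl
    rw [zero_add] at h2
    -- The truncated Lyapunov function has the same expectation at both ends of the period, so the
    -- time integral of its generator vanishes.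
    rw [h2, sub_self] at h1
    have h3 : ∫ u in (0 : ℝ)..τ, ∫ z, forcedGen ν γ T (φ u) (fun z => cutAt (k + 1) (V z)) z ∂(μ u)
        ≤ ∫ u in (0 : ℝ)..τ, (|C| - 1 / 4 * ∫ z, g k z ∂(μ u)) := by
      refine intervalIntegral.integral_mono_on hτ.le ?_ ?_ fun u hu => ?_
      · refine ContinuousOn.intervalIntegrable ?_
        rw [Set.uIcc_of_le hτ.le]
        exact (h.continuousOn_gen_cutAt hφ hk hV hpos).mono hsub
      · refine ContinuousOn.intervalIntegrable ?_
        rw [Set.uIcc_of_le hτ.le]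
        exact continuousOn_const.sub (continuousOn_const.mul (hcont k))
      · have := h.prob u hu.1
        have hi := h.integrable (hgs k).continuous (hgc k) hu.1
        have e : |C| - 1 / 4 * ∫ z, g k z ∂(μ u) = ∫ z, (|C| - 1 / 4 * g k z) ∂(μ u) := by
          rw [integral_sub (integrable_const _) (hi.const_mul _), integral_const_mul]
          simp
        rw [e]
        refine integral_mono (h.integrable_gen_cutAt hk hV hpos _ hu.1)
          ((integrable_const _).sub (hi.const_mul _)) fun z => ?_
        have a1 := forcedGen_cutAt_le (ν := ν) (φ := φ u) hγ hT hk hV z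
        have a2 := mul_le_mul_of_nonneg_left (hgen u z) (cutSlope_nonneg (V z / (k + 1)))
        have a3 : cutSlope (V z / (k + 1)) * C ≤ |C| := by
          have b1 := cutSlope_nonneg (V z / (k + 1))
          have b2 := cutSlope_le_one (V z / (k + 1))
          calc _ ≤ cutSlope (V z / (k + 1)) * |C| := by gcongr; exact le_abs_self _
            _ ≤ 1 * |C| := by gcongr
            _ = |C| := one_mul _
        simp only [hg]
        linarith
    rw [h1, intervalIntegral.integral_sub (by simp) (by
      refine ContinuousOn.intervalIntegrable ?_
      rw [Set.uIcc_of_le hτ.le]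
      exact continuousOn_const.mul (hcont k)), intervalIntegral.integral_const,
      intervalIntegral.integral_const_mul] at h3
    simp only [sub_zero, smul_eq_mul] at h3
    linarith
  have hlint : ∀ k, ∫⁻ t in Set.Ioc 0 τ, ENNReal.ofReal (∫ z, g k z ∂(μ t))
      ≤ ENNReal.ofReal (4 * |C| * τ) := by
    intro k
    have hi : IntegrableOn (fun t => ∫ z, g k z ∂(μ t)) (Set.Ioc 0 τ) :=
      ((hcont k).integrableOn_Icc).mono_set Set.Ioc_subset_Icc_self
    rw [← ofReal_integral_eq_lintegral_ofReal hi
      (Eventually.of_forall fun t => integral_nonneg (hg0 k)),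
      ← intervalIntegral.integral_of_le hτ.le]
    exact ENNReal.ofReal_le_ofReal (hint k)
  -- Fatou's lemma in time: the liminf has a finite integral, so it is finite at some `t`. Fatou's
  -- lemma on the phase space then gives the second moment at that `t`.
  have hfat : ∫⁻ t in Set.Ioc 0 τ, liminf (fun k => ENNReal.ofReal (∫ z, g k z ∂(μ t))) atTop
      ≤ ENNReal.ofReal (4 * |C| * τ) := by
    refine (lintegral_liminf_le' fun k => ?_).trans ?_
    · exact (((hcont k).mono Set.Ioc_subset_Icc_self).aemeasurable measurableSet_Ioc).ennreal_ofReal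
    · exact liminf_le_of_le (by isBoundedDefault) fun b hb => by
        obtain ⟨k, hk⟩ := hb.exists
        exact hk.trans (hlint k)
  have hex : ∃ t ∈ Set.Ioc 0 τ,
      liminf (fun k => ENNReal.ofReal (∫ z, g k z ∂(μ t))) atTop ≠ ⊤ := by
    by_contra! hcon
    rw [setLIntegral_congr_fun measurableSet_Ioc hcon] at hfat
    rw [setLIntegral_const, Real.volume_Ioc, sub_zero, ENNReal.top_mul
      (ENNReal.ofReal_pos.2 hτ).ne', top_le_iff] at hfat
    exact ENNReal.ofReal_ne_top hfat
  obtain ⟨t, ht, htop⟩ := hex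
  refine ⟨t, ht.1.le, ht.2, continuous_sqNorm.aestronglyMeasurable, ?_⟩
  rw [hasFiniteIntegral_iff_ofReal (Eventually.of_forall sqNorm_nonneg)]
  refine lt_of_le_of_lt (lintegral_ofReal_le_liminf (fun k => (hgs k).continuous.measurable) hlim)
    (lt_of_eq_of_lt ?_ htop.lt_top)
  congr 1
  funext k
  rw [ofReal_integral_eq_lintegral_ofReal (h.integrable (hgs k).continuous (hgc k) ht.1.le)
    (Eventually.of_forall (hg0 k))]

/-- The second moments are locally bounded. -/
theorem exists_integral_sqNorm_le (h : IsForcedState ν γ T φ τ μ) (hν : 0 < ν) (hγ : 0 < γ)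
    (hT : 0 < T) (hτ : 0 < τ) (hφ : Continuous φ) (hΦ : ∀ t, |φ t| ≤ Φ) :
    ∃ A B : ℝ, ∀ t, 0 ≤ t → Integrable sqNorm (μ t) ∧ ∫ z, sqNorm z ∂(μ t) ≤ A + B * t := by
  obtain ⟨V, C, hV, hpos, hgen⟩ := exists_lyapunov_force (n := n) hν hγ T Φ
  have hgen' : ∀ t z, forcedGen ν γ T (φ t) V z ≤ C - 1 / 4 * sqNorm z :=
    fun t z => hgen (φ t) (hΦ t) z
  obtain ⟨s, hs0, hsτ, hs⟩ := h.exists_integrable_sqNorm hγ hT hτ hφ hV.smooth hpos hgen'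
  have := h.prob s hs0
  have hVs : Integrable V (μ s) := integrable_of_isBigO hs hV.smooth.continuous hV.growth
  have hV0 : ∀ z, 0 ≤ V z := fun z => (sqNorm_nonneg z).trans (hpos z)
  -- Starting from the good time `s`, truncated Lyapunov expectations grow at most at rate `|C|`,
  -- uniformly in the cutoff height.
  have key : ∀ t, s ≤ t → ∀ k : ℕ,
      ∫ z, cutAt (k + 1) (V z) ∂(μ t) ≤ ∫ z, V z ∂(μ s) + |C| * (t - s) := by
    intro t hst k
    have hk : (0 : ℝ) < k + 1 := by positivity
    have h1 := h.integral_gen_cutAt_eq hφ hk hV.smooth hpos hs0 hst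
    have hsub : Set.Icc s t ⊆ Set.Ici 0 := fun u hu => hs0.trans hu.1
    have h2 : ∫ u in s..t, ∫ z, forcedGen ν γ T (φ u) (fun z => cutAt (k + 1) (V z)) z ∂(μ u)
        ≤ ∫ _ in s..t, |C| := by
      refine intervalIntegral.integral_mono_on hst ?_ (by simp) fun u hu => ?_
      · refine ContinuousOn.intervalIntegrable ?_
        rw [Set.uIcc_of_le hst]
        exact (h.continuousOn_gen_cutAt hφ hk hV.smooth hpos).mono hsub
      · have := h.prob u (hsub hu)
        have e : |C| = ∫ _, |C| ∂(μ u) := by simp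
        rw [e]
        refine integral_mono (h.integrable_gen_cutAt hk hV.smooth hpos _ (hsub hu))
          (integrable_const _) fun z => ?_
        have a1 := forcedGen_cutAt_le (ν := ν) (φ := φ u) hγ hT hk hV.smooth z
        have b1 := cutSlope_nonneg (V z / (k + 1))
        have b2 := cutSlope_le_one (V z / (k + 1))
        calc _ ≤ _ := a1
          _ ≤ cutSlope (V z / (k + 1)) * |C| := by
            gcongr
            linarith [hgen' u z, sqNorm_nonneg z, le_abs_self C]
          _ ≤ 1 * |C| := by gcongr
          _ = |C| := one_mul _
    have h3 : ∫ z, cutAt (k + 1) (V z) ∂(μ s) ≤ ∫ z, V z ∂(μ s) := by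
      refine integral_mono (h.integrable_cutAt hk hV.smooth hpos hs0) hVs fun z => ?_
      have := (le_abs_self _).trans (abs_cutAt_le hk (V z))
      rwa [abs_of_nonneg (hV0 z)] at this
    rw [h1, intervalIntegral.integral_const, smul_eq_mul] at h2
    linarith
  have hcut0 : ∀ (k : ℕ) z, 0 ≤ cutAt (k + 1) (V z) := by
    intro k z
    refine mul_nonneg (by positivity) ?_
    exact intervalIntegral.integral_nonneg (div_nonneg (hV0 z) (by positivity))
      fun u _ => cutSlope_nonneg u
  have hmom : ∀ t, s ≤ t → Integrable sqNorm (μ t) ∧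
      ∫ z, sqNorm z ∂(μ t) ≤ ∫ z, V z ∂(μ s) + |C| * (t - s) := by
    intro t hst
    have ht : 0 ≤ t := hs0.trans hst
    have hbd : ∫⁻ z, ENNReal.ofReal (sqNorm z) ∂(μ t)
        ≤ ENNReal.ofReal (∫ z, V z ∂(μ s) + |C| * (t - s)) := by
      calc _ ≤ ∫⁻ z, ENNReal.ofReal (V z) ∂(μ t) :=
            lintegral_mono fun z => ENNReal.ofReal_le_ofReal (hpos z)
        _ ≤ _ := lintegral_ofReal_le_liminf (g := fun (k : ℕ) z => cutAt (k + 1) (V z))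
            (fun k => ((contDiff_cutAt _).comp hV.smooth).continuous.measurable) fun z => by
              filter_upwards [tendsto_natCast_atTop_atTop.eventually
                (eventually_ge_atTop (V z))] with k hk
              exact cutAt_of_le (by positivity) (by linarith)
        _ ≤ _ := liminf_le_of_le (by isBoundedDefault) fun b hb => by
            obtain ⟨k, hk⟩ := hb.exists
            rw [← ofReal_integral_eq_lintegral_ofReal
              (h.integrable_cutAt (by positivity) hV.smooth hpos ht)
              (Eventually.of_forall (hcut0 k))] at hk
            exact hk.trans (ENNReal.ofReal_le_ofReal (key t hst k))
    refine ⟨⟨continuous_sqNorm.aestronglyMeasurable, ?_⟩, ?_⟩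
    · rw [hasFiniteIntegral_iff_ofReal (Eventually.of_forall sqNorm_nonneg)]
      exact hbd.trans_lt ENNReal.ofReal_lt_top
    · rw [integral_eq_lintegral_of_nonneg_ae (Eventually.of_forall sqNorm_nonneg)
        continuous_sqNorm.aestronglyMeasurable]
      refine ENNReal.toReal_le_of_le_ofReal ?_ hbd
      have : 0 ≤ ∫ z, V z ∂(μ s) := integral_nonneg hV0
      have := mul_nonneg (abs_nonneg C) (sub_nonneg.2 hst)
      linarith
  refine ⟨∫ z, V z ∂(μ s) + |C| * τ, |C|, fun t ht => ?_⟩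
  -- Times before `s` are reached by periodicity, since `s ≤ τ ≤ t + τ`.
  have h1 := hmom (t + τ) (by linarith)
  rw [h.periodic t ht] at h1
  refine ⟨h1.1, h1.2.trans ?_⟩
  have := mul_nonneg (abs_nonneg C) hs0
  linarith

end IsForcedState

/-! ### Dynkin's formula for quadratic growth -/

theorem QuadGrowth.integrable {m : Measure (Phase n)} [IsFiniteMeasure m]
    (hm : Integrable sqNorm m) {W : Phase n → ℝ} (hW : QuadGrowth W) : Integrable W m :=
  integrable_of_isBigO hm hW.smooth.continuous hW.growth

theorem QuadGrowth.integrable_gen {m : Measure (Phase n)} [IsFiniteMeasure m]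
    (hm : Integrable sqNorm m) {W : Phase n → ℝ} (hW : QuadGrowth W) (ν γ T φ : ℝ) :
    Integrable (forcedGen ν γ T φ W) m :=
  integrable_of_isBigO hm (contDiff_forcedGen ν γ T φ hW.smooth).continuous
    (isBigO_forcedGen hW ν γ T φ)

/-- Every function of quadratic growth is a difference of coercive ones. -/
theorem QuadGrowth.exists_coercive {W : Phase n → ℝ} (hW : QuadGrowth W) :
    ∃ U : Phase n → ℝ, QuadGrowth U ∧ (∀ z, sqNorm z ≤ U z) ∧ ∀ z, sqNorm z ≤ W z + U z := by
  -- Only a coercive function of quadratic growth is wanted here; its parameters are arbitrary and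
  -- its dissipation is discarded.
  obtain ⟨V, C, hV, hpos, -⟩ := exists_lyapunov (n := n) one_pos one_pos 1
  obtain ⟨K, hK⟩ := isBigO_top.1 hW.growth
  refine ⟨fun z => (|K| + 1) * V z + |K|, (hV.const_mul _).add (QuadGrowth.const _),
    fun z => ?_, fun z => ?_⟩
  · have h1 := hpos z
    have h2 := sqNorm_nonneg z
    have h3 : 0 ≤ |K| * V z := mul_nonneg (abs_nonneg K) (h2.trans h1)
    have := abs_nonneg K
    linarith
  · have h1 := hK z
    rw [Real.norm_eq_abs, Real.norm_of_nonneg (by positivity)] at h1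
    have h2 : -W z ≤ |K| * (1 + sqNorm z) := by
      calc -W z ≤ |W z| := neg_le_abs _
        _ ≤ K * (1 + ‖z‖ ^ 2) := h1
        _ ≤ |K| * (1 + ‖z‖ ^ 2) := by gcongr; exact le_abs_self _
        _ ≤ _ := by gcongr; exact norm_sq_le_sqNorm z
    have h3 := mul_le_mul_of_nonneg_left (hpos z) (abs_nonneg K)
    linarith [hpos z]

namespace IsForcedState

variable {ν γ T τ Φ : ℝ} {φ : ℝ → ℝ} {μ : ℝ → Measure (Phase n)}

/-- Coercivity makes the truncations admissible in the forward equation. The height is then sent to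
infinity by dominated convergence, first on the phase space and then in time, using the locally
bounded second moments. -/
theorem dynkin_of_coercive (h : IsForcedState ν γ T φ τ μ) (hφ : Continuous φ)
    (hΦ : ∀ t, |φ t| ≤ Φ) {A B : ℝ}
    (hmom : ∀ t, 0 ≤ t → Integrable sqNorm (μ t) ∧ ∫ z, sqNorm z ∂(μ t) ≤ A + B * t)
    {W : Phase n → ℝ} (hW : QuadGrowth W) (hpos : ∀ z, sqNorm z ≤ W z) {t : ℝ} (ht : 0 ≤ t) :
    IntervalIntegrable (fun r => ∫ z, forcedGen ν γ T (φ r) W z ∂(μ r)) volume 0 t ∧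
      ∫ r in (0 : ℝ)..t, ∫ z, forcedGen ν γ T (φ r) W z ∂(μ r)
        = ∫ z, W z ∂(μ t) - ∫ z, W z ∂(μ 0) := by
  obtain ⟨K, hK0, hK⟩ := hW.exists_abs_forcedGen_cutAt_le ν γ T Φ
  have hsub : Set.uIoc 0 t ⊆ Set.Ici 0 := by
    rw [Set.uIoc_of_le ht]
    exact fun u hu => hu.1.le
  have hbound : ∀ u, 0 ≤ u → ∫ z, K * (1 + ‖z‖ ^ 2) ∂(μ u) ≤ K * (1 + (A + B * u)) := by
    intro u hu
    have := h.prob u hu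
    have hn := integrable_norm_sq (hmom u hu).1
    rw [integral_const_mul]
    refine mul_le_mul_of_nonneg_left ?_ hK0
    have : ∫ z, (1 + ‖z‖ ^ 2) ∂(μ u) ≤ ∫ z, (1 + sqNorm z) ∂(μ u) :=
      integral_mono hn ((integrable_const 1).add (hmom u hu).1) fun z =>
        add_le_add le_rfl (norm_sq_le_sqNorm z)
    rw [integral_add (integrable_const _) (hmom u hu).1] at this
    simp only [integral_const, probReal_univ, one_smul] at this
    linarith [(hmom u hu).2]
  set G : ℕ → ℝ → ℝ := fun k u =>
    ∫ z, forcedGen ν γ T (φ u) (fun z => cutAt (k + 1) (W z)) z ∂(μ u) with hG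
  have hk : ∀ k : ℕ, (0 : ℝ) < k + 1 := fun k => by positivity
  have hGb : ∀ k u, 0 ≤ u → ‖G k u‖ ≤ K * (1 + (A + B * u)) := by
    intro k u hu
    have := h.prob u hu
    refine (norm_integral_le_of_norm_le ((integrable_norm_sq (hmom u hu).1).const_mul K)
      (Eventually.of_forall fun z => ?_)).trans (hbound u hu)
    exact hK _ (by simp) _ (hΦ u) z
  have hGlim : ∀ u, 0 ≤ u →
      Tendsto (fun k => G k u) atTop (nhds (∫ z, forcedGen ν γ T (φ u) W z ∂(μ u))) := by
    intro u hu
    have := h.prob u hu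
    refine tendsto_integral_of_dominated_convergence (fun z => K * (1 + ‖z‖ ^ 2)) (fun k => ?_)
      ((integrable_norm_sq (hmom u hu).1).const_mul K)
      (fun k => Eventually.of_forall fun z => hK _ (by simp) _ (hΦ u) z)
      (Eventually.of_forall fun z => tendsto_forcedGen_cutAt hW.smooth z)
    exact (h.integrable_gen_cutAt (hk k) hW.smooth hpos _ hu).aestronglyMeasurable
  have hGm : ∀ k, AEStronglyMeasurable (G k) (volume.restrict (Set.uIoc 0 t)) := fun k =>
    ((h.continuousOn_gen_cutAt hφ (hk k) hW.smooth hpos).mono hsub).aestronglyMeasurable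
      measurableSet_uIoc
  have hbi : IntervalIntegrable (fun u => K * (1 + (A + B * u))) volume 0 t :=
    Continuous.intervalIntegrable (by fun_prop) _ _
  have hlim1 := intervalIntegral.tendsto_integral_filter_of_dominated_convergence
    (μ := volume) (a := 0) (b := t) (F := G) (l := atTop) (fun u => K * (1 + (A + B * u)))
    (Eventually.of_forall hGm)
    (Eventually.of_forall fun k => Eventually.of_forall fun u hu => hGb k u (hsub hu)) hbi
    (Eventually.of_forall fun u hu => hGlim u (hsub hu))
  have hlim2 : ∀ u, 0 ≤ u → Tendsto (fun k : ℕ => ∫ z, cutAt (k + 1) (W z) ∂(μ u)) atTop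
      (nhds (∫ z, W z ∂(μ u))) := by
    intro u hu
    have := h.prob u hu
    refine tendsto_integral_of_dominated_convergence (fun z => |W z|) (fun k => ?_)
      (hW.integrable (hmom u hu).1).abs
      (fun k => Eventually.of_forall fun z => abs_cutAt_le (hk k) _)
      (Eventually.of_forall fun z => tendsto_nhds_of_eventually_eq ?_)
    · exact (h.integrable_cutAt (hk k) hW.smooth hpos hu).aestronglyMeasurable
    · filter_upwards [tendsto_natCast_atTop_atTop.eventually (eventually_ge_atTop (W z))] with k hk'
      exact cutAt_of_le (hk k) (by linarith)
  refine ⟨hbi.mono_fun ?_ ?_, tendsto_nhds_unique hlim1 ?_⟩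
  · refine aestronglyMeasurable_of_tendsto_ae atTop hGm ?_
    filter_upwards [ae_restrict_mem measurableSet_uIoc] with u hu using hGlim u (hsub hu)
  · filter_upwards [ae_restrict_mem measurableSet_uIoc] with u hu
    refine (le_of_tendsto (hGlim u (hsub hu)).norm
      (Eventually.of_forall fun k => hGb k u (hsub hu))).trans (le_abs_self _)
  · have : ∀ k, ∫ u in (0 : ℝ)..t, G k u
        = ∫ z, cutAt (k + 1) (W z) ∂(μ t) - ∫ z, cutAt (k + 1) (W z) ∂(μ 0) := fun k =>
      h.integral_gen_cutAt_eq hφ (hk k) hW.smooth hpos le_rfl ht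
    simp only [this]
    exact (hlim2 t ht).sub (hlim2 0 le_rfl)

/-- Dynkin's formula for functions of quadratic growth. -/
theorem dynkin (h : IsForcedState ν γ T φ τ μ) (hφ : Continuous φ)
    (hΦ : ∀ t, |φ t| ≤ Φ) {A B : ℝ}
    (hmom : ∀ t, 0 ≤ t → Integrable sqNorm (μ t) ∧ ∫ z, sqNorm z ∂(μ t) ≤ A + B * t)
    {W : Phase n → ℝ} (hW : QuadGrowth W) {t : ℝ} (ht : 0 ≤ t) :
    IntervalIntegrable (fun r => ∫ z, forcedGen ν γ T (φ r) W z ∂(μ r)) volume 0 t ∧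
      ∫ r in (0 : ℝ)..t, ∫ z, forcedGen ν γ T (φ r) W z ∂(μ r)
        = ∫ z, W z ∂(μ t) - ∫ z, W z ∂(μ 0) := by
  -- Writing `W = (W + U) - U` reduces to the coercive case.
  obtain ⟨U, hU, hpos, hpos'⟩ := hW.exists_coercive
  obtain ⟨i1, e1⟩ := h.dynkin_of_coercive hφ hΦ hmom hU hpos ht
  obtain ⟨i2, e2⟩ := h.dynkin_of_coercive hφ hΦ hmom (hW.add hU) hpos' ht
  have hG : ∀ r ∈ Set.uIcc 0 t, (∫ z, forcedGen ν γ T (φ r) (fun z => W z + U z) z ∂(μ r))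
      - ∫ z, forcedGen ν γ T (φ r) U z ∂(μ r) = ∫ z, forcedGen ν γ T (φ r) W z ∂(μ r) := by
    intro r hr
    rw [Set.uIcc_of_le ht] at hr
    have := h.prob r hr.1
    simp only [forcedGen_add _ _ _ _ hW.smooth hU.smooth]
    rw [integral_add (hW.integrable_gen (hmom r hr.1).1 _ _ _ _)
      (hU.integrable_gen (hmom r hr.1).1 _ _ _ _), add_sub_cancel_right]
  have hadd : ∀ r, 0 ≤ r → ∫ z, (W z + U z) ∂(μ r) = ∫ z, W z ∂(μ r) + ∫ z, U z ∂(μ r) := by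
    intro r hr
    have := h.prob r hr
    exact integral_add (hW.integrable (hmom r hr).1) (hU.integrable (hmom r hr).1)
  refine ⟨(i2.sub i1).congr fun r hr => hG r (Set.uIoc_subset_uIcc hr), ?_⟩
  rw [← intervalIntegral.integral_congr hG, intervalIntegral.integral_sub i2 i1, e1, e2,
    hadd t ht, hadd 0 le_rfl]
  ring

end IsForcedState

/-! ### Averaged equations of motion -/

theorem continuousOn_of_eq_integral {u g : ℝ → ℝ} {τ : ℝ} (hτ : 0 ≤ τ)
    (hg : IntervalIntegrable g volume 0 τ)
    (hu : ∀ t ∈ Set.Icc 0 τ, u t = u 0 + ∫ r in (0 : ℝ)..t, g r) :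
    ContinuousOn u (Set.Icc 0 τ) := by
  have h1 := intervalIntegral.continuousOn_primitive_interval' hg Set.left_mem_uIcc
  rw [Set.uIcc_of_le hτ] at h1
  exact (continuousOn_const.add h1).congr hu

theorem hasDerivAt_of_eq_integral {u g : ℝ → ℝ} {τ : ℝ}
    (hg : ContinuousOn g (Set.Icc 0 τ))
    (hu : ∀ t ∈ Set.Icc 0 τ, u t = u 0 + ∫ r in (0 : ℝ)..t, g r) {t : ℝ} (ht : t ∈ Set.Ioo 0 τ) :
    HasDerivAt u (g t) t := by
  have hsub : Set.uIcc 0 t ⊆ Set.Icc 0 τ := by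
    rw [Set.uIcc_of_le ht.1.le]
    exact Set.Icc_subset_Icc le_rfl ht.2.le
  have h1 : HasDerivAt (fun t => ∫ r in (0 : ℝ)..t, g r) (g t) t :=
    intervalIntegral.integral_hasDerivAt_right (hg.mono hsub).intervalIntegrable
      ((hg.mono Set.Ioo_subset_Icc_self).stronglyMeasurableAtFilter isOpen_Ioo t ht)
      (hg.continuousAt (Icc_mem_nhds ht.1 ht.2))
  refine (h1.const_add (u 0)).congr_of_eventuallyEq ?_
  filter_upwards [Icc_mem_nhds ht.1 ht.2] with s hs using hu s hs

/-- Periodic solutions of the averaged equations of motion. -/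
structure IsMeanPath (ν γ : ℝ) (φ : ℝ → ℝ) (τ : ℝ) (Q P : ℝ → Fin (n + 1) → ℝ) : Prop where
  contQ : ∀ x, ContinuousOn (fun t => Q t x) (Set.Icc 0 τ)
  contP : ∀ x, ContinuousOn (fun t => P t x) (Set.Icc 0 τ)
  perQ : Q τ = Q 0
  perP : P τ = P 0
  derivQ : ∀ t ∈ Set.Ioo 0 τ, ∀ x, HasDerivAt (fun t => Q t x) (P t x) t
  derivP : ∀ t ∈ Set.Ioo 0 τ, ∀ x, HasDerivAt (fun t => P t x)
    (-stiff ν (Q t) x - 2 * γ * P t x + φ t * (if x = Fin.last n then 1 else 0)) t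

namespace IsForcedState

variable {ν γ T τ Φ : ℝ} {φ : ℝ → ℝ} {μ : ℝ → Measure (Phase n)}

/-- The mean momenta solve the averaged equations, and they determine the mean kinetic energy of
the particle `0`. -/
theorem exists_isMeanPath (h : IsForcedState ν γ T φ τ μ) (hν : 0 < ν) (hγ : 0 < γ)
    (hT : 0 < T) (hτ : 0 < τ) (hφ : Continuous φ) (hΦ : ∀ t, |φ t| ≤ Φ) :
    (∀ t, 0 ≤ t → Integrable (fun z : Phase n => z.2 0 ^ 2) (μ t)) ∧
      IntervalIntegrable (fun t => ∫ z, z.2 0 ^ 2 ∂(μ t)) volume 0 τ ∧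
      ∃ Q P : ℝ → Fin (n + 1) → ℝ, IsMeanPath ν γ φ τ Q P ∧
        ∫ t in (0 : ℝ)..τ, ∫ z, z.2 0 ^ 2 ∂(μ t)
          = τ * T + 1 / (2 * γ) * ∫ t in (0 : ℝ)..τ, φ t * P t (Fin.last n) := by
  obtain ⟨A, B, hmom⟩ := h.exists_integral_sqNorm_le hν hγ hT hτ hφ hΦ
  have hsq : ∀ t, 0 ≤ t → Integrable (fun z : Phase n => z.2 0 ^ 2) (μ t) := by
    intro t ht
    have := h.prob t ht
    have := (QuadGrowth.clm_mul_clm (momFun (coord (0 : Fin (n + 1))))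
      (momFun (coord 0))).integrable (hmom t ht).1
    simpa [pow_two] using this
  set Q : ℝ → Fin (n + 1) → ℝ := fun t x => ∫ z, z.1 x ∂(μ t) with hQ
  set P : ℝ → Fin (n + 1) → ℝ := fun t x => ∫ z, z.2 x ∂(μ t) with hP
  have hiq : ∀ t, 0 ≤ t → ∀ x, Integrable (fun z : Phase n => z.1 x) (μ t) := by
    intro t ht x
    have := h.prob t ht
    exact (QuadGrowth.clm (posFun (coord x))).integrable (hmom t ht).1
  have hip : ∀ t, 0 ≤ t → ∀ x, Integrable (fun z : Phase n => z.2 x) (μ t) := by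
    intro t ht x
    have := h.prob t ht
    exact (QuadGrowth.clm (momFun (coord x))).integrable (hmom t ht).1
  have hstiff : ∀ t, 0 ≤ t → ∀ x, ∫ z, stiff ν z.1 x ∂(μ t) = stiff ν (Q t) x ∧
      Integrable (fun z : Phase n => stiff ν z.1 x) (μ t) := by
    intro t ht x
    have e : ∀ q : Fin (n + 1) → ℝ,
        stiff ν q x = ∑ y, q y * stiff ν (Pi.single y (1 : ℝ)) x := by
      intro q
      conv_lhs => rw [pi_eq_sum_smul q]
      simp [Finset.sum_apply]
    have e' : (fun z : Phase n => stiff ν z.1 x)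
        = fun z => ∑ y, z.1 y * stiff ν (Pi.single y (1 : ℝ)) x := funext fun z => e z.1
    rw [e', e (Q t)]
    refine ⟨?_, integrable_finsetSum _ fun y _ => (hiq t ht y).mul_const _⟩
    rw [integral_finsetSum _ fun y _ => (hiq t ht y).mul_const _]
    simp only [integral_mul_const, hQ]
  have hq0 : ∀ x : Fin (n + 1), ∀ t, 0 ≤ t → IntervalIntegrable (fun r => P r x) volume 0 t ∧
      Q t x = Q 0 x + ∫ r in (0 : ℝ)..t, P r x := by
    intro x t ht
    obtain ⟨i, e⟩ := h.dynkin hφ hΦ hmom (QuadGrowth.clm (posFun (coord x))) ht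
    simp only [forcedGen_posFun] at i e
    refine ⟨i, ?_⟩
    have e' : ∫ r in (0 : ℝ)..t, P r x = Q t x - Q 0 x := e
    linarith
  have hp0 : ∀ x : Fin (n + 1), ∀ t, 0 ≤ t →
      IntervalIntegrable (fun r => -stiff ν (Q r) x - 2 * γ * P r x
        + φ r * (if x = Fin.last n then 1 else 0)) volume 0 t ∧
      P t x = P 0 x + ∫ r in (0 : ℝ)..t, (-stiff ν (Q r) x - 2 * γ * P r x
        + φ r * (if x = Fin.last n then 1 else 0)) := by
    intro x t ht
    obtain ⟨i, e⟩ := h.dynkin hφ hΦ hmom (QuadGrowth.clm (momFun (coord x))) ht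
    have key : ∀ r ∈ Set.uIcc 0 t, (∫ z, forcedGen ν γ T (φ r) (momFun (coord x)) z ∂(μ r))
        = -stiff ν (Q r) x - 2 * γ * P r x + φ r * (if x = Fin.last n then 1 else 0) := by
      intro r hr
      rw [Set.uIcc_of_le ht] at hr
      have := h.prob r hr.1
      simp only [forcedGen_momFun, ContinuousLinearMap.proj_apply, Pi.single_apply]
      have i1 : Integrable (fun z : Phase n => -stiff ν z.1 x) (μ r) := (hstiff r hr.1 x).2.neg
      have i2 : Integrable (fun z : Phase n => 2 * γ * z.2 x) (μ r) := (hip r hr.1 x).const_mul _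
      have i3 : Integrable (fun z : Phase n => -stiff ν z.1 x - 2 * γ * z.2 x) (μ r) := i1.sub i2
      rw [integral_add i3 (integrable_const _), integral_sub i1 i2, integral_neg, (hstiff r hr.1 x).1, integral_const_mul]
      simp [hP]
    refine ⟨i.congr fun r hr => key r (Set.uIoc_subset_uIcc hr), ?_⟩
    rw [← intervalIntegral.integral_congr key]
    have e' : ∫ r in (0 : ℝ)..t, ∫ z, forcedGen ν γ T (φ r) (momFun (coord x)) z ∂(μ r)
      = P t x - P 0 x := e
    linarith
  -- Bootstrap: the integral equations give continuity of the means, hence continuous right-hand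
  -- sides, hence classical derivatives.
  have hcQ : ∀ x, ContinuousOn (fun t => Q t x) (Set.Icc 0 τ) := fun x =>
    continuousOn_of_eq_integral hτ.le (hq0 x τ hτ.le).1 fun t ht => (hq0 x t ht.1).2
  have hcP : ∀ x, ContinuousOn (fun t => P t x) (Set.Icc 0 τ) := fun x =>
    continuousOn_of_eq_integral hτ.le (hp0 x τ hτ.le).1 fun t ht => (hp0 x t ht.1).2
  have hcS : ∀ x, ContinuousOn (fun r => -stiff ν (Q r) x - 2 * γ * P r x
      + φ r * (if x = Fin.last n then (1 : ℝ) else 0)) (Set.Icc 0 τ) := by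
    intro x
    have h1 : ContinuousOn (fun r => stiff ν (Q r) x) (Set.Icc 0 τ) :=
      ((coord x).comp (stiff ν)).continuous.comp_continuousOn (continuousOn_pi.2 hcQ)
    exact (h1.neg.sub (continuousOn_const.mul (hcP x))).add
      (hφ.continuousOn.mul continuousOn_const)
  have hper := h.periodic 0 le_rfl
  rw [zero_add] at hper
  obtain ⟨iE, eE⟩ := h.dynkin hφ hΦ hmom (quadGrowth_energy ν) hτ.le
  have keyE : ∀ r ∈ Set.uIcc 0 τ, (∫ z, forcedGen ν γ T (φ r) (energy ν) z ∂(μ r))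
      = φ r * P r (Fin.last n) + 2 * γ * (T - ∫ z, z.2 0 ^ 2 ∂(μ r)) := by
    intro r hr
    rw [Set.uIcc_of_le hτ.le] at hr
    have := h.prob r hr.1
    simp only [forcedGen_energy]
    have i1 : Integrable (fun z : Phase n => 2 * γ * (T - z.2 0 ^ 2)) (μ r) :=
      ((integrable_const T).sub (hsq r hr.1)).const_mul _
    rw [integral_add ((hip r hr.1 _).const_mul _) i1, integral_const_mul,
      integral_const_mul, integral_sub (integrable_const _) (hsq r hr.1)]
    simp [hP]
  have iF : IntervalIntegrable (fun r => φ r * P r (Fin.last n)) volume 0 τ := by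
    refine ContinuousOn.intervalIntegrable ?_
    rw [Set.uIcc_of_le hτ.le]
    exact hφ.continuousOn.mul (hcP _)
  have iE' : IntervalIntegrable
      (fun r => φ r * P r (Fin.last n) + 2 * γ * (T - ∫ z, z.2 0 ^ 2 ∂(μ r))) volume 0 τ :=
    iE.congr fun r hr => keyE r (Set.uIoc_subset_uIcc hr)
  -- Read off from the integrability in time of the energy rate, provided by Dynkin's formula, minus
  -- the continuous power of the force.
  have iK : IntervalIntegrable (fun t => ∫ z, z.2 0 ^ 2 ∂(μ t)) volume 0 τ := by
    have := (intervalIntegrable_const (μ := volume) (a := 0) (b := τ) (c := T)).sub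
      ((iE'.sub iF).const_mul (1 / (2 * γ)))
    refine this.congr fun r _ => ?_
    simp only [add_sub_cancel_left]
    field_simp
    ring
  refine ⟨hsq, iK, Q, P, ⟨hcQ, hcP, ?_, ?_, ?_, ?_⟩, ?_⟩
  · simp only [hQ, hper]
  · simp only [hP, hper]
  · exact fun t ht x => hasDerivAt_of_eq_integral (hcP x) (fun s hs => (hq0 x s hs.1).2) ht
  · exact fun t ht x => hasDerivAt_of_eq_integral (hcS x) (fun s hs => (hp0 x s hs.1).2) ht
  · rw [hper, sub_self, intervalIntegral.integral_congr keyE,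
      intervalIntegral.integral_add iF ((intervalIntegrable_const.sub iK).const_mul _),
      intervalIntegral.integral_const_mul, intervalIntegral.integral_sub intervalIntegrable_const iK,
      intervalIntegral.integral_const] at eE
    simp only [sub_zero, smul_eq_mul] at eE
    field_simp
    linarith

end IsForcedState

/-! ### Fourier coefficients -/

section Fourier

theorem continuous_exp_mul (κ : ℝ) : Continuous fun t : ℝ => Complex.exp (κ * Complex.I * t) := by
  fun_prop

/-- The Fourier coefficients of a derivative. -/
theorem integral_exp_mul_deriv {κ τ : ℝ} {u g : ℝ → ℝ} (hτ : 0 ≤ τ)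
    (hκ : Complex.exp (κ * Complex.I * τ) = 1) (hu : ContinuousOn u (Set.Icc 0 τ))
    (hg : ContinuousOn g (Set.Icc 0 τ)) (hd : ∀ t ∈ Set.Ioo 0 τ, HasDerivAt u (g t) t)
    (hper : u τ = u 0) :
    ∫ t in (0 : ℝ)..τ, Complex.exp (κ * Complex.I * t) * (g t : ℂ)
      = -(κ * Complex.I) * ∫ t in (0 : ℝ)..τ, Complex.exp (κ * Complex.I * t) * (u t : ℂ) := by
  have hcexp : ContinuousOn (fun t : ℝ => Complex.exp (κ * Complex.I * t)) (Set.Icc 0 τ) :=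
    (continuous_exp_mul κ).continuousOn
  have hcu : ContinuousOn (fun t : ℝ => Complex.exp (κ * Complex.I * t) * (u t : ℂ))
      (Set.Icc 0 τ) := hcexp.mul (Complex.continuous_ofReal.comp_continuousOn hu)
  have hcg : ContinuousOn (fun t : ℝ => Complex.exp (κ * Complex.I * t) * (g t : ℂ))
      (Set.Icc 0 τ) := hcexp.mul (Complex.continuous_ofReal.comp_continuousOn hg)
  have iu : IntervalIntegrable (fun t : ℝ => Complex.exp (κ * Complex.I * t) * (u t : ℂ))
      volume 0 τ := by
    refine ContinuousOn.intervalIntegrable ?_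
    rwa [Set.uIcc_of_le hτ]
  have ig : IntervalIntegrable (fun t : ℝ => Complex.exp (κ * Complex.I * t) * (g t : ℂ))
      volume 0 τ := by
    refine ContinuousOn.intervalIntegrable ?_
    rwa [Set.uIcc_of_le hτ]
  -- Integration by parts; the boundary terms cancel because both the exponential and `u` take equal
  -- values at `0` and `τ`.
  have h1 := intervalIntegral.integral_eq_sub_of_hasDeriv_right
    (f := fun t : ℝ => Complex.exp (κ * Complex.I * t) * (u t : ℂ))
    (f' := fun t : ℝ => κ * Complex.I * (Complex.exp (κ * Complex.I * t) * (u t : ℂ))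
      + Complex.exp (κ * Complex.I * t) * (g t : ℂ))
    (a := 0) (b := τ) (by rwa [Set.uIcc_of_le hτ]) (fun t ht => ?_)
    ((iu.const_mul _).add ig)
  · rw [intervalIntegral.integral_add (iu.const_mul _) ig, intervalIntegral.integral_const_mul,
      hκ, hper] at h1
    simp only [Complex.ofReal_zero, mul_zero, Complex.exp_zero, sub_self] at h1
    linear_combination h1
  · rw [min_eq_left hτ, max_eq_right hτ] at ht
    have h2 : HasDerivAt (fun t : ℝ => Complex.exp (κ * Complex.I * t))
        (Complex.exp (κ * Complex.I * t) * (κ * Complex.I)) t := by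
      have := ((hasDerivAt_id (t : ℂ)).const_mul (κ * Complex.I)).cexp.comp_ofReal
      simpa using this
    have h3 := (h2.mul (hd t ht).ofReal_comp).hasDerivWithinAt (s := Set.Ioi t)
    refine h3.congr_deriv ?_
    ring

theorem fourierCoef_eq (F : ℝ → ℝ) (l : ℤ) :
    fourierCoef F l
      = ∫ t in (0 : ℝ)..1, Complex.exp (((-(2 * Real.pi * l) : ℝ) : ℂ) * Complex.I * t) * (F t : ℂ) := by
  unfold fourierCoef
  refine intervalIntegral.integral_congr fun t _ => ?_
  congr 2
  push_cast
  ring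

theorem exp_two_pi_int (l : ℤ) : Complex.exp (((2 * Real.pi * l : ℝ) : ℂ) * Complex.I) = 1 := by
  rw [Complex.exp_eq_one_iff]
  exact ⟨l, by push_cast; ring⟩

theorem norm_fourierCoef_le (F : ℝ → ℝ) :
    ∃ M, 0 ≤ M ∧ ∀ l, ‖fourierCoef F l‖ ≤ M := by
  refine ⟨∫ t in (0 : ℝ)..1, |F t|,
    intervalIntegral.integral_nonneg zero_le_one fun t _ => abs_nonneg _, fun l => ?_⟩
  rw [fourierCoef_eq]
  refine (intervalIntegral.norm_integral_le_integral_norm zero_le_one).trans_eq ?_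
  refine intervalIntegral.integral_congr fun t _ => ?_
  have : ((-(2 * Real.pi * l) : ℝ) : ℂ) * Complex.I * t
      = ((-(2 * Real.pi * l) * t : ℝ) : ℂ) * Complex.I := by
    push_cast
    ring
  simp only [norm_mul, this, Complex.norm_exp_ofReal_mul_I, one_mul, Complex.norm_real,
    Real.norm_eq_abs]

theorem fourierCoef_deriv {F : ℝ → ℝ} (hF : ContDiff ℝ ∞ F) (hper : Function.Periodic F 1)
    (l : ℤ) : fourierCoef (deriv F) l = (2 * Real.pi * l) * Complex.I * fourierCoef F l := by
  rw [fourierCoef_eq, fourierCoef_eq, integral_exp_mul_deriv (u := F) zero_le_one]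
  · push_cast
    ring
  · have := exp_two_pi_int (-l)
    rw [← this]
    congr 1
    push_cast
    ring
  · exact hF.continuous.continuousOn
  · exact (contDiff_infty_iff_deriv.1 hF).2.continuous.continuousOn
  · exact fun t _ => (hF.differentiable (by simp) t).hasDerivAt
  · simpa using hper 0

theorem periodic_deriv {F : ℝ → ℝ} (hper : Function.Periodic F 1) :
    Function.Periodic (deriv F) 1 := by
  intro t
  have : (fun s => F (s + 1)) = F := funext hper
  rw [← deriv_comp_add_const, this]

theorem exists_norm_fourierCoef_le {F : ℝ → ℝ} (hF : ContDiff ℝ ∞ F)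
    (hper : Function.Periodic F 1) (hmean : ∫ t in (0 : ℝ)..1, F t = 0) :
    ∃ M, 0 ≤ M ∧ ∀ l : ℤ, ‖fourierCoef F l‖ ≤ M * (1 / (l : ℝ) ^ 2) := by
  have hF1 := (contDiff_infty_iff_deriv.1 hF).2
  have hF2 := (contDiff_infty_iff_deriv.1 hF1).2
  obtain ⟨M, hM, h⟩ := norm_fourierCoef_le (deriv (deriv F))
  refine ⟨M, hM, fun l => ?_⟩
  -- At `l = 0` the bound is `0`, because `1 / 0 = 0`, and it holds by the vanishing mean. Otherwise
  -- the decay comes from the second derivative.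
  by_cases hl : l = 0
  · subst hl
    have : fourierCoef F 0 = 0 := by
      simp only [fourierCoef, Int.cast_zero, mul_zero, zero_mul, Complex.exp_zero, one_mul]
      rw [intervalIntegral.integral_ofReal, hmean, Complex.ofReal_zero]
    simp [this]
  · have h1 := h l
    rw [fourierCoef_deriv hF1 (periodic_deriv hper), fourierCoef_deriv hF hper] at h1
    have h2 : ‖(2 * Real.pi * l : ℂ)‖ = 2 * Real.pi * |(l : ℝ)| := by
      simp [abs_of_pos Real.pi_pos]
    rw [norm_mul, norm_mul (_ * Complex.I), norm_mul _ Complex.I, h2, Complex.norm_I] at h1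
    have hl' : 0 < (l : ℝ) ^ 2 := by positivity
    have h3 : (l : ℝ) ^ 2 * ‖fourierCoef F l‖ ≤ M := by
      refine le_trans ?_ h1
      have h4 : 1 ≤ (2 * Real.pi) ^ 2 := by nlinarith [Real.pi_gt_three]
      have h5 : 0 ≤ |(l : ℝ)| ^ 2 * ‖fourierCoef F l‖ := by positivity
      rw [← sq_abs]
      nlinarith
    rw [mul_one_div, le_div_iff₀ hl']
    linarith

theorem summable_norm_fourierCoef {F : ℝ → ℝ} (hF : ContDiff ℝ ∞ F)
    (hper : Function.Periodic F 1) (hmean : ∫ t in (0 : ℝ)..1, F t = 0) :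
    Summable fun l : ℤ => ‖fourierCoef F l‖ := by
  obtain ⟨M, -, h⟩ := exists_norm_fourierCoef_le hF hper hmean
  exact ((Real.summable_one_div_int_pow.2 (by norm_num : 1 < 2)).mul_left M).of_nonneg_of_le
    (fun l => norm_nonneg _) h

theorem summable_sq_mul_norm_fourierCoef_sq {F : ℝ → ℝ} (hF : ContDiff ℝ ∞ F)
    (hper : Function.Periodic F 1) (hmean : ∫ t in (0 : ℝ)..1, F t = 0) :
    Summable fun l : ℤ => (l : ℝ) ^ 2 * ‖fourierCoef F l‖ ^ 2 := by
  obtain ⟨M, hM, h⟩ := exists_norm_fourierCoef_le hF hper hmean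
  refine ((Real.summable_one_div_int_pow.2 (by norm_num : 1 < 2)).mul_left (M ^ 2)).of_nonneg_of_le
    (fun l => by positivity) fun l => ?_
  by_cases hl : (l : ℝ) = 0
  · simp [hl]
  · calc (l : ℝ) ^ 2 * ‖fourierCoef F l‖ ^ 2 ≤ (l : ℝ) ^ 2 * (M * (1 / (l : ℝ) ^ 2)) ^ 2 := by
          gcongr
          exact h l
      _ = M ^ 2 * (1 / (l : ℝ) ^ 2) := by field_simp

theorem fourierCoef_neg (F : ℝ → ℝ) (l : ℤ) :
    fourierCoef F (-l) = starRingEnd ℂ (fourierCoef F l) := by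
  rw [fourierCoef, fourierCoef, intervalIntegral.integral_of_le zero_le_one,
    intervalIntegral.integral_of_le zero_le_one, ← integral_conj]
  refine integral_congr_ae (Eventually.of_forall fun t => ?_)
  simp only [map_mul, Complex.conj_ofReal, ← Complex.exp_conj]
  have h2 : starRingEnd ℂ 2 = 2 := map_ofNat _ 2
  congr 2
  simp [h2]

/-- The Fourier series of a smooth periodic function. -/
theorem hasSum_fourierCoef {F : ℝ → ℝ} (hF : ContDiff ℝ ∞ F)
    (hper : Function.Periodic F 1) (hmean : ∫ t in (0 : ℝ)..1, F t = 0) (t : ℝ) :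
    HasSum (fun l : ℤ => fourierCoef F l * Complex.exp (2 * Real.pi * Complex.I * l * t))
      (F t : ℂ) := by
  have hper' : Function.Periodic (fun t => (F t : ℂ)) 1 := fun t => by simp only [hper t]
  have hcont : Continuous (hper'.lift : AddCircle (1 : ℝ) → ℂ) :=
    continuous_coinduced_dom.mpr (Complex.continuous_ofReal.comp hF.continuous)
  set f : C(AddCircle (1 : ℝ), ℂ) := ⟨hper'.lift, hcont⟩ with hf
  have hcoef : ∀ l : ℤ, fourierCoeff f l = fourierCoef F l := by
    intro l
    rw [fourierCoeff_eq_intervalIntegral _ _ 0]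
    simp only [fourierCoef, zero_add, one_div, inv_one, one_smul]
    refine intervalIntegral.integral_congr fun s _ => ?_
    simp only [fourier_coe_apply, smul_eq_mul, hf, ContinuousMap.coe_mk, Function.Periodic.lift_coe]
    congr 2
    push_cast
    ring
  have hsum : Summable (fourierCoeff f) := by
    have : fourierCoeff f = fourierCoef F := funext hcoef
    rw [this]
    exact (summable_norm_fourierCoef hF hper hmean).of_norm
  have h := has_pointwise_sum_fourier_series_of_summable hsum (t : AddCircle (1 : ℝ))
  simp only [hcoef, fourier_coe_apply, smul_eq_mul] at h
  have e : f (t : AddCircle (1 : ℝ)) = (F t : ℂ) := by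
    simp [hf, Function.Periodic.lift_coe]
  rw [e] at h
  simpa [mul_assoc] using h

end Fourier

/-! ### The driven damped oscillator -/

section Oscillator

/-- The response of a damped oscillator. -/
def response (γ lam w : ℝ) : ℝ := 2 * γ * w ^ 2 / ((lam - w ^ 2) ^ 2 + 4 * γ ^ 2 * w ^ 2)

theorem response_denom_pos {γ lam : ℝ} (hγ : 0 < γ) (hlam : 0 < lam) (w : ℝ) :
    0 < (lam - w ^ 2) ^ 2 + 4 * γ ^ 2 * w ^ 2 := by
  by_cases h : w = 0
  · subst h
    simp only [ne_eq, OfNat.ofNat_ne_zero, not_false_eq_true, zero_pow, sub_zero, mul_zero,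
      add_zero]
    positivity
  · have : 0 < 4 * γ ^ 2 * w ^ 2 := by positivity
    have := sq_nonneg (lam - w ^ 2)
    linarith

/-- The quotient is the velocity response to a force of frequency `w`; its real part is the part in
phase with the force, which does work. -/
theorem re_response {γ lam : ℝ} (hγ : 0 < γ) (hlam : 0 < lam) (w : ℝ) :
    ((lam - w ^ 2 - 2 * γ * w * Complex.I : ℂ) ≠ 0) ∧
      (-(w * Complex.I) / (lam - w ^ 2 - 2 * γ * w * Complex.I : ℂ)).re = response γ lam w := by
  have hn : Complex.normSq (lam - w ^ 2 - 2 * γ * w * Complex.I : ℂ)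
      = (lam - w ^ 2) ^ 2 + 4 * γ ^ 2 * w ^ 2 := by
    rw [Complex.normSq_apply]
    simp [← Complex.ofReal_pow]
    ring
  refine ⟨fun h => ?_, ?_⟩
  · rw [h, map_zero] at hn
    linarith [response_denom_pos hγ hlam w]
  · rw [Complex.div_re, hn, response]
    simp [← Complex.ofReal_pow]
    ring

/-- The power absorbed by a damped oscillator from a periodic force. -/
theorem hasSum_oscillator {γ lam c A τ : ℝ} (hγ : 0 < γ) (hlam : 0 < lam) (hτ : 0 < τ)
    {F : ℝ → ℝ} (hF : ContDiff ℝ ∞ F) (hper : Function.Periodic F 1)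
    (hmean : ∫ t in (0 : ℝ)..1, F t = 0) {X Y : ℝ → ℝ} (hX : ContinuousOn X (Set.Icc 0 τ))
    (hY : ContinuousOn Y (Set.Icc 0 τ)) (hXτ : X τ = X 0) (hYτ : Y τ = Y 0)
    (hX' : ∀ t ∈ Set.Ioo 0 τ, HasDerivAt X (Y t) t)
    (hY' : ∀ t ∈ Set.Ioo 0 τ,
      HasDerivAt Y (-lam * X t - 2 * γ * Y t + c * (A * F (t / τ))) t) :
    HasSum (fun l : ℤ => c * A ^ 2 * ‖fourierCoef F l‖ ^ 2 * response γ lam (2 * Real.pi * l / τ))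
      (τ⁻¹ * ∫ t in (0 : ℝ)..τ, A * F (t / τ) * Y t) := by
  have hFc : Continuous fun t => F (t / τ) := hF.continuous.comp (continuous_id.div_const τ)
  have hY'c : ContinuousOn (fun t => -lam * X t - 2 * γ * Y t + c * (A * F (t / τ)))
      (Set.Icc 0 τ) :=
    ((continuousOn_const.mul hX).sub (continuousOn_const.mul hY)).add
      (continuousOn_const.mul (continuousOn_const.mul hFc.continuousOn))
  have hint : ∀ (κ : ℝ) {u : ℝ → ℝ}, ContinuousOn u (Set.Icc 0 τ) →
      IntervalIntegrable (fun t : ℝ => Complex.exp (κ * Complex.I * t) * (u t : ℂ))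
        volume 0 τ := by
    intro κ u hu
    refine ContinuousOn.intervalIntegrable ?_
    rw [Set.uIcc_of_le hτ.le]
    exact (continuous_exp_mul κ).continuousOn.mul (Complex.continuous_ofReal.comp_continuousOn hu)
  have hτ' : (τ : ℂ) ≠ 0 := Complex.ofReal_ne_zero.2 hτ.ne'
  -- The two equations of motion become algebraic: the coefficient of `Y` is `-iw` times that of
  -- `X`, and the latter solves `x (λ - w² - 2iγw) = τ c A F̂(-l)`. The index is `-l` because the
  -- exponential carries the sign `+`.
  have hcoefY : ∀ l : ℤ, ∫ t in (0 : ℝ)..τ,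
      Complex.exp (((2 * Real.pi * l / τ : ℝ) : ℂ) * Complex.I * t) * (Y t : ℂ)
      = τ * c * A * fourierCoef F (-l) * (-((2 * Real.pi * l / τ : ℝ) * Complex.I)
        / (lam - ((2 * Real.pi * l / τ : ℝ) : ℂ) ^ 2
          - 2 * γ * (2 * Real.pi * l / τ : ℝ) * Complex.I)) := by
    intro l
    set w : ℝ := 2 * Real.pi * l / τ with hw
    have hκ : Complex.exp (w * Complex.I * τ) = 1 := by
      rw [← exp_two_pi_int l]
      congr 1
      rw [hw]
      push_cast
      field_simp
    have e1 := integral_exp_mul_deriv hτ.le hκ hX hY hX' hXτ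
    have e2 := integral_exp_mul_deriv hτ.le hκ hY hY'c hY' hYτ
    have e3 : ∫ t in (0 : ℝ)..τ, Complex.exp (w * Complex.I * t) * ((F (t / τ) : ℝ) : ℂ)
        = τ * fourierCoef F (-l) := by
      have h1 := intervalIntegral.integral_comp_div (a := 0) (b := τ)
        (fun s : ℝ => Complex.exp (((2 * Real.pi * l : ℝ) : ℂ) * Complex.I * s) * (F s : ℂ)) hτ.ne'
      rw [zero_div, div_self hτ.ne'] at h1
      rw [fourierCoef_eq]
      have h2 : ((-(2 * Real.pi * ((-l : ℤ) : ℝ)) : ℝ) : ℂ) = ((2 * Real.pi * l : ℝ) : ℂ) := by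
        push_cast
        ring
      rw [h2]
      rw [Complex.real_smul] at h1
      rw [← h1]
      refine intervalIntegral.integral_congr fun t _ => ?_
      congr 2
      rw [hw]
      push_cast
      field_simp
    have e4 : ∫ t in (0 : ℝ)..τ, Complex.exp (w * Complex.I * t)
        * ((-lam * X t - 2 * γ * Y t + c * (A * F (t / τ)) : ℝ) : ℂ)
        = -lam * (∫ t in (0 : ℝ)..τ, Complex.exp (w * Complex.I * t) * (X t : ℂ))
          - 2 * γ * (∫ t in (0 : ℝ)..τ, Complex.exp (w * Complex.I * t) * (Y t : ℂ))
          + c * A * (τ * fourierCoef F (-l)) := by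
      rw [← e3, ← intervalIntegral.integral_const_mul, ← intervalIntegral.integral_const_mul,
        ← intervalIntegral.integral_const_mul, ← intervalIntegral.integral_sub
          ((hint w hX).const_mul _) ((hint w hY).const_mul _), ← intervalIntegral.integral_add
          (((hint w hX).const_mul _).sub ((hint w hY).const_mul _))
          ((hint w hFc.continuousOn).const_mul _)]
      refine intervalIntegral.integral_congr fun t _ => ?_
      push_cast
      ring
    rw [e4] at e2
    obtain ⟨hne, -⟩ := re_response hγ hlam w
    set x := ∫ t in (0 : ℝ)..τ, Complex.exp (w * Complex.I * t) * (X t : ℂ)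
    set y := ∫ t in (0 : ℝ)..τ, Complex.exp (w * Complex.I * t) * (Y t : ℂ)
    rw [e1] at e2 ⊢
    have hx : x * (lam - (w : ℂ) ^ 2 - 2 * γ * w * Complex.I)
        = τ * c * A * fourierCoef F (-l) := by
      linear_combination -e2 - (w : ℂ) ^ 2 * x * Complex.I_sq
    rw [← hx, mul_div_assoc', eq_div_iff hne]
    ring
  have hYi : IntervalIntegrable (fun t => (Y t : ℂ)) volume 0 τ := by
    refine ContinuousOn.intervalIntegrable ?_
    rw [Set.uIcc_of_le hτ.le]
    exact Complex.continuous_ofReal.comp_continuousOn hY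
  -- Parseval by hand: the force is expanded in its absolutely convergent Fourier series and
  -- integrated term by term against `Y`.
  have hsum : HasSum (fun l : ℤ => ∫ t in (0 : ℝ)..τ, A * fourierCoef F l
      * (Complex.exp (((2 * Real.pi * l / τ : ℝ) : ℂ) * Complex.I * t) * (Y t : ℂ)))
      (∫ t in (0 : ℝ)..τ, ((A * F (t / τ) * Y t : ℝ) : ℂ)) := by
    refine intervalIntegral.hasSum_integral_of_dominated_convergence
      (fun l t => |A| * ‖fourierCoef F l‖ * ‖(Y t : ℂ)‖) (fun l => ?_) (fun l => ?_) ?_ ?_ ?_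
    · exact ((hint _ hY).const_mul _).def'.aestronglyMeasurable
    · refine Eventually.of_forall fun t _ => ?_
      have : ((2 * Real.pi * l / τ : ℝ) : ℂ) * Complex.I * t
          = ((2 * Real.pi * l / τ * t : ℝ) : ℂ) * Complex.I := by
        push_cast
        ring
      rw [norm_mul, norm_mul, norm_mul, this, Complex.norm_exp_ofReal_mul_I, one_mul,
        Complex.norm_real, Real.norm_eq_abs]
    · exact Eventually.of_forall fun t _ =>
        ((summable_norm_fourierCoef hF hper hmean).mul_left _).mul_right _
    · simp only [tsum_mul_right]
      exact hYi.norm.const_mul _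
    · refine Eventually.of_forall fun t _ => ?_
      have h1 := ((hasSum_fourierCoef hF hper hmean (t / τ)).mul_left (A : ℂ)).mul_right (Y t : ℂ)
      push_cast
      have e : (fun l : ℤ => (A : ℂ) * fourierCoef F l
          * (Complex.exp (2 * Real.pi * l / τ * Complex.I * t) * (Y t : ℂ)))
          = fun l : ℤ => A * (fourierCoef F l
            * Complex.exp (2 * Real.pi * Complex.I * l * ((t / τ : ℝ) : ℂ))) * (Y t : ℂ) := by
        funext l
        have : (2 * Real.pi * l / τ : ℂ) * Complex.I * t
            = 2 * Real.pi * Complex.I * l * ((t / τ : ℝ) : ℂ) := by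
          push_cast
          ring
        rw [this]
        ring
      rw [e]
      exact h1
  have hsum2 := (hsum.mul_left ((τ⁻¹ : ℝ) : ℂ)).mapL Complex.reCLM
  convert hsum2 using 1
  · funext l
    rw [intervalIntegral.integral_const_mul, hcoefY l, fourierCoef_neg]
    rw [← (re_response hγ hlam (2 * Real.pi * l / τ)).2]
    set w : ℝ := 2 * Real.pi * l / τ with hw
    have e : ((τ⁻¹ : ℝ) : ℂ) * (A * fourierCoef F l * (τ * c * A * starRingEnd ℂ (fourierCoef F l)
        * (-(w * Complex.I) / (lam - (w : ℂ) ^ 2 - 2 * γ * w * Complex.I))))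
        = ((c * A ^ 2 * ‖fourierCoef F l‖ ^ 2 : ℝ) : ℂ)
          * (-(w * Complex.I) / (lam - (w : ℂ) ^ 2 - 2 * γ * w * Complex.I)) := by
      have h1 := Complex.mul_conj' (fourierCoef F l)
      have h2 : ((τ⁻¹ : ℝ) : ℂ) * τ = 1 := by
        rw [← Complex.ofReal_mul, inv_mul_cancel₀ hτ.ne', Complex.ofReal_one]
      push_cast at h1 h2 ⊢
      rw [← h1]
      linear_combination (A ^ 2 * c * (fourierCoef F l * starRingEnd ℂ (fourierCoef F l))
        * (-(w * Complex.I) / (lam - (w : ℂ) ^ 2 - 2 * γ * w * Complex.I))) * h2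
    rw [e]
    simp only [Complex.reCLM_apply, Complex.re_ofReal_mul]
  · rw [intervalIntegral.integral_ofReal, ← Complex.ofReal_mul]
    simp

end Oscillator

/-! ### Neumann normal modes -/

section Modes

/-- The wave number of the `j`-th normal mode. -/
def waveNumber (n j : ℕ) : ℝ := Real.pi * j / (2 * (n + 1))

/-- The `j`-th normal mode. -/
def mode (n j : ℕ) (x : Fin (n + 1)) : ℝ := Real.cos ((2 * x + 1) * waveNumber n j)

/-- The dispersion relation. -/
def dispersion (ν α : ℝ) : ℝ := ν ^ 2 + 4 * Real.sin α ^ 2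

theorem waveNumber_mul (n j : ℕ) : 2 * (n + 1) * waveNumber n j = j * Real.pi := by
  rw [waveNumber]
  field_simp

theorem cos_nat_mul_pi_add (j : ℕ) (α : ℝ) :
    Real.cos (j * Real.pi + α) = Real.cos (j * Real.pi) * Real.cos α := by
  rw [Real.cos_add, Real.sin_nat_mul_pi]
  ring

/-- The cosine is even about `x = -1/2` and, as `2(n + 1)` times the wave number is `jπ`, also about
`x = n + 1/2`. The Neumann conventions thus agree with its values at `-1` and `n + 1`, and the
trigonometric identity holds at every site. -/
theorem stiff_mode (ν : ℝ) (j : ℕ) (x : Fin (n + 1)) :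
    stiff ν (mode n j) x = dispersion ν (waveNumber n j) * mode n j x := by
  have hr : rightNbr (mode n j) x = Real.cos ((2 * x + 3) * waveNumber n j) := by
    by_cases h : x.val + 1 < n + 1
    · simp only [rightNbr, h, dif_pos, mode]
      congr 2
      push_cast
      ring
    · have hx : (x.val : ℝ) = n := by
        have : x.val = n := by omega
        exact_mod_cast this
      simp only [rightNbr, h, dif_neg, not_false_eq_true, mode, hx]
      have e1 : (2 * n + 3) * waveNumber n j = j * Real.pi + waveNumber n j := by
        rw [← waveNumber_mul]
        ring
      have e2 : (2 * n + 1) * waveNumber n j = j * Real.pi + -waveNumber n j := by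
        rw [← waveNumber_mul]
        ring
      rw [e1, e2, cos_nat_mul_pi_add, cos_nat_mul_pi_add, Real.cos_neg]
  have hl : leftNbr (mode n j) x = Real.cos ((2 * x - 1) * waveNumber n j) := by
    by_cases h : x.val = 0
    · simp only [leftNbr, h, if_true, mode, Nat.cast_zero]
      rw [← Real.cos_neg]
      congr 1
      ring
    · simp only [leftNbr, h, if_false, mode]
      rw [Nat.cast_sub (by omega)]
      congr 1
      push_cast
      ring
  rw [stiff_apply, neumannLaplacian, hr, hl, mode, dispersion]
  have e1 : (2 * (x : ℝ) + 3) * waveNumber n j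
      = (2 * x + 1) * waveNumber n j + 2 * waveNumber n j := by ring
  have e2 : (2 * (x : ℝ) - 1) * waveNumber n j
      = (2 * x + 1) * waveNumber n j - 2 * waveNumber n j := by ring
  rw [e1, e2, Real.cos_add, Real.cos_sub, Real.cos_two_mul, Real.cos_sq']
  ring

theorem mode_last_sq (n j : ℕ) :
    mode n j (Fin.last n) ^ 2 = Real.cos (waveNumber n j) ^ 2 := by
  have e : (2 * (n : ℝ) + 1) * waveNumber n j = j * Real.pi + -waveNumber n j := by
    rw [← waveNumber_mul]
    ring
  rw [mode, Fin.val_last, e, cos_nat_mul_pi_add, Real.cos_neg, mul_pow, Real.cos_sq',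
    Real.sin_nat_mul_pi]
  ring

/-- The coefficients of the Dirichlet kernel. -/
def dirichletWeight (j : ℕ) : ℝ := if j = 0 then 1 else 2

theorem dirichlet_sum (k : ℕ) (β : ℝ) :
    (∑ j ∈ Finset.range (k + 1), dirichletWeight j * Real.cos (j * β)) * Real.sin (β / 2)
      = Real.sin (k * β + β / 2) := by
  induction k with
  | zero => simp [dirichletWeight]
  | succ k ih =>
    rw [Finset.sum_range_succ, add_mul, ih, dirichletWeight, if_neg (Nat.succ_ne_zero k)]
    have e1 : (k : ℝ) * β + β / 2 = ((k + 1 : ℕ) : ℝ) * β - β / 2 := by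
      push_cast
      ring
    rw [e1, Real.sin_sub, Real.sin_add]
    ring

/-- With `β = πm/(n + 1)` the Dirichlet kernel has numerator `sin(mπ - β/2) = -(-1)^m sin(β/2)`. The
range of `m` keeps `sin(β/2)` from vanishing. -/
theorem dirichlet_sum_eq {n m : ℕ} (h0 : 0 < m) (hm : m < 2 * (n + 1)) :
    ∑ j ∈ Finset.range (n + 1), dirichletWeight j * Real.cos (2 * m * waveNumber n j)
      = -(-1) ^ m := by
  have h := dirichlet_sum n (Real.pi * m / (n + 1))
  have hs : Real.sin (Real.pi * m / (n + 1) / 2) ≠ 0 := by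
    refine (Real.sin_pos_of_pos_of_lt_pi (by positivity) ?_).ne'
    have : (m : ℝ) < 2 * (n + 1) := by exact_mod_cast hm
    rw [div_div, div_lt_iff₀ (by positivity)]
    nlinarith [Real.pi_pos]
  have e : (n : ℝ) * (Real.pi * m / (n + 1)) + Real.pi * m / (n + 1) / 2
      = m * Real.pi - Real.pi * m / (n + 1) / 2 := by
    field_simp
    ring
  rw [e, Real.sin_sub, Real.sin_nat_mul_pi, Real.cos_nat_mul_pi] at h
  refine mul_right_cancel₀ hs (Eq.trans ?_ (h.trans (by ring)))
  congr 1
  refine Finset.sum_congr rfl fun j _ => ?_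
  congr 2
  rw [waveNumber]
  field_simp

theorem sum_dirichletWeight (n : ℕ) :
    ∑ j ∈ Finset.range (n + 1), dirichletWeight j = 2 * n + 1 := by
  induction n with
  | zero => simp [dirichletWeight]
  | succ k ih =>
    rw [Finset.sum_range_succ, ih, dirichletWeight, if_neg (Nat.succ_ne_zero k)]
    push_cast
    ring

/-- Completeness of the normal modes, at the right end of the chain. -/
theorem sum_mode_last_mul_mode (x : Fin (n + 1)) :
    ∑ j ∈ Finset.range (n + 1), dirichletWeight j / (n + 1) * (mode n j (Fin.last n) * mode n j x)
      = if x = Fin.last n then 1 else 0 := by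
  have hx : x.val ≤ n := by omega
  -- Product to sum, with indices `n - x` and `n + x + 1`. They have opposite parity, so the two
  -- Dirichlet sums cancel unless `x = n`, when they are `2n + 1` and `1`.
  have e : ∀ j, dirichletWeight j / (n + 1) * (mode n j (Fin.last n) * mode n j x)
      = (2 * (n + 1 : ℝ))⁻¹ * (dirichletWeight j * Real.cos (2 * (n - x.val : ℕ) * waveNumber n j)
        + dirichletWeight j * Real.cos (2 * (n + x.val + 1 : ℕ) * waveNumber n j)) := by
    intro j
    have e1 : 2 * ((n - x.val : ℕ) : ℝ) * waveNumber n j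
        = (2 * n + 1) * waveNumber n j - (2 * x.val + 1) * waveNumber n j := by
      rw [Nat.cast_sub hx]
      ring
    have e2 : 2 * ((n + x.val + 1 : ℕ) : ℝ) * waveNumber n j
        = (2 * n + 1) * waveNumber n j + (2 * x.val + 1) * waveNumber n j := by
      push_cast
      ring
    rw [e1, e2, Real.cos_sub, Real.cos_add, mode, mode, Fin.val_last]
    field_simp
    ring
  simp only [e]
  rw [← Finset.mul_sum, Finset.sum_add_distrib, dirichlet_sum_eq (m := n + x.val + 1) (by omega)
    (by omega)]
  by_cases h : x = Fin.last n
  · subst h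
    simp only [Fin.val_last, Nat.sub_self, Nat.cast_zero, mul_zero, zero_mul,
      Real.cos_zero, mul_one, if_true, sum_dirichletWeight]
    rw [Odd.neg_one_pow ⟨n, by ring⟩]
    field_simp
    ring
  · have hlt : x.val < n := lt_of_le_of_ne hx fun hn => h (Fin.ext hn)
    rw [dirichlet_sum_eq (m := n - x.val) (by omega) (by omega), if_neg h]
    have : n + x.val + 1 = (n - x.val) + (2 * x.val + 1) := by omega
    rw [this, pow_add, Odd.neg_one_pow (n := 2 * x.val + 1) ⟨x.val, rfl⟩]
    ring

end Modes

/-! ### Power absorbed by the chain -/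

/-- The power absorbed by the chain from a periodic force. -/
theorem IsMeanPath.hasSum_power {ν γ τ A : ℝ} (hν : 0 < ν) (hγ : 0 < γ) (hτ : 0 < τ) {F : ℝ → ℝ}
    (hF : ContDiff ℝ ∞ F) (hper : Function.Periodic F 1) (hmean : ∫ t in (0 : ℝ)..1, F t = 0)
    {Q P : ℝ → Fin (n + 1) → ℝ} (h : IsMeanPath ν γ (fun t => A * F (t / τ)) τ Q P) :
    HasSum (fun l : ℤ => A ^ 2 * ‖fourierCoef F l‖ ^ 2 * ∑ j ∈ Finset.range (n + 1),
        dirichletWeight j / (n + 1) * Real.cos (waveNumber n j) ^ 2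
          * response γ (dispersion ν (waveNumber n j)) (2 * Real.pi * l / τ))
      (τ⁻¹ * ∫ t in (0 : ℝ)..τ, A * F (t / τ) * P t (Fin.last n)) := by
  have hcX : ∀ j, ContinuousOn (fun t => ∑ x, mode n j x * Q t x) (Set.Icc 0 τ) := fun j =>
    continuousOn_finsetSum _ fun x _ => continuousOn_const.mul (h.contQ x)
  have hcY : ∀ j, ContinuousOn (fun t => ∑ x, mode n j x * P t x) (Set.Icc 0 τ) := fun j =>
    continuousOn_finsetSum _ fun x _ => continuousOn_const.mul (h.contP x)
  have hmode : ∀ j, HasSum (fun l : ℤ => mode n j (Fin.last n) * A ^ 2 * ‖fourierCoef F l‖ ^ 2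
      * response γ (dispersion ν (waveNumber n j)) (2 * Real.pi * l / τ))
      (τ⁻¹ * ∫ t in (0 : ℝ)..τ, A * F (t / τ) * ∑ x, mode n j x * P t x) := by
    intro j
    refine hasSum_oscillator hγ (by unfold dispersion; positivity) hτ hF hper hmean
      (X := fun t => ∑ x, mode n j x * Q t x) (hcX j) (hcY j) ?_ ?_ ?_ ?_
    · simp only [h.perQ]
    · simp only [h.perP]
    · exact fun t ht => HasDerivAt.fun_sum fun x _ => (h.derivQ t ht x).const_mul _
    · intro t ht
      refine (HasDerivAt.fun_sum fun x _ => (h.derivP t ht x).const_mul (mode n j x)).congr_deriv ?_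
      have e1 : ∑ x, mode n j x * stiff ν (Q t) x
          = dispersion ν (waveNumber n j) * ∑ x, mode n j x * Q t x := by
        rw [sum_mul_stiff_comm, Finset.mul_sum]
        refine Finset.sum_congr rfl fun x _ => ?_
        rw [stiff_mode]
        ring
      have e2 : ∑ x, mode n j x * (A * F (t / τ) * (if x = Fin.last n then (1 : ℝ) else 0))
          = mode n j (Fin.last n) * (A * F (t / τ)) := by simp
      have e3 : ∑ x, mode n j x * (2 * γ * P t x) = 2 * γ * ∑ x, mode n j x * P t x := by
        rw [Finset.mul_sum]
        exact Finset.sum_congr rfl fun x _ => by ring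
      simp only [mul_add, mul_sub, Finset.sum_add_distrib, Finset.sum_sub_distrib, mul_neg,
        Finset.sum_neg_distrib]
      rw [e1, e2, e3]
      ring
  have hsum := hasSum_sum (s := Finset.range (n + 1)) fun j _ =>
    (hmode j).mul_left (dirichletWeight j / (n + 1) * mode n j (Fin.last n))
  have hl : ∀ l : ℤ, ∑ j ∈ Finset.range (n + 1), dirichletWeight j / (n + 1) * mode n j (Fin.last n)
        * (mode n j (Fin.last n) * A ^ 2 * ‖fourierCoef F l‖ ^ 2
          * response γ (dispersion ν (waveNumber n j)) (2 * Real.pi * l / τ))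
      = A ^ 2 * ‖fourierCoef F l‖ ^ 2 * ∑ j ∈ Finset.range (n + 1),
        dirichletWeight j / (n + 1) * Real.cos (waveNumber n j) ^ 2
          * response γ (dispersion ν (waveNumber n j)) (2 * Real.pi * l / τ) := by
    intro l
    rw [Finset.mul_sum]
    refine Finset.sum_congr rfl fun j _ => ?_
    rw [← mode_last_sq]
    ring
  simp only [hl] at hsum
  -- The momentum of the last particle is recovered from the modes. Completeness at this one site
  -- suffices, as both the force and the power sit there.
  have hP : ∀ t, ∑ j ∈ Finset.range (n + 1), dirichletWeight j / (n + 1) * mode n j (Fin.last n)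
      * (A * F (t / τ) * ∑ x, mode n j x * P t x) = A * F (t / τ) * P t (Fin.last n) := by
    intro t
    calc _ = A * F (t / τ) * ∑ x, (∑ j ∈ Finset.range (n + 1), dirichletWeight j / (n + 1)
          * (mode n j (Fin.last n) * mode n j x)) * P t x := by
          simp only [Finset.mul_sum, Finset.sum_mul]
          rw [Finset.sum_comm]
          refine Finset.sum_congr rfl fun x _ => Finset.sum_congr rfl fun j _ => by ring
      _ = _ := by simp [sum_mode_last_mul_mode]
  have hFc : Continuous fun t => F (t / τ) := hF.continuous.comp (continuous_id.div_const τ)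
  have hP' : (fun t => A * F (t / τ) * P t (Fin.last n)) = fun t =>
      ∑ j ∈ Finset.range (n + 1), dirichletWeight j / (n + 1) * mode n j (Fin.last n)
        * (A * F (t / τ) * ∑ x, mode n j x * P t x) := funext fun t => (hP t).symm
  have e : τ⁻¹ * ∫ t in (0 : ℝ)..τ, A * F (t / τ) * P t (Fin.last n)
      = ∑ j ∈ Finset.range (n + 1), dirichletWeight j / (n + 1) * mode n j (Fin.last n)
        * (τ⁻¹ * ∫ t in (0 : ℝ)..τ, A * F (t / τ) * ∑ x, mode n j x * P t x) := by
    rw [hP', intervalIntegral.integral_finsetSum, Finset.mul_sum]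
    · refine Finset.sum_congr rfl fun j _ => ?_
      rw [intervalIntegral.integral_const_mul]
      ring
    · intro j _
      refine IntervalIntegrable.const_mul (ContinuousOn.intervalIntegrable ?_) _
      rw [Set.uIcc_of_le hτ.le]
      exact (continuous_const.mul hFc).continuousOn.mul (hcY j)
  rw [e]
  exact hsum

/-! ### Riemann sums with a varying integrand -/

section Riemann

/-- A Riemann sum is the integral of a step function; in this form dominated convergence applies
even when `g` depends on `n`. -/
theorem sum_eq_integral_floor {g : ℝ → ℝ} {K : ℝ} (hg : Continuous g) (hK : ∀ z, |g z| ≤ K)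
    (n : ℕ) : ((n : ℝ) + 1)⁻¹ * ∑ j ∈ Finset.range (n + 1), g (j / (n + 1))
      = ∫ z in (0 : ℝ)..1, g (⌊z * ((n : ℝ) + 1)⌋₊ / (n + 1)) := by
  have hn : (0 : ℝ) < n + 1 := by positivity
  have hint : ∀ a b : ℝ,
      IntervalIntegrable (fun z : ℝ => g (⌊z * ((n : ℝ) + 1)⌋₊ / (n + 1))) volume a b := by
    intro a b
    refine (intervalIntegrable_const (c := K)).mono_fun (Measurable.aestronglyMeasurable ?_)
      (Eventually.of_forall fun z => (hK _).trans (le_abs_self K))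
    have h1 : Measurable fun z : ℝ => ⌊z * ((n : ℝ) + 1)⌋₊ :=
      Nat.measurable_floor.comp (measurable_id.mul_const _)
    have h2 : Measurable fun z : ℝ => (⌊z * ((n : ℝ) + 1)⌋₊ : ℝ) := measurable_from_nat.comp h1
    exact hg.measurable.comp (h2.div_const _)
  have h := intervalIntegral.sum_integral_adjacent_intervals (a := fun k : ℕ => (k : ℝ) / (n + 1))
    (n := n + 1) (μ := volume) (f := fun z : ℝ => g (⌊z * ((n : ℝ) + 1)⌋₊ / (n + 1)))
    fun k _ => hint _ _
  simp only [Nat.cast_zero, zero_div] at h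
  have h1 : (((n + 1 : ℕ) : ℝ) / (n + 1)) = 1 := by
    push_cast
    exact div_self hn.ne'
  rw [h1] at h
  rw [← h, Finset.mul_sum]
  refine Finset.sum_congr rfl fun k _ => ?_
  have hk : (k : ℝ) / (n + 1) ≤ ((k + 1 : ℕ) : ℝ) / (n + 1) := by
    gcongr
    exact Nat.le_succ k
  have e : ∫ z in (k : ℝ) / (n + 1)..((k + 1 : ℕ) : ℝ) / (n + 1),
      g (⌊z * ((n : ℝ) + 1)⌋₊ / (n + 1))
      = ∫ _ in (k : ℝ) / (n + 1)..((k + 1 : ℕ) : ℝ) / (n + 1), g (k / (n + 1)) := by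
    refine intervalIntegral.integral_congr_Ioo_of_le hk fun z hz => ?_
    have h2 : ⌊z * ((n : ℝ) + 1)⌋₊ = k := by
      have h3 := (div_lt_iff₀ hn).1 hz.1
      have h4 := (lt_div_iff₀ hn).1 hz.2
      push_cast at h4
      exact (Nat.floor_eq_iff ((Nat.cast_nonneg k).trans h3.le)).2 ⟨h3.le, h4⟩
    simp only [h2]
  rw [e, intervalIntegral.integral_const, smul_eq_mul]
  congr 1
  have : ((k + 1 : ℕ) : ℝ) = k + 1 := Nat.cast_succ k
  rw [this]
  field_simp
  ring

theorem tendsto_riemann_sum {g : ℕ → ℝ → ℝ} {G : ℝ → ℝ} {K : ℝ} (hg : ∀ n, Continuous (g n))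
    (hK : ∀ n z, |g n z| ≤ K)
    (hG : ∀ z, ∀ u : ℕ → ℝ, Tendsto u atTop (nhds z) →
      Tendsto (fun n => g n (u n)) atTop (nhds (G z))) :
    Tendsto (fun n : ℕ => ((n : ℝ) + 1)⁻¹ * ∑ j ∈ Finset.range (n + 1), g n (j / (n + 1))) atTop
      (nhds (∫ z in (0 : ℝ)..1, G z)) := by
  simp only [sum_eq_integral_floor (hg _) (hK _)]
  refine intervalIntegral.tendsto_integral_filter_of_dominated_convergence (fun _ => K)
    (Eventually.of_forall fun n => Measurable.aestronglyMeasurable ?_)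
    (Eventually.of_forall fun n => Eventually.of_forall fun z _ => hK n _)
    intervalIntegrable_const (Eventually.of_forall fun z hz => hG z _ ?_)
  · have h1 : Measurable fun z : ℝ => ⌊z * ((n : ℝ) + 1)⌋₊ :=
      Nat.measurable_floor.comp (measurable_id.mul_const _)
    have h2 : Measurable fun z : ℝ => (⌊z * ((n : ℝ) + 1)⌋₊ : ℝ) := measurable_from_nat.comp h1
    exact (hg n).measurable.comp (h2.div_const _)
  · rw [Set.uIoc_of_le zero_le_one] at hz
    exact (tendsto_nat_floor_mul_div_atTop hz.1.le).comp
      (tendsto_atTop_add_const_right atTop (1 : ℝ) tendsto_natCast_atTop_atTop)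

end Riemann

/-! ### Limit of the chain response -/

section Limit

variable {γ ν : ℝ}

/-- The resonance profile. -/
def profile (γ ν w z : ℝ) : ℝ :=
  Real.cos (Real.pi * z / 2) ^ 2 *
    ((dispersion ν (Real.pi * z / 2) - w ^ 2) ^ 2 + 4 * γ ^ 2 * w ^ 2)⁻¹

/-- Resonance is harmless. If `w² ≤ ν²/2`, the frequency lies below the spectrum and the first
square is at least `ν⁴/4`; otherwise the damping term is at least `2γ²ν²`. -/
theorem exists_inv_denom_le (hν : 0 < ν) (hγ : 0 < γ) :
    ∃ K, 0 < K ∧ ∀ α w, ((dispersion ν α - w ^ 2) ^ 2 + 4 * γ ^ 2 * w ^ 2)⁻¹ ≤ K := by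
  set κ := min (ν ^ 4 / 4) (2 * γ ^ 2 * ν ^ 2) with hκ
  have hκ0 : 0 < κ := lt_min (by positivity) (by positivity)
  refine ⟨κ⁻¹, inv_pos.2 hκ0, fun α w => inv_anti₀ hκ0 ?_⟩
  have hd : ν ^ 2 ≤ dispersion ν α := by
    unfold dispersion
    have := sq_nonneg (Real.sin α)
    linarith
  rcases le_total (w ^ 2) (ν ^ 2 / 2) with h | h
  · have h1 : (ν ^ 2 / 2) ^ 2 ≤ (dispersion ν α - w ^ 2) ^ 2 :=
      pow_le_pow_left₀ (by positivity) (by linarith) 2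
    have h2 : 0 ≤ 4 * γ ^ 2 * w ^ 2 := by positivity
    have h3 := min_le_left (ν ^ 4 / 4) (2 * γ ^ 2 * ν ^ 2)
    nlinarith
  · have h1 : 4 * γ ^ 2 * (ν ^ 2 / 2) ≤ 4 * γ ^ 2 * w ^ 2 := by gcongr
    have h2 := sq_nonneg (dispersion ν α - w ^ 2)
    have h3 := min_le_right (ν ^ 4 / 4) (2 * γ ^ 2 * ν ^ 2)
    linarith

theorem dispersion_pos (hν : 0 < ν) (α : ℝ) : 0 < dispersion ν α := by
  unfold dispersion
  positivity

theorem profile_nonneg (hν : 0 < ν) (hγ : 0 < γ) (w z : ℝ) : 0 ≤ profile γ ν w z :=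
  mul_nonneg (sq_nonneg _) (inv_nonneg.2 (response_denom_pos hγ (dispersion_pos hν _) w).le)

theorem profile_le {K : ℝ} (hν : 0 < ν) (hγ : 0 < γ)
    (hK : ∀ α w, ((dispersion ν α - w ^ 2) ^ 2 + 4 * γ ^ 2 * w ^ 2)⁻¹ ≤ K) (w z : ℝ) :
    profile γ ν w z ≤ K := by
  calc profile γ ν w z
      ≤ 1 * ((dispersion ν (Real.pi * z / 2) - w ^ 2) ^ 2 + 4 * γ ^ 2 * w ^ 2)⁻¹ :=
        mul_le_mul_of_nonneg_right (Real.cos_sq_le_one _)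
          (inv_nonneg.2 (response_denom_pos hγ (dispersion_pos hν _) w).le)
    _ ≤ K := by
        rw [one_mul]
        exact hK _ _

theorem continuous_profile (hν : 0 < ν) (hγ : 0 < γ) :
    Continuous fun wz : ℝ × ℝ => profile γ ν wz.1 wz.2 := by
  have h : ∀ wz : ℝ × ℝ, (ν ^ 2 + 4 * Real.sin (Real.pi * wz.2 / 2) ^ 2 - wz.1 ^ 2) ^ 2
      + 4 * γ ^ 2 * wz.1 ^ 2 ≠ 0 := fun wz =>
    (response_denom_pos hγ (dispersion_pos hν (Real.pi * wz.2 / 2)) wz.1).ne'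
  unfold profile dispersion
  fun_prop (disch := exact h _)

theorem continuous_profile_right (hν : 0 < ν) (hγ : 0 < γ) (w : ℝ) :
    Continuous (profile γ ν w) := by
  have h := (continuous_profile hν hγ).comp (Continuous.prodMk_right w)
  simpa only [Function.comp_def] using h

/-- The normalized response of the chain at the frequency `w`. -/
def chainResponse (γ ν : ℝ) (n : ℕ) (w : ℝ) : ℝ :=
  ∑ j ∈ Finset.range (n + 1), dirichletWeight j / (n + 1) * profile γ ν w (j / (n + 1))

theorem sum_response_eq (γ ν : ℝ) (n : ℕ) (w : ℝ) :
    ∑ j ∈ Finset.range (n + 1), dirichletWeight j / (n + 1) * Real.cos (waveNumber n j) ^ 2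
      * response γ (dispersion ν (waveNumber n j)) w = 2 * γ * w ^ 2 * chainResponse γ ν n w := by
  rw [chainResponse, Finset.mul_sum]
  refine Finset.sum_congr rfl fun j _ => ?_
  have e : Real.pi * ((j : ℝ) / (n + 1)) / 2 = waveNumber n j := by
    rw [waveNumber]
    field_simp
  rw [profile, e, response]
  ring

/-- The weights are `2` except at `j = 0`. The correction is `O(1/n)`, and the `2` turns the `2γ` of
the response into the `4γ` of the limiting coefficients. -/
theorem chainResponse_eq (γ ν : ℝ) (n : ℕ) (w : ℝ) :
    chainResponse γ ν n w
      = 2 * (((n : ℝ) + 1)⁻¹ * ∑ j ∈ Finset.range (n + 1), profile γ ν w (j / (n + 1)))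
        - ((n : ℝ) + 1)⁻¹ * profile γ ν w 0 := by
  rw [chainResponse, Finset.sum_range_succ', Finset.sum_range_succ']
  simp only [dirichletWeight, Nat.add_eq_zero_iff, one_ne_zero, and_false, if_false, if_true,
    Nat.cast_zero, zero_div]
  have : ∑ j ∈ Finset.range n, 2 / ((n : ℝ) + 1) * profile γ ν w (((j + 1 : ℕ) : ℝ) / (n + 1))
      = 2 * (((n : ℝ) + 1)⁻¹
        * ∑ j ∈ Finset.range n, profile γ ν w (((j + 1 : ℕ) : ℝ) / (n + 1))) := by
    rw [Finset.mul_sum, Finset.mul_sum]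
    exact Finset.sum_congr rfl fun j _ => by ring
  rw [this]
  ring

theorem chainResponse_nonneg (hν : 0 < ν) (hγ : 0 < γ) (n : ℕ) (w : ℝ) :
    0 ≤ chainResponse γ ν n w := by
  refine Finset.sum_nonneg fun j _ => mul_nonneg ?_ (profile_nonneg hν hγ _ _)
  unfold dirichletWeight
  split_ifs <;> positivity

theorem chainResponse_le {K : ℝ} (hν : 0 < ν) (hγ : 0 < γ)
    (hK : ∀ α w, ((dispersion ν α - w ^ 2) ^ 2 + 4 * γ ^ 2 * w ^ 2)⁻¹ ≤ K) (n : ℕ) (w : ℝ) :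
    chainResponse γ ν n w ≤ 2 * K := by
  have hn : (0 : ℝ) < n + 1 := by positivity
  rw [chainResponse_eq]
  have h1 : ∑ j ∈ Finset.range (n + 1), profile γ ν w (j / (n + 1)) ≤ (n + 1) * K := by
    refine (Finset.sum_le_sum fun j _ => profile_le hν hγ hK w _).trans_eq ?_
    simp
  have h2 := mul_le_mul_of_nonneg_left h1 (inv_pos.2 hn).le
  rw [inv_mul_cancel_left₀ hn.ne'] at h2
  have h3 : 0 ≤ ((n : ℝ) + 1)⁻¹ * profile γ ν w 0 :=
    mul_nonneg (inv_pos.2 hn).le (profile_nonneg hν hγ _ _)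
  linarith

theorem tendsto_chainResponse (hν : 0 < ν) (hγ : 0 < γ) {w : ℕ → ℝ} {W : ℝ}
    (hw : Tendsto w atTop (nhds W)) :
    Tendsto (fun n => chainResponse γ ν n (w n)) atTop
      (nhds (2 * ∫ z in (0 : ℝ)..1, profile γ ν W z)) := by
  obtain ⟨K, hK0, hK⟩ := exists_inv_denom_le hν hγ
  have hc := continuous_profile hν hγ
  have hbd : ∀ n z, |profile γ ν (w n) z| ≤ K := fun n z => by
    rw [abs_of_nonneg (profile_nonneg hν hγ _ _)]
    exact profile_le hν hγ hK _ _
  have hcomp : ∀ (z : ℝ) (u : ℕ → ℝ), Tendsto u atTop (nhds z) →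
      Tendsto (fun n => profile γ ν (w n) (u n)) atTop (nhds (profile γ ν W z)) := by
    intro z u hu
    have h1 : Tendsto (fun n => (w n, u n)) atTop (nhds (W, z)) := hw.prodMk_nhds hu
    have h2 : Tendsto (fun wz : ℝ × ℝ => profile γ ν wz.1 wz.2) (nhds (W, z))
      (nhds (profile γ ν W z)) := hc.tendsto (W, z)
    have h3 := h2.comp h1
    simpa only [Function.comp_def] using h3
  have h1 := tendsto_riemann_sum (g := fun n z => profile γ ν (w n) z)
    (G := fun z => profile γ ν W z) (fun n => continuous_profile_right hν hγ (w n)) hbd hcomp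
  have h2 : Tendsto (fun n : ℕ => ((n : ℝ) + 1)⁻¹ * profile γ ν (w n) 0) atTop (nhds 0) := by
    have h3 : Tendsto (fun n : ℕ => ((n : ℝ) + 1)⁻¹) atTop (nhds 0) :=
      tendsto_inv_atTop_zero.comp
        (tendsto_atTop_add_const_right atTop (1 : ℝ) tendsto_natCast_atTop_atTop)
    have h4 : Tendsto (fun n : ℕ => profile γ ν (w n) 0) atTop (nhds (profile γ ν W 0)) :=
      hcomp 0 _ tendsto_const_nhds
    have h5 := h3.mul h4
    rwa [zero_mul] at h5
  have h6 := (h1.const_mul 2).sub h2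
  rw [sub_zero] at h6
  exact h6.congr fun n => (chainResponse_eq γ ν n (w n)).symm

/-- The limiting frequency. -/
def limitFreq (θ b : ℝ) (l : ℤ) : ℝ := if b = 0 then 2 * Real.pi * l / θ else 0

/-- Both regimes are one formula: for `b > 0` the period diverges, and the profile is taken at
frequency `0`. -/
theorem currentCoef_eq (ν γ θ b : ℝ) (F : ℝ → ℝ) (l : ℤ) :
    currentCoef ν γ θ b F l = 4 * γ * ‖fourierCoef F l‖ ^ 2 *
      ∫ z in (0 : ℝ)..1, profile γ ν (limitFreq θ b l) z := by
  unfold currentCoef limitFreq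
  split_ifs with hb
  · congr 1
    refine intervalIntegral.integral_congr fun z _ => ?_
    simp only [profile, dispersion]
    congr 2
    ring
  · congr 1
    refine intervalIntegral.integral_congr fun z _ => ?_
    simp only [profile, dispersion]
    congr 2
    ring

theorem tendsto_freq (θ : ℝ) {b : ℝ} (hb : 0 ≤ b) (l : ℤ) :
    Tendsto (fun n : ℕ => 2 * Real.pi * l / period θ b n) atTop (nhds (limitFreq θ b l)) := by
  unfold limitFreq period
  split_ifs with h
  · subst h
    simp
  · have hb' : 0 < b := lt_of_le_of_ne hb (Ne.symm h)
    have h1 : Tendsto (fun n : ℕ => ((n : ℝ) ^ b)⁻¹) atTop (nhds 0) :=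
      tendsto_inv_atTop_zero.comp ((tendsto_rpow_atTop hb').comp tendsto_natCast_atTop_atTop)
    have h2 := h1.mul_const (2 * Real.pi * l / θ)
    rw [zero_mul] at h2
    refine h2.congr fun n => ?_
    field_simp

theorem integral_profile_bounds {K : ℝ} (hν : 0 < ν) (hγ : 0 < γ)
    (hK : ∀ α w, ((dispersion ν α - w ^ 2) ^ 2 + 4 * γ ^ 2 * w ^ 2)⁻¹ ≤ K) (w : ℝ) :
    0 ≤ ∫ z in (0 : ℝ)..1, profile γ ν w z ∧ ∫ z in (0 : ℝ)..1, profile γ ν w z ≤ K := by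
  refine ⟨intervalIntegral.integral_nonneg zero_le_one fun z _ => profile_nonneg hν hγ _ _, ?_⟩
  have hc := continuous_profile_right hν hγ w
  have := intervalIntegral.integral_mono_on (μ := volume) zero_le_one (hc.intervalIntegrable 0 1)
    (intervalIntegrable_const (c := K)) fun z _ => profile_le hν hγ hK w z
  simpa using this

theorem summable_sq_mul_currentCoef (hν : 0 < ν) (hγ : 0 < γ) (θ b : ℝ) {F : ℝ → ℝ}
    (hF : ContDiff ℝ ∞ F) (hper : Function.Periodic F 1)
    (hmean : ∫ t in (0 : ℝ)..1, F t = 0) :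
    Summable fun l : ℤ => (l : ℝ) ^ 2 * currentCoef ν γ θ b F l := by
  obtain ⟨K, hK0, hK⟩ := exists_inv_denom_le hν hγ
  refine ((summable_sq_mul_norm_fourierCoef_sq hF hper hmean).mul_left
    (4 * γ * K)).of_nonneg_of_le (fun l => ?_) fun l => ?_
  · rw [currentCoef_eq]
    have := (integral_profile_bounds hν hγ hK (limitFreq θ b l)).1
    positivity
  · rw [currentCoef_eq]
    have := (integral_profile_bounds hν hγ hK (limitFreq θ b l)).2
    calc _ = (l : ℝ) ^ 2 * (4 * γ * ‖fourierCoef F l‖ ^ 2)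
          * ∫ z in (0 : ℝ)..1, profile γ ν (limitFreq θ b l) z := by ring
      _ ≤ (l : ℝ) ^ 2 * (4 * γ * ‖fourierCoef F l‖ ^ 2) * K := by gcongr
      _ = _ := by ring

/-- Dominated convergence in `l`: the chain response is bounded uniformly in `n` and in the
frequency, and `l² |F̂(l)|²` is summable. -/
theorem tendsto_tsum_chainResponse (hν : 0 < ν) (hγ : 0 < γ) (θ : ℝ) {b : ℝ} (hb : 0 ≤ b)
    {F : ℝ → ℝ} (hF : ContDiff ℝ ∞ F) (hper : Function.Periodic F 1)
    (hmean : ∫ t in (0 : ℝ)..1, F t = 0) :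
    Tendsto (fun n : ℕ => ∑' l : ℤ, (2 * Real.pi / θ) ^ 2 * ((l : ℝ) ^ 2 * (‖fourierCoef F l‖ ^ 2
      * (2 * γ * chainResponse γ ν n (2 * Real.pi * l / period θ b n))))) atTop
      (nhds (-limitCurrent ν γ θ b F)) := by
  obtain ⟨K, hK0, hK⟩ := exists_inv_denom_le hν hγ
  have e : -limitCurrent ν γ θ b F = ∑' l : ℤ, (2 * Real.pi / θ) ^ 2 * ((l : ℝ) ^ 2
      * (‖fourierCoef F l‖ ^ 2 * (2 * γ
        * (2 * ∫ z in (0 : ℝ)..1, profile γ ν (limitFreq θ b l) z)))) := by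
    rw [limitCurrent, neg_mul, neg_neg, ← tsum_mul_left]
    refine tsum_congr fun l => ?_
    rw [currentCoef_eq]
    ring
  rw [e]
  refine tendsto_tsum_of_dominated_convergence
    ((summable_sq_mul_norm_fourierCoef_sq hF hper hmean).mul_left
      ((2 * Real.pi / θ) ^ 2 * (2 * γ * (2 * K)))) (fun l => ?_)
    (Eventually.of_forall fun n l => ?_)
  · exact ((((tendsto_chainResponse hν hγ (tendsto_freq θ hb l)).const_mul _).const_mul _).const_mul
      _).const_mul _
  · have h0 := chainResponse_nonneg hν hγ n (2 * Real.pi * l / period θ b n)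
    have h1 := chainResponse_le hν hγ hK n (2 * Real.pi * l / period θ b n)
    rw [Real.norm_of_nonneg (by positivity)]
    calc _ ≤ (2 * Real.pi / θ) ^ 2 * ((l : ℝ) ^ 2 * (‖fourierCoef F l‖ ^ 2
          * (2 * γ * (2 * K)))) := by gcongr
      _ = _ := by ring

end Limit

/-! ### Energy balance and scaling in `n` -/

section Main

variable {ν γ T θ a b : ℝ} {F : ℝ → ℝ}

theorem period_pos (hθ : 0 < θ) (b : ℝ) {n : ℕ} (hn : 1 ≤ n) : 0 < period θ b n :=
  mul_pos (Real.rpow_pos_of_pos (by exact_mod_cast hn) b) hθ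

theorem exists_abs_le_of_periodic (hF : Continuous F) (hper : Function.Periodic F 1) :
    ∃ K, ∀ t, |F t| ≤ K := by
  obtain ⟨K, hK⟩ := isCompact_Icc.exists_bound_of_continuousOn (s := Set.Icc (0 : ℝ) 1)
    hF.continuousOn
  refine ⟨K, fun t => ?_⟩
  obtain ⟨s, hs, e⟩ := hper.exists_mem_Ico₀ one_pos t
  rw [e]
  exact hK s ⟨hs.1, hs.2.le⟩

/-- The energy balance of a periodic state. -/
theorem IsPeriodicState.energy_balance (hν : 0 < ν) (hγ : 0 < γ) (hT : 0 < T) (hθ : 0 < θ)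
    (hF : ContDiff ℝ ∞ F) (hper : Function.Periodic F 1) (hmean : ∫ t in (0 : ℝ)..1, F t = 0)
    (hab : b - a = 1 / 2) (hn : 1 ≤ n) {μ : ℝ → Measure (Phase n)}
    (h : IsPeriodicState ν γ T θ a b F n μ) :
    (∀ t, 0 ≤ t → Integrable (fun z : Phase n => z.2 0 ^ 2) (μ t)) ∧
      IntervalIntegrable (fun t => ∫ z, z.2 0 ^ 2 ∂(μ t)) volume 0 (period θ b n) ∧
      T - timeAverage (period θ b n) μ (fun z => z.2 0 ^ 2) = -(1 / (2 * γ) * (1 / (n : ℝ)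
        * ∑' l : ℤ, (2 * Real.pi / θ) ^ 2 * ((l : ℝ) ^ 2 * (‖fourierCoef F l‖ ^ 2
          * (2 * γ * chainResponse γ ν n (2 * Real.pi * l / period θ b n)))))) := by
  have hτ := period_pos hθ b hn
  have hn0 : (0 : ℝ) < n := by exact_mod_cast hn
  have hFc : Continuous (force θ a b F n) :=
    continuous_const.mul (hF.continuous.comp (continuous_id.div_const _))
  obtain ⟨K, hK⟩ := exists_abs_le_of_periodic hF.continuous hper
  have hΦ : ∀ t, |force θ a b F n t| ≤ (n : ℝ) ^ a * K := by
    intro t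
    rw [force, abs_mul, abs_of_nonneg (by positivity)]
    exact mul_le_mul_of_nonneg_left (hK _) (by positivity)
  have hs : IsForcedState ν γ T (force θ a b F n) (period θ b n) μ :=
    ⟨h.prob, h.periodic, fun f hf hc t ht => h.forward f hf hc t ht⟩
  obtain ⟨h1, h2, Q, P, hQP, h3⟩ := hs.exists_isMeanPath hν hγ hT hτ hFc hΦ
  refine ⟨h1, h2, ?_⟩
  have hQP' : IsMeanPath ν γ (fun t => (n : ℝ) ^ a * F (t / period θ b n)) (period θ b n) Q P := hQP
  have h4 := hQP'.hasSum_power hν hγ hτ hF hper hmean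
  simp only [sum_response_eq] at h4
  -- The only use of `b - a = 1/2`: it makes the squared amplitude times the squared frequency
  -- exactly `1/n` times a constant.
  have h5 : (n : ℝ) ^ a * (n : ℝ) ^ a * n = (n : ℝ) ^ b * (n : ℝ) ^ b := by
    rw [← Real.rpow_add hn0, ← Real.rpow_add hn0, ← Real.rpow_add_one hn0.ne']
    congr 1
    linarith
  have h6 : ∀ l : ℤ, ((n : ℝ) ^ a) ^ 2 * ‖fourierCoef F l‖ ^ 2
      * (2 * γ * (2 * Real.pi * l / period θ b n) ^ 2
        * chainResponse γ ν n (2 * Real.pi * l / period θ b n))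
      = 1 / (n : ℝ) * ((2 * Real.pi / θ) ^ 2 * ((l : ℝ) ^ 2 * (‖fourierCoef F l‖ ^ 2
          * (2 * γ * chainResponse γ ν n (2 * Real.pi * l / period θ b n))))) := by
    intro l
    generalize chainResponse γ ν n (2 * Real.pi * l / period θ b n) = c
    have hb0 : 0 < (n : ℝ) ^ b := Real.rpow_pos_of_pos hn0 b
    rw [period]
    field_simp
    linear_combination (‖fourierCoef F l‖ ^ 2 * (l : ℝ) ^ 2 * c) * h5
  simp only [h6] at h4
  have h7 := h4.tsum_eq
  rw [tsum_mul_left] at h7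
  rw [timeAverage, h3, h7, mul_add, inv_mul_cancel_left₀ hτ.ne']
  have h8 : ∀ t, force θ a b F n t * P t (Fin.last n)
      = (n : ℝ) ^ a * F (t / period θ b n) * P t (Fin.last n) := fun t => rfl
  simp only [h8]
  ring

end Main

end HarmonicChain

end

theorem corollary3p3 (ω₀ γ T θ a b : ℝ) (hω : 0 < ω₀) (hγ : 0 < γ) (hT : 0 < T) (hθ : 0 < θ)
    (hab : b - a = 1 / 2) (ha : a ≤ 0) (hb : 0 ≤ b)
    (F : ℝ → ℝ) (hF : ContDiff ℝ ∞ F) (hper : Function.Periodic F 1)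
    (hmean : ∫ t in (0 : ℝ)..1, F t = 0) (hpos : 0 < ∫ t in (0 : ℝ)..1, F t ^ 2)
    (μ : (n : ℕ) → ℝ → Measure (HarmonicChain.Phase n))
    (hμ : ∀ n : ℕ, 1 ≤ n → HarmonicChain.IsPeriodicState ω₀ γ T θ a b F n (μ n)) :
    (∀ n : ℕ, 1 ≤ n →
      (∀ t : ℝ, 0 ≤ t → Integrable (fun z : HarmonicChain.Phase n => z.2 0 ^ 2) (μ n t)) ∧
      IntervalIntegrable (fun t => ∫ z, z.2 0 ^ 2 ∂(μ n t)) volume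
        0 (HarmonicChain.period θ b n)) ∧
    Summable (fun l : ℤ => (l : ℝ) ^ 2 * HarmonicChain.currentCoef ω₀ γ θ b F l) ∧
    (fun n : ℕ =>
        (T - HarmonicChain.timeAverage (HarmonicChain.period θ b n) (μ n) (fun z => z.2 0 ^ 2))
          - HarmonicChain.limitCurrent ω₀ γ θ b F / (2 * γ * n))
      =o[atTop] (fun n : ℕ => 1 / (n : ℝ)) := by
  have key := fun (n : ℕ) (hn : 1 ≤ n) =>
    (hμ n hn).energy_balance hω hγ hT hθ hF hper hmean hab hn
  refine ⟨fun n hn => ⟨(key n hn).1, (key n hn).2.1⟩,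
    HarmonicChain.summable_sq_mul_currentCoef hω hγ θ b hF hper hmean, ?_⟩
  have hlim := HarmonicChain.tendsto_tsum_chainResponse hω hγ θ hb hF hper hmean
  -- By the energy balance the error is exactly `1/n` times this null sequence, for `n ≥ 1`.
  have hzero := (hlim.add_const (HarmonicChain.limitCurrent ω₀ γ θ b F)).const_mul (-(1 / (2 * γ)))
  rw [neg_add_cancel, mul_zero] at hzero
  have hO := ((isLittleO_one_iff ℝ).2 hzero).mul_isBigO
    (isBigO_refl (fun n : ℕ => 1 / (n : ℝ)) atTop)
  simp only [one_mul] at hO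
  refine hO.congr' ?_ EventuallyEq.rfl
  filter_upwards [eventually_ge_atTop 1] with n hn
  rw [(key n hn).2.2]
  have hn0 : (n : ℝ) ≠ 0 := by
    have : n ≠ 0 := by omega
    exact_mod_cast this
  field_simp
  ring
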